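/- **Setting.** Let $S,A$ be finite nonempty sets (states, actions), $R\subset[0,1]$ a finite set of rewards, $\gamma\in(0,1)$, and for each $(s,a)\in S\times A$ let $\nu_{s,a}$ be a probability distribution on $R$ and $p_{s,a}$ a probability distribution on $S$. Fix $\delta>0$ and put $\mathcal P_{s,a}=\{p: D_{\mathrm{KL}}(p\|p_{s,a})\le\delta\}$, $\mathcal R_{s,a}=\{\nu: D_{\mathrm{KL}}(\nu\|\nu_{s,a})\le\delta\}$. Let $v^*$ be the unique solution of the robust Bellman equation $$v^*(s)=\max_{a\in A}\ \inf_{p\in\mathcal P_{s,a},\,\nu\in\mathcal R_{s,a}}\{E_{r\sim\nu}[r]+\gamma E_{s'\sim p}[v^*(s')]\},$$ and let $$q^*(s,a)=\inf_{p\in\mathcal P_{s,a},\,\nu\in\mathcal R_{s,a}}\{E_{r\sim\nu}[r]+\gamma E_{s'\sim p}[v^*(s')]\}.$$ Let $p_\wedge$ be the smallest positive value taken by any $\nu_{s,a}(r)$ or $p_{s,a}(s')$, and let $d=|S||A|\max(|S|,|R|)$. The $n$-sample empirical robust Bellman operator, built from independent samples $r_1,\dots,r_n\sim\nu_{s,a}$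 and $s'_1,\dots,s'_n\sim p_{s,a}$ for each $(s,a)$, is $$\mathbf T(q)(s,a)=\sup_{\alpha\ge0}\Big\{-\alpha\log\tfrac1n\sum_{i}e^{-r_i/\alpha}-\alpha\delta\Big\}+\gamma\sup_{\beta\ge0}\Big\{-\beta\log\tfrac1n\sum_{i}e^{-\max_b q(s'_i,b)/\beta}-\beta\delta\Big\},$$ where the objectives at $\alpha=0$ and $\beta=0$ are understood as limits. **Algorithm** (variance-reduced distributionally robust Q-learning). Put $\hat q_0\equiv0$. In epoch $l=1,\dots,l_{\mathrm{vr}}$, draw an $m_l$-sample empirical operator $\widetilde{\mathbf T}_l$, set $q_{l,1}=\hat q_{l-1}$, and for $k=1,\dots,k_{\mathrm{vr}}$ draw an $n_{\mathrm{vr}}$-sample empirical operator $\mathbf T_{l,k+1}$ and set $$q_{l,k+1}=(1-\lambda_k)q_{l,k}+\lambda_k\big(\mathbf T_{l,k+1}(q_{l,k})-\mathbf T_{l,k+1}(\hat q_{l-1})+\widetilde{\mathbf T}_l(\hat q_{l-1})\big),\qquad \lambda_k=\frac1{1+(1-\gamma)k};$$ finally put $\hat q_l=q_{l,k_{\mathrm{vr}}+1}$.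 All samples are independent. **Proposition.** There is an absolute constant $C>0$ such that the following holds for all $c_1,c_2,c_3\ge C$ and all models as above. Assume $0<\delta<-\log(1-\tfrac1{48}p_\wedge)$, $0<\epsilon<(1-\gamma)^{-1}$ and $0<\eta<1$, and choose $$k_{\mathrm{vr}}=\Big\lceil\frac{c_1}{(1-\gamma)^2}\Big\rceil,\quad l_{\mathrm{vr}}=\Big\lceil\log_2\frac1{\epsilon(1-\gamma)}\Big\rceil,\quad n_{\mathrm{vr}}=\Big\lceil\frac{c_2\log(8dk_{\mathrm{vr}}l_{\mathrm{vr}}/\eta)^4}{p_\wedge^3(1-\gamma)}\Big\rceil,\quad m_l=\Big\lceil\frac{c_3\,4^l\log(24d\,l_{\mathrm{vr}}/\eta)^2}{p_\wedge^3(1-\gamma)^2}\Big\rceil.$$ Then, with probability at least $1-\eta$, $\|\hat q_l-q^*\|_\infty\le2^{-l}(1-\gamma)^{-1}$ holds simultaneously for all $0\le l\le l_{\mathrm{vr}}$. In particular, $\|\hat q_{l_{\mathrm{vr}}}-q^*\|_\infty\le2^{-l_{\mathrm{vr}}}(1-\gamma)^{-1}$ with probability at least $1-\eta$. -/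

import Mathlib

open MeasureTheory ProbabilityTheory InformationTheory

universe u v w

noncomputable section

/-- A finite reference Markov decision process: a finite reward space `R ⊂ ℝ≥0`, reward
distributions `ν_{s,a}` on `R`, transition distributions `p_{s,a}` on `S`, and a discount factor
`γ ∈ (0,1)`. -/
structure RobustMDP (S : Type u) (A : Type v) where
  rewards : Finset ℝ
  rewards_nonneg : ∀ r ∈ rewards, 0 ≤ r
  ν : S → A → PMF rewards
  p : S → A → PMF S
  γ : ℝ
  γ_pos : 0 < γ
  γ_lt_one : γ < 1

/-- The expectation of `f` under a distribution on a finite set. -/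
def pmfExp {X : Type*} [Fintype X] (P : PMF X) (f : X → ℝ) : ℝ :=
  ∑ x, (P x).toReal * f x

/-- The KL uncertainty set `{P : D_KL(P ‖ P₀) ≤ δ}`. -/
def klBall {X : Type*} [MeasurableSpace X] (P₀ : PMF X) (δ : ℝ) : Set (PMF X) :=
  {P | klDiv P.toMeasure P₀.toMeasure ≤ ENNReal.ofReal δ}

theorem mem_klBall_self {X : Type*} [MeasurableSpace X] (P₀ : PMF X) (δ : ℝ) :
    P₀ ∈ klBall P₀ δ := by
  simp [klBall]

theorem sum_toReal_pmf {X : Type*} [Fintype X] (P : PMF X) : ∑ x, (P x).toReal = 1 := by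
  rw [← ENNReal.toReal_sum (fun x _ => P.apply_ne_top x), ← tsum_fintype (L := .unconditional X),
    P.tsum_coe]
  rfl

theorem pmfExp_sub_le {X : Type*} [Fintype X] (P : PMF X) (f g : X → ℝ) :
    pmfExp P f - pmfExp P g ≤ ‖f - g‖ := by
  unfold pmfExp
  rw [← Finset.sum_sub_distrib]
  calc ∑ x, ((P x).toReal * f x - (P x).toReal * g x)
      ≤ ∑ x, (P x).toReal * ‖f - g‖ := by
        refine Finset.sum_le_sum fun x _ => ?_
        rw [← mul_sub]
        exact mul_le_mul_of_nonneg_left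
          ((le_abs_self _).trans (norm_le_pi_norm (f - g) x)) ENNReal.toReal_nonneg
    _ = ‖f - g‖ := by rw [← Finset.sum_mul, sum_toReal_pmf, one_mul]

theorem neg_norm_le_pmfExp {X : Type*} [Fintype X] (P : PMF X) (f : X → ℝ) :
    -‖f‖ ≤ pmfExp P f := by
  have h := pmfExp_sub_le P 0 f
  have h0 : pmfExp P (0 : X → ℝ) = 0 := by simp [pmfExp]
  rw [h0, zero_sub, zero_sub, norm_neg] at h
  linarith

namespace RobustMDP

variable {S : Type u} {A : Type v} [Fintype S] [Fintype A] [MeasurableSpace S]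

/-- The worst-case one-step value
`inf {E_ν[r] + γ E_p[v] : D_KL(p ‖ p_{s,a}) ≤ δ, D_KL(ν ‖ ν_{s,a}) ≤ δ}`. -/
def robustBackup (M : RobustMDP S A) (δ : ℝ) (v : S → ℝ) (s : S) (a : A) : ℝ :=
  ⨅ x : klBall (M.p s a) δ × klBall (M.ν s a) δ,
    pmfExp x.2.1 (fun r => (r : ℝ)) + M.γ * pmfExp x.1.1 v

/-- The robust Bellman operator on value functions. -/
def bellmanV (M : RobustMDP S A) (δ : ℝ) (v : S → ℝ) : S → ℝ :=
  fun s => ⨆ a, M.robustBackup δ v s a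

theorem robustBackup_le (M : RobustMDP S A) (δ : ℝ) (v w : S → ℝ) (s : S) (a : A) :
    M.robustBackup δ v s a ≤ M.robustBackup δ w s a + M.γ * ‖v - w‖ := by
  unfold robustBackup
  have : Nonempty (klBall (M.p s a) δ × klBall (M.ν s a) δ) :=
    ⟨⟨⟨_, mem_klBall_self _ _⟩, ⟨_, mem_klBall_self _ _⟩⟩⟩
  rw [← sub_le_iff_le_add]
  refine le_ciInf fun x => ?_
  rw [sub_le_iff_le_add]
  refine (ciInf_le ?_ x).trans ?_
  · refine ⟨-‖fun r : M.rewards => (r : ℝ)‖ + M.γ * -‖v‖, ?_⟩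
    rintro _ ⟨y, rfl⟩
    exact add_le_add (neg_norm_le_pmfExp _ _)
      (mul_le_mul_of_nonneg_left (neg_norm_le_pmfExp _ _) M.γ_pos.le)
  · have := mul_le_mul_of_nonneg_left (pmfExp_sub_le x.1.1 v w) M.γ_pos.le
    linarith

theorem bellmanV_le [Nonempty A] (M : RobustMDP S A) (δ : ℝ) (v w : S → ℝ) (s : S) :
    M.bellmanV δ v s ≤ M.bellmanV δ w s + M.γ * ‖v - w‖ := by
  refine ciSup_le fun a => (M.robustBackup_le δ v w s a).trans ?_
  have := le_ciSup (Set.finite_range fun a => M.robustBackup δ w s a).bddAbove a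
  unfold bellmanV
  linarith

theorem bellmanV_contracting [Nonempty A] (M : RobustMDP S A) (δ : ℝ) :
    ContractingWith M.γ.toNNReal (M.bellmanV δ) := by
  refine ⟨by simpa using M.γ_lt_one, LipschitzWith.of_dist_le_mul fun v w => ?_⟩
  rw [Real.coe_toNNReal _ M.γ_pos.le, dist_eq_norm, dist_eq_norm,
    pi_norm_le_iff_of_nonneg (mul_nonneg M.γ_pos.le (norm_nonneg _))]
  intro s
  have h1 := M.bellmanV_le δ v w s
  have h2 := M.bellmanV_le δ w v s
  rw [norm_sub_rev w v] at h2
  rw [Real.norm_eq_abs, abs_le, Pi.sub_apply]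
  constructor <;> linarith

/-- The optimal robust value function `v*`: the unique fixed point of the robust Bellman
operator. -/
def vStar [Nonempty A] (M : RobustMDP S A) (δ : ℝ) : S → ℝ :=
  ContractingWith.fixedPoint (M.bellmanV δ) (M.bellmanV_contracting δ)

/-- The optimal robust `q`-function `q*`. -/
def qStar [Nonempty A] (M : RobustMDP S A) (δ : ℝ) : S → A → ℝ :=
  M.robustBackup δ (M.vStar δ)

/-- The minimal support probability `p_∧` of the reference model. -/
def minSupport (M : RobustMDP S A) : ℝ :=
  ⨅ x : S × A, min
    (⨅ r : {r : M.rewards // 0 < M.ν x.1 x.2 r}, (M.ν x.1 x.2 r.1).toReal)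
    (⨅ s' : {s' : S // 0 < M.p x.1 x.2 s'}, (M.p x.1 x.2 s'.1).toReal)

/-- `d = |S| |A| (|S| ∨ |R|)`. -/
def dimFactor (M : RobustMDP S A) : ℝ :=
  (Fintype.card S : ℝ) * Fintype.card A * max (Fintype.card S : ℝ) M.rewards.card

end RobustMDP

/-- The dual KL functional of the empirical measure of `x 0, …, x (n - 1)`,
`sup_α {-α log (n⁻¹ ∑ i, exp (-(x i) / α)) - α δ}`. The supremum is over `α > 0`: at `α = 0` the
objective means its limit as `α ↓ 0`, so including `α = 0` does not change the supremum. -/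
def empiricalDual (δ : ℝ) (n : ℕ) (x : ℕ → ℝ) : ℝ :=
  ⨆ α : Set.Ioi (0 : ℝ),
    (-(α : ℝ) * Real.log ((n : ℝ)⁻¹ * ∑ i ∈ Finset.range n, Real.exp (-(x i) / α)) - α * δ)

/-- Labels of the samples drawn from the simulator. `recenter l i s a` is the `i`-th sample for
`(s, a)` in the recentering operator of epoch `l`; `inner l k i s a` is the `i`-th sample for
`(s, a)` in the operator used in the `k`-th update of epoch `l`. -/
inductive SampleIdx (S : Type u) (A : Type v) : Type (max u v) where
  | recenter (l i : ℕ) (s : S) (a : A)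
  | inner (l k i : ℕ) (s : S) (a : A)

/-- The state of a sample label. -/
def SampleIdx.state {S : Type u} {A : Type v} : SampleIdx S A → S
  | .recenter _ _ s _ => s
  | .inner _ _ _ s _ => s

/-- The action of a sample label. -/
def SampleIdx.action {S : Type u} {A : Type v} : SampleIdx S A → A
  | .recenter _ _ _ a => a
  | .inner _ _ _ _ a => a

namespace RobustMDP

variable {S : Type u} {A : Type v}

/-- The empirical robust Bellman operator, in dual form, built from the first `n`
(reward, next state) samples `x 0 s a, …, x (n - 1) s a` for each `(s, a)`. Here
`v(q)(s') = max_b q(s', b)`. -/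
def empiricalBellman (M : RobustMDP S A) (δ : ℝ) (n : ℕ) (x : ℕ → S → A → M.rewards × S)
    (q : S → A → ℝ) : S → A → ℝ :=
  fun s a => empiricalDual δ n (fun i => ((x i s a).1 : ℝ))
    + M.γ * empiricalDual δ n (fun i => ⨆ b, q (x i s a).2 b)

/-- The inner loop of an epoch that starts at `q₀`, with recentering operator `Tc` and with `T k`
the operator used in the `k`-th update, `k ≥ 1`. The value at `k` is the iterate after `k` updates;
the step size of the `k`-th update is `1 / (1 + (1 - γ) k)`. -/
def innerLoop (γ : ℝ) (T : ℕ → (S → A → ℝ) → (S → A → ℝ)) (Tc : (S → A → ℝ) → (S → A → ℝ))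
    (q₀ : S → A → ℝ) : ℕ → (S → A → ℝ)
  | 0 => q₀
  | k + 1 =>
      (1 - 1 / (1 + (1 - γ) * ((k : ℝ) + 1))) • innerLoop γ T Tc q₀ k
        + (1 / (1 + (1 - γ) * ((k : ℝ) + 1))) •
          (T (k + 1) (innerLoop γ T Tc q₀ k) - T (k + 1) q₀ + Tc q₀)

/-- Variance-reduced robust Q-learning: the epoch iterates `q̂_0 = 0, q̂_1, q̂_2, …`, as a function of
the drawn samples `x`, with epoch length `kvr`, batch size `nvr` and recentering sample sizes
`m l`. -/
def vrIterate (M : RobustMDP S A) (δ : ℝ) (kvr nvr : ℕ) (m : ℕ → ℕ)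
    (x : SampleIdx S A → M.rewards × S) : ℕ → (S → A → ℝ)
  | 0 => 0
  | l + 1 =>
      innerLoop M.γ
        (fun k => M.empiricalBellman δ nvr (fun i s a => x (.inner (l + 1) k i s a)))
        (M.empiricalBellman δ (m (l + 1)) (fun i s a => x (.recenter (l + 1) i s a)))
        (vrIterate M δ kvr nvr m x l) kvr

variable [Fintype S] [Fintype A]

/-- The epoch length `k_vr = c₁ / (1 - γ)²`, rounded up. -/
def kVR (M : RobustMDP S A) (c₁ : ℝ) : ℕ :=
  ⌈c₁ / (1 - M.γ) ^ 2⌉₊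

/-- The number of epochs `l_vr = ⌈log₂ (1 / (ε (1 - γ)))⌉`. -/
def lVR (M : RobustMDP S A) (ε : ℝ) : ℕ :=
  ⌈Real.logb 2 (1 / (ε * (1 - M.γ)))⌉₊

/-- The batch size `n_vr = c₂ log(8 d k_vr l_vr / η)⁴ / (p_∧³ (1 - γ))`, rounded up. -/
def nVR (M : RobustMDP S A) (c₁ c₂ ε η : ℝ) : ℕ :=
  ⌈c₂ * Real.log (8 * M.dimFactor * M.kVR c₁ * M.lVR ε / η) ^ 4
    / (M.minSupport ^ 3 * (1 - M.γ))⌉₊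

/-- The recentering sample size `m_l = c₃ 4^l log(24 d l_vr / η)² / (p_∧³ (1 - γ)²)`, rounded
up. -/
def mVR (M : RobustMDP S A) (c₃ ε η : ℝ) (l : ℕ) : ℕ :=
  ⌈c₃ * 4 ^ l * Real.log (24 * M.dimFactor * M.lVR ε / η) ^ 2
    / (M.minSupport ^ 3 * (1 - M.γ) ^ 2)⌉₊

/-- The epoch iterate `q̂_l` under the above parameter choice. -/
def qHat (M : RobustMDP S A) (δ c₁ c₂ c₃ ε η : ℝ) (x : SampleIdx S A → M.rewards × S) (l : ℕ) :
    S → A → ℝ :=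
  M.vrIterate δ (M.kVR c₁) (M.nVR c₁ c₂ ε η) (M.mVR c₃ ε η) x l

end RobustMDP

end

/-! By KL duality q* is the fixed point of the γ-contraction T obtained by replacing each worst-case
expectation with its dual functional, and an empirical operator is the same formula with empirical
weights. It suffices that an epoch started at q̂ with ‖q̂ - q*‖ ≤ R = 2^(-l) / (1 - γ) ends within R
/ 2 outside an event of small probability; a union bound over epochs then finishes.

Write T_k for an inner operator and T' for the recentering one. One inner target minus q* is the sum
of T_k(q_k) - T_k(q*), which is at most γ times the current error; T_k(q*) - T_k(q̂) - (q* - T(q̂)),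
the sampling error of a difference; and T'(q̂) - T(q̂), the recentering error. The second term must
have size and mean controlled by R and not by 1 / (1 - γ), and this is the analytic core.

The minimiser in the primal problem is an exponential tilt of the reference weights μ, and it is a
supergradient of the concave map V ↦ `klDual δ μ V`. For δ ≤ p_∧ / 47 the centred tilt exponent is
bounded by 1 (`exists_tilt`). If μ is replaced by μ (1 + h) with |h| ≤ ε, the new tilt has density 1
+ M h + O(ε²) relative to the old one, with M linear and bounded uniformly in V
(`exists_worstCaseLinearization`). All remainders in the equation for the tilt parameter are
proportional to the variance v of the exponent, so nearly constant V cause no loss. Integrating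
supergradients along the segment from W to V shows that the error of the difference is at most 7 ε
‖V - W‖ (`abs_klDual_sub_sub_le`). Since M h has mean zero under sampling, its mean is only O(ε²) ‖V
- W‖ up to a small-probability term (`abs_setIntegral_klDual_sub_sub_le`).

With log factor x, the inner batches have ε of order √(1 - γ) / x. The centred noise, averaged with
the step sizes, is sub-Gaussian with variance proxy λ_k (ε R)² up to a constant, hence of order R /
√k. The bias and the recentering error are small multiples of (1 - γ) R. The recursion amplifies
such constant errors by 1 / (1 - γ), and K ≥ c₁ / (1 - γ)² makes the initial error and the noise
negligible (`norm_sub_noiseAvg_le`, `recursion_bound_le_half`). A bias of first order in ε would be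
too large for this batch size. The starting point q̂ of an epoch is random but independent of its
inner samples, so bounds for fixed q transfer to it (`measureReal_le_of_dependsOn`). -/

noncomputable section

set_option linter.unusedSectionVars false

/-! ### The dual KL functional and its worst-case distributions. -/

section KLDual

variable {X : Type*} [Fintype X]

/-- The dual KL functional `sup_{α > 0} {-α log E_w[exp (-V / α)] - α δ}` of a weight function on a
finite set. -/
def klDual (δ : ℝ) (w V : X → ℝ) : ℝ :=
  ⨆ α : Set.Ioi (0 : ℝ), (-(α : ℝ) * Real.log (∑ x, w x * Real.exp (-(V x) / α)) - α * δ)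

/-- The distribution `p` solves the primal problem `inf {E_p V : D_KL(p ‖ w) ≤ δ}`, expressed
through the dual functional. -/
structure IsWorstCase (δ : ℝ) (w V p : X → ℝ) : Prop where
  klDual_le : ∀ V', klDual δ w V' ≤ ∑ x, p x * V' x
  klDual_eq : klDual δ w V = ∑ x, p x * V x

theorem weighted_sum_le {p f g : X → ℝ} (hp : ∀ x, 0 ≤ p x) (h : ∀ x, p x ≠ 0 → f x ≤ g x) :
    ∑ x, p x * f x ≤ ∑ x, p x * g x := by
  refine Finset.sum_le_sum fun x _ => ?_
  by_cases hx : p x = 0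
  · simp [hx]
  · exact mul_le_mul_of_nonneg_left (h x hx) (hp x)

theorem weighted_sum_congr {p f g : X → ℝ} (h : ∀ x, p x ≠ 0 → f x = g x) :
    ∑ x, p x * f x = ∑ x, p x * g x := by
  refine Finset.sum_congr rfl fun x _ => ?_
  by_cases hx : p x = 0
  · simp [hx]
  · rw [h x hx]

theorem abs_weighted_sum_le {p f : X → ℝ} (hp : ∀ x, 0 ≤ p x) {g : X → ℝ}
    (h : ∀ x, p x ≠ 0 → |f x| ≤ g x) : |∑ x, p x * f x| ≤ ∑ x, p x * g x := by
  refine (Finset.abs_sum_le_sum_abs _ _).trans ?_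
  simp_rw [abs_mul, abs_of_nonneg (hp _)]
  exact weighted_sum_le hp h

theorem abs_weighted_sum_le_const {p f : X → ℝ} (hp : ∀ x, 0 ≤ p x) (hp1 : ∑ x, p x = 1) {c : ℝ}
    (h : ∀ x, p x ≠ 0 → |f x| ≤ c) : |∑ x, p x * f x| ≤ c := by
  refine (abs_weighted_sum_le hp h).trans ?_
  rw [← Finset.sum_mul, hp1, one_mul]

/-- The Gibbs variational inequality on a finite set. -/
theorem sum_sub_log_le_log_sum_exp {p w f : X → ℝ} (hp : ∀ x, 0 ≤ p x) (hp1 : ∑ x, p x = 1)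
    (hw : ∀ x, 0 ≤ w x) (hpw : ∀ x, p x ≠ 0 → w x ≠ 0) :
    ∑ x, p x * (f x - Real.log (p x / w x)) ≤ Real.log (∑ x, w x * Real.exp (f x)) := by
  set Z := ∑ x, w x * Real.exp (f x) with hZ
  have hZpos : 0 < Z := by
    obtain ⟨x, hx⟩ : ∃ x, p x ≠ 0 := by
      by_contra! h
      simp [h] at hp1
    refine Finset.sum_pos' (fun y _ => mul_nonneg (hw y) (Real.exp_pos _).le)
      ⟨x, Finset.mem_univ _, mul_pos ((hw x).lt_of_ne' (hpw x hx)) (Real.exp_pos _)⟩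
  have key : ∑ x, p x * (f x - Real.log (p x / w x) - Real.log Z)
      ≤ ∑ x, (w x * Real.exp (f x) / Z - p x) := by
    refine Finset.sum_le_sum fun x _ => ?_
    by_cases hx : p x = 0
    · simp only [hx, zero_mul, sub_zero]
      exact div_nonneg (mul_nonneg (hw x) (Real.exp_pos _).le) hZpos.le
    · have hpx := (hp x).lt_of_ne' hx
      have hwx := (hw x).lt_of_ne' (hpw x hx)
      have h1 : f x - Real.log (p x / w x) - Real.log Z
          = Real.log (w x * Real.exp (f x) / (p x * Z)) := by
        rw [Real.log_div hx hwx.ne', Real.log_div (by positivity) (by positivity),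
          Real.log_mul hwx.ne' (Real.exp_pos _).ne', Real.log_exp, Real.log_mul hx hZpos.ne']
        ring
      rw [h1]
      have h2 := Real.log_le_sub_one_of_pos
        (show 0 < w x * Real.exp (f x) / (p x * Z) by positivity)
      refine (mul_le_mul_of_nonneg_left h2 hpx.le).trans (le_of_eq ?_)
      field_simp
  rw [Finset.sum_sub_distrib, hp1, ← Finset.sum_div, ← hZ, div_self hZpos.ne', sub_self] at key
  simp_rw [mul_sub _ _ (Real.log Z)] at key
  rw [Finset.sum_sub_distrib, ← Finset.sum_mul, hp1, one_mul] at key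
  linarith

/-- Weak duality: the Gibbs inequality with f = -V / α, multiplied by α. -/
theorem klDual_objective_le {δ : ℝ} {p w : X → ℝ} (hp : ∀ x, 0 ≤ p x) (hp1 : ∑ x, p x = 1)
    (hw : ∀ x, 0 ≤ w x) (hpw : ∀ x, p x ≠ 0 → w x ≠ 0)
    (hkl : ∑ x, p x * Real.log (p x / w x) ≤ δ) (V : X → ℝ) {α : ℝ} (hα : 0 < α) :
    -α * Real.log (∑ x, w x * Real.exp (-(V x) / α)) - α * δ ≤ ∑ x, p x * V x := by
  have h := sum_sub_log_le_log_sum_exp (f := fun x => -(V x) / α) hp hp1 hw hpw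
  simp_rw [mul_sub] at h
  rw [Finset.sum_sub_distrib] at h
  have h2 : ∑ x, p x * (-(V x) / α) = -(∑ x, p x * V x) / α := by
    rw [neg_div, Finset.sum_div, ← Finset.sum_neg_distrib]
    exact Finset.sum_congr rfl fun x _ => by ring
  rw [h2] at h
  have h3 := mul_le_mul_of_nonneg_left (h.trans' (sub_le_sub_left hkl _)) hα.le
  rw [mul_sub, mul_div_cancel₀ _ hα.ne'] at h3
  linarith

instance : Nonempty (Set.Ioi (0 : ℝ)) := ⟨⟨1, Set.mem_Ioi.2 one_pos⟩⟩

theorem klDual_le_of_kl_le {δ : ℝ} {p w : X → ℝ} (hp : ∀ x, 0 ≤ p x) (hp1 : ∑ x, p x = 1)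
    (hw : ∀ x, 0 ≤ w x) (hpw : ∀ x, p x ≠ 0 → w x ≠ 0)
    (hkl : ∑ x, p x * Real.log (p x / w x) ≤ δ) (V : X → ℝ) :
    klDual δ w V ≤ ∑ x, p x * V x :=
  ciSup_le fun α => klDual_objective_le hp hp1 hw hpw hkl V α.2

theorem bddAbove_klDual_objective {δ : ℝ} (hδ : 0 ≤ δ) {w : X → ℝ} (hw : ∀ x, 0 ≤ w x)
    (hw1 : ∑ x, w x = 1) (V : X → ℝ) :
    BddAbove (Set.range fun α : Set.Ioi (0 : ℝ) =>
      (-(α : ℝ) * Real.log (∑ x, w x * Real.exp (-(V x) / α)) - α * δ)) := by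
  refine ⟨∑ x, w x * V x, ?_⟩
  rintro _ ⟨α, rfl⟩
  refine klDual_objective_le hw hw1 hw (fun _ h => h) ?_ V α.2
  refine (Finset.sum_nonpos fun x _ => ?_).trans hδ
  by_cases hx : w x = 0 <;> simp [hx]

/-- Exponential tilts on the boundary of the KL ball are worst-case distributions. -/
theorem isWorstCase_of_tilt {δ : ℝ} (hδ : 0 ≤ δ) {w p V : X → ℝ} (hw : ∀ x, 0 ≤ w x)
    (hw1 : ∑ x, w x = 1)
    {b τ : ℝ} (hτ : 0 < τ) (hp : ∀ x, p x = w x * Real.exp (b - τ * V x)) (hp1 : ∑ x, p x = 1)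
    (hkl : ∑ x, p x * (b - τ * V x) = δ) : IsWorstCase δ w V p := by
  have hp0 : ∀ x, 0 ≤ p x := fun x => by
    rw [hp]; exact mul_nonneg (hw x) (Real.exp_pos _).le
  have hpw : ∀ x, p x ≠ 0 → w x ≠ 0 := fun x hx h => hx (by rw [hp, h, zero_mul])
  have hle : ∀ V', klDual δ w V' ≤ ∑ x, p x * V' x := by
    refine klDual_le_of_kl_le hp0 hp1 hw hpw (le_of_eq ?_)
    rw [← hkl]
    refine weighted_sum_congr fun x hx => ?_
    rw [hp, mul_div_cancel_left₀ _ (hpw x hx), Real.log_exp]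
  refine ⟨hle, (hle V).antisymm ?_⟩
  have hmem : τ⁻¹ ∈ Set.Ioi (0 : ℝ) := inv_pos.2 hτ
  -- The dual objective at α = 1 / τ, the reciprocal of the tilt parameter, equals the primal value.
  refine le_trans (le_of_eq ?_) (le_ciSup (bddAbove_klDual_objective hδ hw hw1 V) ⟨τ⁻¹, hmem⟩)
  have hZ : ∑ x, w x * Real.exp (-(V x) / τ⁻¹) = Real.exp (-b) := by
    have : ∀ x, w x * Real.exp (-(V x) / τ⁻¹) = p x * Real.exp (-b) := fun x => by
      rw [hp, mul_assoc, ← Real.exp_add, div_inv_eq_mul]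
      congr 2; ring
    simp_rw [this]
    rw [← Finset.sum_mul, hp1, one_mul]
  have hk : b - τ * ∑ x, p x * V x = δ := by
    rw [← hkl]
    simp_rw [mul_sub]
    rw [Finset.sum_sub_distrib, ← Finset.sum_mul, hp1, one_mul, Finset.mul_sum]
    congr 1
    exact Finset.sum_congr rfl fun x _ => by ring
  simp only [hZ, Real.log_exp]
  rw [← hk]
  field_simp
  ring

/-- If `V` is constant on the support then the reference distribution is a worst case. -/
theorem isWorstCase_self_of_const {δ : ℝ} (hδ : 0 ≤ δ) {w V : X → ℝ} (hw : ∀ x, 0 ≤ w x)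
    (hw1 : ∑ x, w x = 1) {c : ℝ} (hV : ∀ x, w x ≠ 0 → V x = c) : IsWorstCase δ w V w := by
  have hle : ∀ V', klDual δ w V' ≤ ∑ x, w x * V' x := by
    refine klDual_le_of_kl_le hw hw1 hw (fun _ h => h) ?_
    refine (Finset.sum_nonpos fun x _ => ?_).trans hδ
    by_cases hx : w x = 0 <;> simp [hx]
  refine ⟨hle, (hle V).antisymm ?_⟩
  have hsum : ∑ x, w x * V x = c := by
    rw [weighted_sum_congr hV, ← Finset.sum_mul, hw1, one_mul]
  rw [hsum]
  refine le_of_forall_pos_sub_le fun ε hε => ?_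
  -- For constant V the objective is c - α δ, whose supremum is only approached as α ↓ 0; this α
  -- loses at most ε.
  have hα : 0 < ε / (δ + 1) := by positivity
  refine le_trans ?_ (le_ciSup (bddAbove_klDual_objective hδ hw hw1 V) ⟨_, hα⟩)
  have hZ : ∑ x, w x * Real.exp (-(V x) / (ε / (δ + 1))) = Real.exp (-c / (ε / (δ + 1))) := by
    rw [weighted_sum_congr (g := fun _ => Real.exp (-c / (ε / (δ + 1))))
      (fun x hx => by rw [hV x hx]), ← Finset.sum_mul, hw1, one_mul]
  simp only [hZ, Real.log_exp]
  have h1 : ε / (δ + 1) * δ ≤ ε := by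
    rw [div_mul_eq_mul_div, div_le_iff₀ (by positivity)]
    nlinarith
  have h2 : -(ε / (δ + 1)) * (-c / (ε / (δ + 1))) = c := by field_simp
  rw [h2]
  linarith

/-- For each fixed α the objective is monotone in V and shifts by c when V does, so it is
1-Lipschitz; a supremum keeps this. -/
theorem klDual_le_add_norm {δ : ℝ} (hδ : 0 ≤ δ) {w : X → ℝ} (hw : ∀ x, 0 ≤ w x)
    (hw1 : ∑ x, w x = 1) (V V' : X → ℝ) : klDual δ w V ≤ klDual δ w V' + ‖V - V'‖ := by
  refine ciSup_le fun α => ?_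
  have hα : (0 : ℝ) < α := α.2
  rw [← sub_le_iff_le_add]
  refine le_trans ?_ (le_ciSup (bddAbove_klDual_objective hδ hw hw1 V') α)
  have hpos : ∀ U : X → ℝ, 0 < ∑ x, w x * Real.exp (-(U x) / α) := by
    intro U
    obtain ⟨x, hx⟩ : ∃ x, w x ≠ 0 := by
      by_contra! h
      simp [h] at hw1
    exact Finset.sum_pos' (fun y _ => mul_nonneg (hw y) (Real.exp_pos _).le)
      ⟨x, Finset.mem_univ _, mul_pos ((hw x).lt_of_ne' hx) (Real.exp_pos _)⟩
  have h1 : ∑ x, w x * Real.exp (-(V' x) / α)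
      ≤ Real.exp (‖V - V'‖ / α) * ∑ x, w x * Real.exp (-(V x) / α) := by
    rw [Finset.mul_sum]
    refine Finset.sum_le_sum fun x _ => ?_
    rw [mul_left_comm, ← Real.exp_add]
    refine mul_le_mul_of_nonneg_left (Real.exp_le_exp.2 ?_) (hw x)
    rw [← add_div]
    have := (le_abs_self _).trans (norm_le_pi_norm (V - V') x)
    rw [Pi.sub_apply] at this
    gcongr
    linarith
  have h2 := Real.log_le_log (hpos V') h1
  rw [Real.log_mul (Real.exp_pos _).ne' (hpos V).ne', Real.log_exp] at h2
  have h3 := mul_le_mul_of_nonneg_left h2 hα.le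
  rw [mul_add, mul_div_cancel₀ _ hα.ne'] at h3
  linarith

theorem abs_klDual_sub_le {δ : ℝ} (hδ : 0 ≤ δ) {w : X → ℝ} (hw : ∀ x, 0 ≤ w x)
    (hw1 : ∑ x, w x = 1) (V V' : X → ℝ) : |klDual δ w V - klDual δ w V'| ≤ ‖V - V'‖ := by
  have h1 := klDual_le_add_norm hδ hw hw1 V V'
  have h2 := klDual_le_add_norm hδ hw hw1 V' V
  rw [norm_sub_rev] at h2
  rw [abs_le]
  constructor <;> linarith

theorem klDual_zero {δ : ℝ} (hδ : 0 ≤ δ) {w : X → ℝ} (hw : ∀ x, 0 ≤ w x)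
    (hw1 : ∑ x, w x = 1) : klDual δ w 0 = 0 := by
  rw [(isWorstCase_self_of_const hδ hw hw1 (V := 0) (c := 0) fun _ _ => rfl).klDual_eq]
  simp

end KLDual

/-! ### Empirical distributions. -/

/-- The empirical distribution of `z 0, …, z (n - 1)`. -/
def empWeight {X : Type*} (n : ℕ) (z : ℕ → X) (x : X) : ℝ :=
  open Classical in (n : ℝ)⁻¹ * ∑ i ∈ Finset.range n, if z i = x then 1 else 0

theorem empWeight_nonneg {X : Type*} (n : ℕ) (z : ℕ → X) (x : X) : 0 ≤ empWeight n z x := by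
  unfold empWeight
  refine mul_nonneg (by positivity) (Finset.sum_nonneg fun i _ => ?_)
  split_ifs <;> norm_num

theorem sum_empWeight_mul {X : Type*} [Fintype X] (n : ℕ) (z : ℕ → X) (f : X → ℝ) :
    ∑ x, empWeight n z x * f x = (n : ℝ)⁻¹ * ∑ i ∈ Finset.range n, f (z i) := by
  classical
  unfold empWeight
  simp_rw [mul_assoc, ← Finset.mul_sum, Finset.sum_mul]
  rw [Finset.sum_comm]
  simp

theorem sum_empWeight {X : Type*} [Fintype X] {n : ℕ} (hn : n ≠ 0) (z : ℕ → X) :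
    ∑ x, empWeight n z x = 1 := by
  have := sum_empWeight_mul n z (fun _ : X => (1 : ℝ))
  simp only [mul_one, Finset.sum_const, Finset.card_range, nsmul_eq_mul] at this
  rw [this, inv_mul_cancel₀ (by exact_mod_cast hn)]

theorem empiricalDual_eq_klDual {X : Type*} [Fintype X] (δ : ℝ) (n : ℕ) (z : ℕ → X) (V : X → ℝ) :
    empiricalDual δ n (fun i => V (z i)) = klDual δ (empWeight n z) V := by
  unfold empiricalDual klDual
  refine iSup_congr fun α => ?_
  rw [sum_empWeight_mul n z fun x => Real.exp (-(V x) / α)]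

/-! ### Exponential tilts and their perturbation. -/

section Tilt

/-- Taylor expansion of a function vanishing to second order at 0; it bounds the divergence of a
tilt below by a variance. -/
theorem sq_div_four_le_mul_exp_sub {y : ℝ} (hy : |y| ≤ 1 / 2) :
    y ^ 2 / 4 ≤ y * Real.exp y - Real.exp y + 1 := by
  have h := Real.exp_bound (x := y) (by linarith) (n := 4) (by norm_num)
  simp only [Finset.sum_range_succ, Finset.sum_range_zero, Nat.factorial] at h
  rw [Even.pow_abs (by decide)] at h
  norm_num at h
  have h1 := (abs_le.1 h).2
  obtain ⟨h2, h3⟩ := abs_le.1 hy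
  have h4 : (1 - y) * (Real.exp y) ≤ (1 - y) * (1 + y + y ^ 2 / 2 + y ^ 3 / 6 + y ^ 4 * (5 / 96)) :=
    mul_le_mul_of_nonneg_left (by linarith) (by linarith)
  have h5 : 0 ≤ y ^ 2 * ((1 / 2 + y) * (1 / 3) + 1 / 12 + y ^ 2 * (1 / 6 - 5 / 96 * (1 - y))) := by
    refine mul_nonneg (sq_nonneg _) ?_
    have : 0 ≤ y ^ 2 * (1 / 6 - 5 / 96 * (1 - y)) := mul_nonneg (sq_nonneg _) (by linarith)
    linarith
  nlinarith

theorem exp_sub_one_sub_id_le {y : ℝ} (hy : |y| ≤ 1 / 2) :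
    Real.exp y - 1 - y ≤ 11 / 18 * y ^ 2 := by
  have h := Real.exp_bound (x := y) (by linarith) (n := 3) (by norm_num)
  simp only [Finset.sum_range_succ, Finset.sum_range_zero, Nat.factorial] at h
  norm_num at h
  have h1 := (abs_le.1 h).2
  have h2 : |y| ^ 3 ≤ y ^ 2 * (1 / 2) := by
    rw [pow_succ, sq_abs]
    exact mul_le_mul_of_nonneg_left hy (sq_nonneg _)
  linarith

theorem abs_exp_sub_one_le_two_mul {u : ℝ} (hu : |u| ≤ 1) : |Real.exp u - 1| ≤ 2 * |u| :=
  Real.abs_exp_sub_one_le hu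

theorem abs_exp_mul_sub_one_add_one_le {u : ℝ} (hu : |u| ≤ 1) :
    |Real.exp u * (u - 1) + 1| ≤ u ^ 2 := by
  have h0 : 0 ≤ Real.exp u * (u - 1) + 1 := by
    have h1 := Real.add_one_le_exp (-u)
    have h2 : Real.exp u * Real.exp (-u) = 1 := by rw [← Real.exp_add]; simp
    nlinarith [Real.exp_pos u]
  rw [abs_of_nonneg h0]
  obtain ⟨h2, h3⟩ := abs_le.1 hu
  have h4 : 1 + u ≤ Real.exp u := by linarith [Real.add_one_le_exp u]
  nlinarith

/-- Comes from 1 - 1 / z ≤ log z ≤ z - 1 after multiplication by z. -/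
theorem abs_mul_log_sub_le {z : ℝ} (hz : 0 < z) : |z * Real.log z - (z - 1)| ≤ (z - 1) ^ 2 := by
  have h1 := mul_le_mul_of_nonneg_left (Real.log_le_sub_one_of_pos hz) hz.le
  have h2 := mul_le_mul_of_nonneg_left (Real.one_sub_inv_le_log_of_pos hz) hz.le
  rw [mul_sub, mul_inv_cancel₀ hz.ne'] at h2
  rw [abs_le]
  constructor <;> nlinarith

variable {X : Type*} [Fintype X]

/-- The divergence from μ of the tilt of μ by exp (-t V) depends continuously on t and vanishes at t
= 0. At the largest t for which the exponents are guaranteed to stay within 1 / 2 it already exceeds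
pm / 47, so it equals δ somewhere before. The constant c centres the exponent under the tilted law,
which accounts for both displayed identities. -/
theorem exists_tilt {μ V : X → ℝ} {δ pm : ℝ} (hμ : ∀ x, 0 ≤ μ x) (hμ1 : ∑ x, μ x = 1)
    (hpm : 0 < pm) (hμpm : ∀ x, μ x ≠ 0 → pm ≤ μ x) (hδ : 0 < δ) (hδpm : δ ≤ pm / 47)
    (hV : ¬ ∃ c, ∀ x, μ x ≠ 0 → V x = c) :
    ∃ t > 0, ∃ c, (∀ x, μ x ≠ 0 → |c - t * V x| ≤ 1) ∧
      ∑ x, μ x * Real.exp (c - t * V x) = Real.exp (-δ) ∧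
      ∑ x, μ x * Real.exp (c - t * V x) * (c - t * V x) = 0 := by
  set m := ∑ x, μ x * V x with hm
  set U : X → ℝ := fun x => V x - m with hU
  have hU0 : ∑ x, μ x * U x = 0 := by
    simp only [hU, mul_sub]
    rw [Finset.sum_sub_distrib, ← Finset.sum_mul, hμ1, ← hm]; ring
  set σ := ∑ x, μ x * U x ^ 2 with hσ
  have hterm : ∀ x, μ x ≠ 0 → pm * U x ^ 2 ≤ σ := fun x hx =>
    (mul_le_mul_of_nonneg_right (hμpm x hx) (sq_nonneg _)).trans
      (Finset.single_le_sum (f := fun x => μ x * U x ^ 2)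
        (fun y _ => mul_nonneg (hμ y) (sq_nonneg _)) (Finset.mem_univ x))
  obtain ⟨x0, hx0, hVx0⟩ : ∃ x, μ x ≠ 0 ∧ V x ≠ m := by
    by_contra! h
    exact hV ⟨m, h⟩
  have hσ0 : 0 < σ := (mul_pos hpm (pow_pos (abs_pos.2 (sub_ne_zero.2 hVx0)) 2)).trans_le
    (by rw [sq_abs]; exact hterm x0 hx0)
  have hpm1 : pm ≤ 1 := (hμpm x0 hx0).trans
    (hμ1 ▸ Finset.single_le_sum (f := μ) (fun y _ => hμ y) (Finset.mem_univ x0))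
  -- A support point has mass at least pm, so U² ≤ σ / pm there; hence |t1 U| ≤ 1 / 2, while the
  -- variance of t1 U is pm / 4.
  set t1 := Real.sqrt (pm / σ) / 2 with ht1
  have ht1pos : 0 < t1 := by positivity
  have ht1sq : t1 ^ 2 * σ = pm / 4 := by
    rw [ht1, div_pow, Real.sq_sqrt (by positivity)]; field_simp; norm_num
  have hyb : ∀ t, 0 ≤ t → t ≤ t1 → ∀ x, μ x ≠ 0 → |-(t * U x)| ≤ 1 / 2 := by
    intro t ht htt x hx
    rw [abs_neg]
    refine abs_le_of_sq_le_sq ?_ (by norm_num)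
    have h1 : t ^ 2 ≤ t1 ^ 2 := pow_le_pow_left₀ ht htt 2
    have h2 : pm * (t * U x) ^ 2 ≤ pm * (1 / 2) ^ 2 := by
      calc pm * (t * U x) ^ 2 = t ^ 2 * (pm * U x ^ 2) := by ring
        _ ≤ t1 ^ 2 * σ := mul_le_mul h1 (hterm x hx) (by positivity) (by positivity)
        _ = _ := by rw [ht1sq]; ring
    exact le_of_mul_le_mul_left h2 hpm
  set Z : ℝ → ℝ := fun t => ∑ x, μ x * Real.exp (-(t * U x)) with hZ
  set N : ℝ → ℝ := fun t => ∑ x, μ x * Real.exp (-(t * U x)) * (-(t * U x)) with hN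
  have hZpos : ∀ t, 0 < Z t := fun t =>
    Finset.sum_pos' (fun y _ => mul_nonneg (hμ y) (Real.exp_pos _).le)
      ⟨x0, Finset.mem_univ _, mul_pos ((hμ x0).lt_of_ne' hx0) (Real.exp_pos _)⟩
  have hZc : Continuous Z := by fun_prop
  have hNc : Continuous N := by fun_prop
  -- N / Z - log Z is the divergence of the tilted law from μ.
  have hgc : Continuous fun t => N t / Z t - Real.log (Z t) :=
    (hNc.div hZc fun t => (hZpos t).ne').sub (hZc.log fun t => (hZpos t).ne')
  have hg0 : N 0 / Z 0 - Real.log (Z 0) = 0 := by simp [hN, hZ, hμ1]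
  have hsum1 : ∑ x, μ x * (-(t1 * U x)) = 0 := by
    have : ∀ x, μ x * (-(t1 * U x)) = -t1 * (μ x * U x) := fun x => by ring
    simp_rw [this, ← Finset.mul_sum, hU0, mul_zero]
  have hsum2 : ∑ x, μ x * (-(t1 * U x)) ^ 2 = pm / 4 := by
    have : ∀ x, μ x * (-(t1 * U x)) ^ 2 = t1 ^ 2 * (μ x * U x ^ 2) := fun x => by ring
    simp_rw [this, ← Finset.mul_sum, ← hσ, ht1sq]
  have hg1 : δ ≤ N t1 / Z t1 - Real.log (Z t1) := by
    have hb := hyb t1 ht1pos.le le_rfl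
    have e1 : N t1 - Z t1 + 1 ≥ pm / 16 := by
      have h := weighted_sum_le (p := μ) hμ (fun x hx => sq_div_four_le_mul_exp_sub (hb x hx))
      have h1 : ∑ x, μ x * ((-(t1 * U x)) ^ 2 / 4) = pm / 16 := by
        simp_rw [← mul_div_assoc, ← Finset.sum_div, hsum2]; ring
      have h2 : ∑ x, μ x * (-(t1 * U x) * Real.exp (-(t1 * U x)) - Real.exp (-(t1 * U x)) + 1)
          = N t1 - Z t1 + 1 := by
        refine Eq.trans ?_ (congrArg (N t1 - Z t1 + ·) hμ1)
        simp only [hN, hZ]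
        rw [← Finset.sum_sub_distrib, ← Finset.sum_add_distrib]
        exact Finset.sum_congr rfl fun x _ => by ring
      linarith
    have e2 : Z t1 - 1 ≤ 11 / 72 * pm := by
      have h := weighted_sum_le (p := μ) hμ (fun x hx => exp_sub_one_sub_id_le (hb x hx))
      have h1 : ∑ x, μ x * (11 / 18 * (-(t1 * U x)) ^ 2) = 11 / 72 * pm := by
        simp_rw [mul_left_comm (μ _), ← Finset.mul_sum, hsum2]; ring
      have h2 : ∑ x, μ x * (Real.exp (-(t1 * U x)) - 1 - -(t1 * U x)) = Z t1 - 1 := by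
        simp_rw [mul_sub]
        rw [Finset.sum_sub_distrib, Finset.sum_sub_distrib, hsum1]
        simp [hZ, hμ1]
      linarith
    have e3 : 1 ≤ Z t1 := by
      have h := weighted_sum_le (p := μ) hμ
        (fun x _ => Real.add_one_le_exp (-(t1 * U x)))
      simp_rw [mul_add, mul_one] at h
      rw [Finset.sum_add_distrib, hsum1, hμ1] at h
      linarith
    have e4 := (abs_le.1 (abs_mul_log_sub_le (hZpos t1))).2
    have e5 : Real.log (Z t1) = Z t1 * Real.log (Z t1) / Z t1 := by
      rw [mul_div_cancel_left₀ _ (hZpos t1).ne']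
    rw [e5, ← sub_div, le_div_iff₀ (hZpos t1)]
    have e6 : (Z t1 - 1) ^ 2 ≤ (11 / 72 * pm) ^ 2 := pow_le_pow_left₀ (by linarith) e2 2
    have e7 : δ * Z t1 ≤ pm / 47 * (1 + 11 / 72) :=
      mul_le_mul hδpm (by linarith) (hZpos t1).le (by positivity)
    nlinarith
  obtain ⟨t, ht, htδ⟩ := intermediate_value_Icc ht1pos.le hgc.continuousOn
    (show δ ∈ Set.Icc _ _ from ⟨by rw [hg0]; exact hδ.le, hg1⟩)
  have htpos : 0 < t := by
    refine ht.1.lt_of_ne fun h => ?_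
    simp only [← h, hg0] at htδ
    exact hδ.ne htδ
  have hNZ : |N t / Z t| ≤ 1 / 2 := by
    rw [abs_div, abs_of_pos (hZpos t), div_le_iff₀ (hZpos t), hZ, Finset.mul_sum]
    refine (abs_weighted_sum_le (p := fun x => μ x * Real.exp (-(t * U x)))
      (g := fun _ => 1 / 2) (fun x => mul_nonneg (hμ x) (Real.exp_pos _).le)
      fun x hx => hyb t ht.1 ht.2 x (left_ne_zero_of_mul hx)).trans (le_of_eq ?_)
    exact Finset.sum_congr rfl fun x _ => mul_comm _ _
  have hYeq : ∀ x, t * m - N t / Z t - t * V x = -(t * U x) - N t / Z t := fun x => by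
    simp only [hU]; ring
  refine ⟨t, htpos, t * m - N t / Z t, fun x hx => ?_, ?_, ?_⟩
  · rw [hYeq]
    exact (abs_sub _ _).trans (by linarith [hyb t ht.1 ht.2 x hx])
  · simp_rw [hYeq, Real.exp_sub, ← mul_div_assoc, ← Finset.sum_div]
    rw [← htδ, neg_sub, Real.exp_sub, Real.exp_log (hZpos t)]
  · simp_rw [hYeq, Real.exp_sub]
    have : ∀ x, μ x * (Real.exp (-(t * U x)) / Real.exp (N t / Z t)) * (-(t * U x) - N t / Z t)
        = (μ x * Real.exp (-(t * U x)) * (-(t * U x)) - μ x * Real.exp (-(t * U x)) * (N t / Z t))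
          / Real.exp (N t / Z t) := fun x => by ring
    simp_rw [this]
    rw [← Finset.sum_div, Finset.sum_sub_distrib, ← Finset.sum_mul]
    change (N t - Z t * (N t / Z t)) / _ = 0
    rw [mul_div_cancel₀ _ (hZpos t).ne', sub_self, zero_div]

/-- The hypotheses on a centred tilt exponent `Y` of `p` and on a perturbation `1 + h`. -/
structure TiltPerturb (p Y h : X → ℝ) (ε : ℝ) : Prop where
  nonneg : ∀ x, 0 ≤ p x
  sum_eq : ∑ x, p x = 1
  mean_eq : ∑ x, p x * Y x = 0
  abs_le_one : ∀ x, p x ≠ 0 → |Y x| ≤ 1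
  var_pos : 0 < ∑ x, p x * Y x ^ 2
  eps_nonneg : 0 ≤ ε
  eps_le : ε ≤ 1 / 25
  abs_le_eps : ∀ x, |h x| ≤ ε
  orth : ∑ x, p x * (h x * Real.exp (-(Y x))) = 0

namespace TiltPerturb

variable {p Y h : X → ℝ} {ε ρ : ℝ}

theorem abs_mul_le (H : TiltPerturb p Y h ε) (hρ : |ρ| ≤ 2 * ε) {x : X} (hx : p x ≠ 0) :
    |ρ * Y x| ≤ 2 * ε := by
  rw [abs_mul]
  have := H.abs_le_one x hx
  have := H.eps_nonneg
  calc |ρ| * |Y x| ≤ 2 * ε * 1 := mul_le_mul hρ ‹_› (abs_nonneg _) (by linarith)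
    _ = _ := mul_one _

omit [Fintype X] in
theorem sq_mul_le (hρ : |ρ| ≤ 2 * ε) (x : X) : (ρ * Y x) ^ 2 ≤ 4 * ε ^ 2 * Y x ^ 2 := by
  rw [mul_pow]
  have h1 : ρ ^ 2 ≤ (2 * ε) ^ 2 := sq_le_sq' (by linarith [(abs_le.1 hρ).1]) (abs_le.1 hρ).2
  nlinarith [sq_nonneg (Y x)]

theorem partition_pos (H : TiltPerturb p Y h ε) (ρ : ℝ) :
    0 < ∑ x, p x * ((1 + h x) * Real.exp (ρ * Y x)) := by
  have h1 : ∀ x, 0 < (1 + h x) * Real.exp (ρ * Y x) := fun x =>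
    mul_pos (by linarith [(abs_le.1 (H.abs_le_eps x)).1, H.eps_le]) (Real.exp_pos _)
  obtain ⟨x, hx⟩ : ∃ x, p x ≠ 0 := by
    by_contra! h
    simpa [h] using H.sum_eq
  exact Finset.sum_pos' (fun y _ => mul_nonneg (H.nonneg y) (h1 y).le)
    ⟨x, Finset.mem_univ _, mul_pos ((H.nonneg x).lt_of_ne' hx) (h1 x)⟩

/-- By `orth` and `mean_eq` the terms of first order cancel up to factors |Y|, so |Z - 1| ≤ 3 ε
E|Y|; Jensen's inequality turns the square into a multiple of the variance. -/
theorem partition_sub_one_sq_le (H : TiltPerturb p Y h ε) (hρ : |ρ| ≤ 2 * ε) :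
    (∑ x, p x * ((1 + h x) * Real.exp (ρ * Y x)) - 1) ^ 2 ≤ 9 * ε ^ 2 * ∑ x, p x * Y x ^ 2 := by
  have hε := H.eps_nonneg
  have hε' := H.eps_le
  have hsq : ∀ B : ℝ, ∑ x, p x * (|Y x| - B) ^ 2
      = ∑ x, p x * Y x ^ 2 - 2 * B * ∑ x, p x * |Y x| + B ^ 2 * ∑ x, p x := by
    intro B
    rw [Finset.mul_sum, Finset.mul_sum, ← Finset.sum_sub_distrib, ← Finset.sum_add_distrib]
    refine Finset.sum_congr rfl fun x _ => ?_
    rw [← sq_abs (Y x)]; ring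
  set A := ∑ x, p x * |Y x| with hA
  have hA0 : 0 ≤ A := Finset.sum_nonneg fun x _ => mul_nonneg (H.nonneg x) (abs_nonneg _)
  have hAv : A ^ 2 ≤ ∑ x, p x * Y x ^ 2 := by
    have h0 : 0 ≤ ∑ x, p x * (|Y x| - A) ^ 2 :=
      Finset.sum_nonneg fun x _ => mul_nonneg (H.nonneg x) (sq_nonneg _)
    have h1 := hsq A
    rw [H.sum_eq] at h1
    nlinarith
  -- Subtracting the zero sums of h e^(-Y) and ρ Y leaves three terms, each O(ε |Y|).
  have hid : ∑ x, p x * ((1 + h x) * Real.exp (ρ * Y x)) - 1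
      = ∑ x, p x * (h x * (1 - Real.exp (-(Y x))) + h x * (Real.exp (ρ * Y x) - 1)
        + (Real.exp (ρ * Y x) - 1 - ρ * Y x)) := by
    have h1 : ∑ x, p x * (h x * (1 - Real.exp (-(Y x))) + h x * (Real.exp (ρ * Y x) - 1)
        + (Real.exp (ρ * Y x) - 1 - ρ * Y x))
        = ∑ x, p x * ((1 + h x) * Real.exp (ρ * Y x)) - ∑ x, p x * (h x * Real.exp (-(Y x)))
          - ∑ x, p x - ρ * ∑ x, p x * Y x := by
      rw [Finset.mul_sum, ← Finset.sum_sub_distrib, ← Finset.sum_sub_distrib,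
        ← Finset.sum_sub_distrib]
      exact Finset.sum_congr rfl fun x _ => by ring
    rw [h1, H.orth, H.sum_eq, H.mean_eq]; ring
  have hbound : |∑ x, p x * ((1 + h x) * Real.exp (ρ * Y x)) - 1| ≤ 3 * ε * A := by
    rw [hid]
    refine (abs_weighted_sum_le H.nonneg (g := fun x => 3 * ε * |Y x|) fun x hx => ?_).trans
      (le_of_eq ?_)
    · have hY := H.abs_le_one x hx
      have hu := H.abs_mul_le hρ hx
      have hu1 : |ρ * Y x| ≤ 1 := hu.trans (by linarith)
      have b1 : |1 - Real.exp (-(Y x))| ≤ 2 * |Y x| := by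
        rw [abs_sub_comm, ← abs_neg (Y x)]
        exact abs_exp_sub_one_le_two_mul (by rwa [abs_neg])
      have b2 := abs_exp_sub_one_le_two_mul hu1
      have b3 := Real.abs_exp_sub_one_sub_id_le hu1
      have hρY : |ρ * Y x| ≤ 2 * ε * |Y x| := by
        rw [abs_mul]; exact mul_le_mul_of_nonneg_right hρ (abs_nonneg _)
      have b4 : (ρ * Y x) ^ 2 ≤ 2 * ε * (2 * ε * |Y x|) := by
        rw [← sq_abs, sq]
        exact mul_le_mul hu hρY (abs_nonneg _) (by linarith)
      have hh := H.abs_le_eps x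
      have c1 : |h x * (1 - Real.exp (-(Y x)))| ≤ ε * (2 * |Y x|) := by
        rw [abs_mul]; exact mul_le_mul hh b1 (abs_nonneg _) hε
      have c2 : |h x * (Real.exp (ρ * Y x) - 1)| ≤ ε * (2 * (2 * ε * |Y x|)) := by
        rw [abs_mul]; exact mul_le_mul hh (b2.trans (by linarith)) (abs_nonneg _) hε
      have c3 := (abs_add_three (h x * (1 - Real.exp (-(Y x)))) (h x * (Real.exp (ρ * Y x) - 1))
        (Real.exp (ρ * Y x) - 1 - ρ * Y x))
      have c4 : ε * |Y x| * ε ≤ ε * |Y x| * (1 / 25) :=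
        mul_le_mul_of_nonneg_left hε' (by positivity)
      nlinarith [abs_nonneg (Y x), mul_nonneg hε (abs_nonneg (Y x))]
    · rw [hA, Finset.mul_sum]
      exact Finset.sum_congr rfl fun x _ => by ring
  have := sq_le_sq' (by linarith [(abs_le.1 hbound).1]) (abs_le.1 hbound).2
  nlinarith [sq_nonneg ε]

/-- The tilt p (1 + h) e^(ρ Y) / Z lies on the boundary of the KL ball around μ (1 + h) exactly when
(1 + ρ) E[(1 + h) e^(ρ Y) Y] = Z log Z. This is the linearization of that equation in (ρ, h). The
remainder carries the factor v, so dividing by v to solve for ρ costs nothing. -/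
theorem abs_residual_le (H : TiltPerturb p Y h ε) (hρ : |ρ| ≤ 2 * ε) :
    |(1 + ρ) * ∑ x, p x * ((1 + h x) * Real.exp (ρ * Y x) * Y x)
        - (∑ x, p x * ((1 + h x) * Real.exp (ρ * Y x)))
          * Real.log (∑ x, p x * ((1 + h x) * Real.exp (ρ * Y x)))
        - (ρ * ∑ x, p x * Y x ^ 2 + ∑ x, p x * (h x * (Y x - 1 + Real.exp (-(Y x)))))|
      ≤ 25 * ε ^ 2 * ∑ x, p x * Y x ^ 2 := by
  have hε := H.eps_nonneg
  have hε' := H.eps_le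
  set Z := ∑ x, p x * ((1 + h x) * Real.exp (ρ * Y x)) with hZ
  set v := ∑ x, p x * Y x ^ 2 with hv
  set D1 := ∑ x, p x * (Y x * (h x * (Real.exp (ρ * Y x) - 1)
    + (Real.exp (ρ * Y x) - 1 - ρ * Y x))) with hD1
  set D2 := ∑ x, p x * ((1 + h x) * (Real.exp (ρ * Y x) * (ρ * Y x - 1) + 1)) with hD2
  have e1 : |D1| ≤ 8 * ε ^ 2 * v := by
    refine (abs_weighted_sum_le H.nonneg (g := fun x => 8 * ε ^ 2 * Y x ^ 2)
      fun x hx => ?_).trans (le_of_eq ?_)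
    · have hY := H.abs_le_one x hx
      have hu1 : |ρ * Y x| ≤ 1 := (H.abs_mul_le hρ hx).trans (by linarith)
      have b2 := abs_exp_sub_one_le_two_mul hu1
      have b3 := (Real.abs_exp_sub_one_sub_id_le hu1).trans (sq_mul_le hρ x)
      have hρY : |ρ * Y x| ≤ 2 * ε * |Y x| := by
        rw [abs_mul]; exact mul_le_mul_of_nonneg_right hρ (abs_nonneg _)
      have c2 : |h x * (Real.exp (ρ * Y x) - 1)| ≤ ε * (2 * (2 * ε * |Y x|)) := by
        rw [abs_mul]
        exact mul_le_mul (H.abs_le_eps x) (b2.trans (by linarith)) (abs_nonneg _) hε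
      rw [abs_mul]
      have c3 : |h x * (Real.exp (ρ * Y x) - 1) + (Real.exp (ρ * Y x) - 1 - ρ * Y x)|
          ≤ 8 * ε ^ 2 * |Y x| := by
        refine (abs_add_le _ _).trans ?_
        have : Y x ^ 2 ≤ |Y x| := by
          rw [← sq_abs, sq]; exact mul_le_of_le_one_left (abs_nonneg _) hY
        nlinarith [sq_nonneg ε]
      calc |Y x| * _ ≤ |Y x| * (8 * ε ^ 2 * |Y x|) := mul_le_mul_of_nonneg_left c3 (abs_nonneg _)
        _ = 8 * ε ^ 2 * Y x ^ 2 := by rw [← sq_abs (Y x)]; ring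
    · rw [hv, Finset.mul_sum]
      exact Finset.sum_congr rfl fun x _ => by ring
  have e2 : |D2| ≤ 8 * ε ^ 2 * v := by
    refine (abs_weighted_sum_le H.nonneg (g := fun x => 8 * ε ^ 2 * Y x ^ 2)
      fun x hx => ?_).trans (le_of_eq ?_)
    · have hu1 : |ρ * Y x| ≤ 1 := (H.abs_mul_le hρ hx).trans (by linarith)
      have b := (abs_exp_mul_sub_one_add_one_le hu1).trans (sq_mul_le hρ x)
      rw [abs_mul]
      have hh : |1 + h x| ≤ 2 := (abs_add_le _ _).trans (by
        rw [abs_one]; linarith [H.abs_le_eps x])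
      calc |1 + h x| * _ ≤ 2 * (4 * ε ^ 2 * Y x ^ 2) :=
            mul_le_mul hh b (abs_nonneg _) (by norm_num)
        _ = _ := by ring
    · rw [hv, Finset.mul_sum]
      exact Finset.sum_congr rfl fun x _ => by ring
  have e3 := (abs_mul_log_sub_le (H.partition_pos ρ)).trans (H.partition_sub_one_sq_le hρ)
  -- The remainder splits into D1, D2 and the curvature of z log z, contributing 8, 8 and 9 to the
  -- constant 25.
  have hid : (1 + ρ) * ∑ x, p x * ((1 + h x) * Real.exp (ρ * Y x) * Y x) - Z * Real.log Z
      - (ρ * v + ∑ x, p x * (h x * (Y x - 1 + Real.exp (-(Y x)))))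
      = D1 + D2 - (Z * Real.log Z - (Z - 1)) := by
    have i1 : (1 + ρ) * ∑ x, p x * ((1 + h x) * Real.exp (ρ * Y x) * Y x)
        = D1 + D2 + Z + ρ * v + ∑ x, p x * (h x * (Y x - 1 + Real.exp (-(Y x))))
          + ∑ x, p x * Y x - ∑ x, p x - ∑ x, p x * (h x * Real.exp (-(Y x))) := by
      simp only [hD1, hD2, hZ, hv, Finset.mul_sum, ← Finset.sum_sub_distrib,
        ← Finset.sum_add_distrib]
      exact Finset.sum_congr rfl fun x _ => by ring
    rw [i1, H.sum_eq, H.mean_eq, H.orth]; ring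
  rw [hid]
  refine (abs_sub _ _).trans ?_
  have := abs_add_le D1 D2
  linarith

/-- The function Y - 1 + e^(-Y) is bounded by Y² for |Y| ≤ 1, so the numerator is at most ε v. -/
theorem abs_shift_le (H : TiltPerturb p Y h ε) :
    |(∑ x, p x * (h x * (Y x - 1 + Real.exp (-(Y x))))) / ∑ x, p x * Y x ^ 2| ≤ ε := by
  have hε := H.eps_nonneg
  set v := ∑ x, p x * Y x ^ 2 with hv
  set L := ∑ x, p x * (h x * (Y x - 1 + Real.exp (-(Y x)))) with hL
  have hv0 : 0 < v := H.var_pos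
  have hLv : |L| ≤ ε * v := by
    refine (abs_weighted_sum_le H.nonneg (g := fun x => ε * Y x ^ 2)
      fun x hx => ?_).trans (le_of_eq ?_)
    · rw [abs_mul]
      refine mul_le_mul (H.abs_le_eps x) ?_ (abs_nonneg _) hε
      have := Real.abs_exp_sub_one_sub_id_le (x := -(Y x)) (by
        rw [abs_neg]; exact H.abs_le_one x hx)
      rw [neg_sq] at this
      rwa [show Y x - 1 + Real.exp (-(Y x)) = Real.exp (-(Y x)) - 1 - -(Y x) by ring]
    · rw [hv, Finset.mul_sum]
      exact Finset.sum_congr rfl fun x _ => by ring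
  rw [abs_div, abs_of_pos hv0]
  exact (div_le_iff₀ hv0).2 hLv

/-- The perturbed tilt parameter agrees to first order with a linear function of `h`. -/
theorem exists_root (H : TiltPerturb p Y h ε) :
    ∃ ρ, |ρ + (∑ x, p x * (h x * (Y x - 1 + Real.exp (-(Y x))))) / ∑ x, p x * Y x ^ 2|
        ≤ 25 * ε ^ 2 ∧ |ρ| ≤ 2 * ε ∧
      (1 + ρ) * ∑ x, p x * ((1 + h x) * Real.exp (ρ * Y x) * Y x)
        = (∑ x, p x * ((1 + h x) * Real.exp (ρ * Y x)))
          * Real.log (∑ x, p x * ((1 + h x) * Real.exp (ρ * Y x))) := by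
  have hε := H.eps_nonneg
  have hε' := H.eps_le
  set v := ∑ x, p x * Y x ^ 2 with hv
  set L := ∑ x, p x * (h x * (Y x - 1 + Real.exp (-(Y x)))) with hL
  have hv0 : 0 < v := H.var_pos
  have hLv' : |L / v| ≤ ε := H.abs_shift_le
  -- The root of the linear part; the residual bound forces a sign change of Φ between a - 25 ε² and
  -- a + 25 ε².
  set a := -(L / v) with ha
  -- Uses ε ≤ 1 / 25; it keeps the bracketing interval inside |ρ| ≤ 2 ε, where the residual bound
  -- applies.
  have h25 : 25 * ε ^ 2 ≤ ε := by nlinarith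
  have hmem : ∀ ρ, |ρ - a| ≤ 25 * ε ^ 2 → |ρ| ≤ 2 * ε := fun ρ hρ => by
    have h1 := abs_add_le (ρ - a) a
    rw [sub_add_cancel] at h1
    have : |a| ≤ ε := by rwa [ha, abs_neg]
    linarith
  have hLa : L = -a * v := by rw [ha, neg_neg, div_mul_cancel₀ _ hv0.ne']
  set Φ : ℝ → ℝ := fun ρ => (1 + ρ) * ∑ x, p x * ((1 + h x) * Real.exp (ρ * Y x) * Y x)
    - (∑ x, p x * ((1 + h x) * Real.exp (ρ * Y x)))
          * Real.log (∑ x, p x * ((1 + h x) * Real.exp (ρ * Y x))) with hΦ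
  have hΦc : Continuous Φ := by
    have c1 : Continuous fun ρ : ℝ => ∑ x, p x * ((1 + h x) * Real.exp (ρ * Y x)) := by fun_prop
    have c2 : Continuous fun ρ : ℝ => (1 + ρ) * ∑ x, p x * ((1 + h x) * Real.exp (ρ * Y x) * Y x) := by
      fun_prop
    exact c2.sub (c1.mul (c1.log fun ρ => (H.partition_pos ρ).ne'))
  have hb := fun ρ hρ => abs_le.1 (H.abs_residual_le (ρ := ρ) (hmem ρ hρ))
  have h1 : Φ (a - 25 * ε ^ 2) ≤ 0 := by
    have := (hb (a - 25 * ε ^ 2) (by rw [sub_sub_cancel_left, abs_neg, abs_of_nonneg]; positivity)).2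
    simp only [← hv, ← hL] at this
    change Φ (a - 25 * ε ^ 2) - _ ≤ _ at this
    rw [hLa] at this
    linarith
  have h2 : 0 ≤ Φ (a + 25 * ε ^ 2) := by
    have := (hb (a + 25 * ε ^ 2) (by rw [add_sub_cancel_left, abs_of_nonneg]; positivity)).1
    simp only [← hv, ← hL] at this
    change _ ≤ Φ (a + 25 * ε ^ 2) - _ at this
    rw [hLa] at this
    linarith
  obtain ⟨ρ, hρ, hρ0⟩ := intermediate_value_Icc (show a - 25 * ε ^ 2 ≤ a + 25 * ε ^ 2 by
    linarith [show 0 ≤ ε ^ 2 by positivity]) hΦc.continuousOn (show (0 : ℝ) ∈ Set.Icc _ _ from ⟨h1, h2⟩)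
  have hρa : |ρ - a| ≤ 25 * ε ^ 2 := by
    rw [abs_le]; constructor <;> linarith [hρ.1, hρ.2]
  refine ⟨ρ, by rwa [ha, sub_neg_eq_add] at hρa, hmem ρ hρa, ?_⟩
  exact sub_eq_zero.1 hρ0

end TiltPerturb

end Tilt

/-! ### Linearization of the worst-case distribution in the reference weights. -/

section Linearization

theorem abs_div_sub_linear_le {N Z n z ε : ℝ} (hε0 : 0 ≤ ε) (hε : ε ≤ 1 / 25)
    (hN : |N - 1 - n| ≤ 33 * ε ^ 2) (hZ : |Z - 1 - z| ≤ 33 * ε ^ 2) (hn : |n| ≤ 2 * ε)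
    (hz : |z| ≤ ε) : |N / Z - (1 + (n - z))| ≤ 100 * ε ^ 2 := by
  have hεε : 33 * ε ^ 2 ≤ 33 / 25 * ε := by nlinarith
  have hN1 : |N - 1| ≤ 4 * ε := by
    have := abs_add_le (N - 1 - n) n
    rw [sub_add_cancel] at this
    linarith
  have hZ1 : |Z - 1| ≤ 5 / 2 * ε := by
    have := abs_add_le (Z - 1 - z) z
    rw [sub_add_cancel] at this
    linarith
  have hZ9 : 9 / 10 ≤ Z := by linarith [(abs_le.1 hZ1).1]
  have hNZ : |N - Z| ≤ 13 / 2 * ε := by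
    have := abs_sub (N - 1) (Z - 1)
    rw [sub_sub_sub_cancel_right] at this
    linarith
  have hid : N / Z - (1 + (n - z)) = (N - 1 - n) - (Z - 1 - z) - (N - Z) * (Z - 1) / Z := by
    field_simp
    ring
  have h3 : |(N - Z) * (Z - 1) / Z| ≤ 20 * ε ^ 2 := by
    rw [abs_div, abs_mul, abs_of_pos (show 0 < Z by linarith), div_le_iff₀ (by linarith)]
    have := mul_le_mul hNZ hZ1 (abs_nonneg _) (by linarith)
    nlinarith [sq_nonneg ε]
  rw [hid]
  have h4 := abs_sub (N - 1 - n - (Z - 1 - z)) ((N - Z) * (Z - 1) / Z)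
  have h5 := abs_sub (N - 1 - n) (Z - 1 - z)
  nlinarith [sq_nonneg ε]

variable {X : Type*} [Fintype X]

namespace TiltPerturb

variable {p Y h : X → ℝ} {ε ρ : ℝ}

/-- First-order expansion of numerator and partition function with ρ ≈ -s; since Y has mean zero, s
drops out of the denominator. -/
theorem abs_ratio_sub_le (H : TiltPerturb p Y h ε) {s : ℝ} (hs : |s| ≤ ε) (hρ : |ρ| ≤ 2 * ε)
    (hρs : |ρ + s| ≤ 25 * ε ^ 2) {x : X} (hx : p x ≠ 0) :
    |(1 + h x) * Real.exp (ρ * Y x) / (∑ z, p z * ((1 + h z) * Real.exp (ρ * Y z)))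
      - (1 + (h x - s * Y x - ∑ z, p z * h z))| ≤ 100 * ε ^ 2 := by
  have hε := H.eps_nonneg
  have hε' := H.eps_le
  have hnum : ∀ y, p y ≠ 0 →
      |(1 + h y) * Real.exp (ρ * Y y) - 1 - (h y - s * Y y)| ≤ 33 * ε ^ 2 := by
    intro y hy
    have hY := H.abs_le_one y hy
    have hu := H.abs_mul_le hρ hy
    have hu1 : |ρ * Y y| ≤ 1 := hu.trans (by linarith)
    have b1 := abs_exp_sub_one_le_two_mul hu1
    have b2 := Real.abs_exp_sub_one_sub_id_le hu1
    have b3 : (ρ * Y y) ^ 2 ≤ (2 * ε) ^ 2 := sq_le_sq' (by linarith [(abs_le.1 hu).1])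
      (abs_le.1 hu).2
    have b4 : |h y * (Real.exp (ρ * Y y) - 1)| ≤ ε * (2 * (2 * ε)) := by
      rw [abs_mul]
      exact mul_le_mul (H.abs_le_eps y) (by linarith) (abs_nonneg _) hε
    have b5 : |(ρ + s) * Y y| ≤ 25 * ε ^ 2 * 1 := by
      rw [abs_mul]
      exact mul_le_mul hρs hY (abs_nonneg _) (by positivity)
    have hid : (1 + h y) * Real.exp (ρ * Y y) - 1 - (h y - s * Y y)
        = h y * (Real.exp (ρ * Y y) - 1) + (Real.exp (ρ * Y y) - 1 - ρ * Y y)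
          + (ρ + s) * Y y := by ring
    rw [hid]
    have := abs_add_three (h y * (Real.exp (ρ * Y y) - 1)) (Real.exp (ρ * Y y) - 1 - ρ * Y y)
      ((ρ + s) * Y y)
    nlinarith
  have hpart : |∑ z, p z * ((1 + h z) * Real.exp (ρ * Y z)) - 1 - ∑ z, p z * h z|
      ≤ 33 * ε ^ 2 := by
    have hid : ∑ z, p z * ((1 + h z) * Real.exp (ρ * Y z)) - 1 - ∑ z, p z * h z
        = ∑ z, p z * ((1 + h z) * Real.exp (ρ * Y z) - 1 - (h z - s * Y z)) := by
      have : ∑ z, p z * ((1 + h z) * Real.exp (ρ * Y z) - 1 - (h z - s * Y z))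
          = ∑ z, p z * ((1 + h z) * Real.exp (ρ * Y z)) - ∑ z, p z - ∑ z, p z * h z
            + s * ∑ z, p z * Y z := by
        rw [Finset.mul_sum, ← Finset.sum_sub_distrib, ← Finset.sum_sub_distrib,
          ← Finset.sum_add_distrib]
        exact Finset.sum_congr rfl fun x _ => by ring
      rw [this, H.sum_eq, H.mean_eq, mul_zero, add_zero]
    rw [hid]
    exact abs_weighted_sum_le_const H.nonneg H.sum_eq hnum
  refine abs_div_sub_linear_le hε hε' (hnum x hx) hpart ?_ ?_
  · have h1 := abs_sub (h x) (s * Y x)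
    have h2 : |s * Y x| ≤ ε * 1 := by
      rw [abs_mul]
      exact mul_le_mul hs (H.abs_le_one x hx) (abs_nonneg _) hε
    linarith [H.abs_le_eps x]
  · exact abs_weighted_sum_le_const H.nonneg H.sum_eq fun y _ => H.abs_le_eps y

end TiltPerturb

/-- `p` is a worst-case distribution at `μ`, and at the perturbed weights `μ (1 + h)` there is one
whose density with respect to `p` is `1 + M h` up to a second-order error. -/
structure WorstCaseLinearization (δ : ℝ) (μ V p : X → ℝ) (M : X → X → ℝ) : Prop where
  isWorstCase : IsWorstCase δ μ V p
  nonneg : ∀ x, 0 ≤ p x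
  sum_eq : ∑ x, p x = 1
  row_le : ∀ x, p x ≠ 0 → ∑ z, |M x z| ≤ 3
  perturb : ∀ (ε : ℝ) (h : X → ℝ), 0 ≤ ε → ε ≤ 1 / 25 → (∀ x, |h x| ≤ ε) →
    ∑ x, μ x * h x = 0 → ∃ p', IsWorstCase δ (fun x => μ x * (1 + h x)) V p' ∧
      ∀ x, |p' x - p x * (1 + ∑ z, M x z * h z)| ≤ 100 * ε ^ 2 * p x

/-- A probability vector whose positive entries are at least `pm`. -/
structure IsProbWeight (μ : X → ℝ) (pm : ℝ) : Prop where
  nonneg : ∀ x, 0 ≤ μ x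
  sum_eq : ∑ x, μ x = 1
  pm_pos : 0 < pm
  pm_le : ∀ x, μ x ≠ 0 → pm ≤ μ x

theorem worstCaseLinearization_of_const {μ V : X → ℝ} {δ pm : ℝ} (hμ : IsProbWeight μ pm)
    (hδ : 0 ≤ δ) {c : ℝ} (hV : ∀ x, μ x ≠ 0 → V x = c) :
    WorstCaseLinearization δ μ V μ (open Classical in fun x z => if x = z then 1 else 0) where
  isWorstCase := isWorstCase_self_of_const hδ hμ.nonneg hμ.sum_eq hV
  nonneg := hμ.nonneg
  sum_eq := hμ.sum_eq
  row_le x _ := by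
    classical
    simp only [apply_ite abs, abs_one, abs_zero, Finset.sum_ite_eq, Finset.mem_univ, if_true]
    norm_num
  perturb ε h hε hε' hh hμh := by
    classical
    refine ⟨fun x => μ x * (1 + h x), isWorstCase_self_of_const hδ (fun x => ?_) ?_ (c := c)
      fun x hx => hV x (left_ne_zero_of_mul hx), fun x => ?_⟩
    · exact mul_nonneg (hμ.nonneg x) (by linarith [(abs_le.1 (hh x)).1])
    · simp_rw [mul_add, mul_one]
      rw [Finset.sum_add_distrib, hμ.sum_eq, hμh, add_zero]
    · simp only [ite_mul, one_mul, zero_mul, Finset.sum_ite_eq, Finset.mem_univ, if_true, sub_self,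
        abs_zero]
      exact mul_nonneg (by positivity) (hμ.nonneg x)

/-- If V is constant on the support, every reference law is its own worst case and M is the
identity. Otherwise the tilt of `exists_tilt` is perturbed by moving its parameter to the root found
in `TiltPerturb.exists_root`. -/
theorem exists_worstCaseLinearization {μ : X → ℝ} {δ pm : ℝ} (hμ : IsProbWeight μ pm)
    (hδ : 0 < δ) (hδpm : δ ≤ pm / 47) (V : X → ℝ) :
    ∃ p M, WorstCaseLinearization δ μ V p M := by
  classical
  by_cases hV : ∃ c, ∀ x, μ x ≠ 0 → V x = c
  · obtain ⟨c, hc⟩ := hV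
    exact ⟨_, _, worstCaseLinearization_of_const hμ hδ.le hc⟩
  obtain ⟨t, ht, c, hY1, hZ, hmean⟩ :=
    exists_tilt hμ.nonneg hμ.sum_eq hμ.pm_pos hμ.pm_le hδ hδpm hV
  set Y : X → ℝ := fun x => c - t * V x with hYdef
  set p : X → ℝ := fun x => μ x * Real.exp (Y x + δ) with hp
  have hpμ : ∀ x, p x ≠ 0 → μ x ≠ 0 := fun x hx => left_ne_zero_of_mul hx
  have hp0 : ∀ x, 0 ≤ p x := fun x => mul_nonneg (hμ.nonneg x) (Real.exp_pos _).le
  have hpe : ∀ x, p x = μ x * Real.exp (Y x) * Real.exp δ := fun x => by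
    simp only [hp, Real.exp_add, mul_assoc]
  have hp1 : ∑ x, p x = 1 := by
    simp_rw [hpe]
    rw [← Finset.sum_mul, hZ, ← Real.exp_add, neg_add_cancel, Real.exp_zero]
  have hpY : ∑ x, p x * Y x = 0 := by
    have : ∀ x, p x * Y x = μ x * Real.exp (Y x) * Y x * Real.exp δ := fun x => by
      rw [hpe]; ring
    simp_rw [this]
    rw [← Finset.sum_mul, hmean, zero_mul]
  have hYabs : ∀ x, p x ≠ 0 → |Y x| ≤ 1 := fun x hx => hY1 x (hpμ x hx)
  set v := ∑ x, p x * Y x ^ 2 with hv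
  have hv0 : 0 < v := by
    refine (Finset.sum_nonneg fun x _ => mul_nonneg (hp0 x) (sq_nonneg _)).lt_of_ne fun h0 => ?_
    refine hV ⟨c / t, fun x hx => ?_⟩
    have h1 := (Finset.sum_eq_zero_iff_of_nonneg
      (fun x _ => mul_nonneg (hp0 x) (sq_nonneg _))).1 h0.symm x (Finset.mem_univ x)
    have h2 : p x ≠ 0 := mul_ne_zero hx (Real.exp_pos _).ne'
    have h3 : c - t * V x = 0 := by simpa [h2] using h1
    rw [eq_div_iff ht.ne']
    linarith
  -- The matrix of h ↦ h(x) - E_p h - s Y(x) with s = E_p[h (Y - 1 + e^(-Y))] / v. Its row sums are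
  -- at most 1 + 1 + 1, the last from |Y - 1 + e^(-Y)| ≤ Y² and |Y x| ≤ 1.
  refine ⟨p, fun x z => (if x = z then 1 else 0) - p z
    - p z * (Y z - 1 + Real.exp (-(Y z))) / v * Y x, ?_, hp0, hp1, fun x hx => ?_, ?_⟩
  · refine isWorstCase_of_tilt hδ.le hμ.nonneg hμ.sum_eq (b := c + δ) ht (fun x => ?_) hp1 ?_
    · simp only [hp, hYdef]
      congr 2; ring
    · have : ∀ x, p x * (c + δ - t * V x) = p x * Y x + p x * δ := fun x => by
        simp only [hYdef]; ring
      simp_rw [this]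
      rw [Finset.sum_add_distrib, hpY, ← Finset.sum_mul, hp1]; ring
  · have hrow : ∀ z, |(if x = z then (1 : ℝ) else 0) - p z
        - p z * (Y z - 1 + Real.exp (-(Y z))) / v * Y x|
        ≤ (if x = z then 1 else 0) + p z + p z * Y z ^ 2 / v := by
      intro z
      refine (abs_sub _ _).trans (add_le_add ((abs_sub _ _).trans (le_of_eq ?_)) ?_)
      · rw [abs_of_nonneg (hp0 z), abs_of_nonneg]
        split_ifs <;> norm_num
      · rw [abs_mul, abs_div, abs_of_pos hv0, abs_mul, abs_of_nonneg (hp0 z)]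
        refine (mul_le_of_le_one_right (div_nonneg (mul_nonneg (hp0 z) (abs_nonneg _)) hv0.le)
          (hYabs x hx)).trans ?_
        gcongr ?_ / _
        by_cases hz : p z = 0
        · simp [hz]
        refine mul_le_mul_of_nonneg_left ?_ (hp0 z)
        have := Real.abs_exp_sub_one_sub_id_le (x := -(Y z)) (by
          rw [abs_neg]; exact hYabs z hz)
        rw [neg_sq] at this
        rwa [show Y z - 1 + Real.exp (-(Y z)) = Real.exp (-(Y z)) - 1 - -(Y z) by ring]
    refine (Finset.sum_le_sum fun z _ => hrow z).trans (le_of_eq ?_)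
    rw [Finset.sum_add_distrib, Finset.sum_add_distrib, hp1, ← Finset.sum_div, ← hv,
      div_self hv0.ne']
    simp only [Finset.sum_ite_eq, Finset.mem_univ, if_true]
    norm_num
  · intro ε h hε hε' hh hμh
    have H : TiltPerturb p Y h ε := by
      refine ⟨hp0, hp1, hpY, hYabs, hv0, hε, hε', hh, ?_⟩
      -- Since p e^(-Y) is a multiple of μ, orthogonality expresses that μ (1 + h) still has total
      -- mass 1.
      have : ∀ x, p x * (h x * Real.exp (-(Y x))) = μ x * h x * Real.exp δ := fun x => by
        rw [hpe, Real.exp_neg]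
        have := (Real.exp_pos (Y x)).ne'
        field_simp
      simp_rw [this]
      rw [← Finset.sum_mul, hμh, zero_mul]
    obtain ⟨ρ, hρs, hρ, hroot⟩ := H.exists_root
    have hs := H.abs_shift_le
    set s := (∑ x, p x * (h x * (Y x - 1 + Real.exp (-(Y x))))) / ∑ x, p x * Y x ^ 2 with hsdef
    set Z := ∑ x, p x * ((1 + h x) * Real.exp (ρ * Y x)) with hZdef
    have hZ0 : 0 < Z := H.partition_pos ρ
    refine ⟨fun x => p x * ((1 + h x) * Real.exp (ρ * Y x) / Z), ?_, fun x => ?_⟩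
    · have hρ1 : 0 < 1 + ρ := by linarith [(abs_le.1 hρ).1]
      have hs1 : ∑ x, p x * ((1 + h x) * Real.exp (ρ * Y x) / Z) = 1 := by
        simp_rw [← mul_div_assoc, ← Finset.sum_div]
        exact div_self hZ0.ne'
      refine isWorstCase_of_tilt hδ.le (fun x => ?_) ?_
        (b := (1 + ρ) * c + δ - Real.log Z) (mul_pos hρ1 ht) (fun x => ?_) hs1 ?_
      · exact mul_nonneg (hμ.nonneg x) (by linarith [(abs_le.1 (hh x)).1])
      · simp_rw [mul_add, mul_one]
        rw [Finset.sum_add_distrib, hμ.sum_eq, hμh, add_zero]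
      · have : (1 + ρ) * c + δ - Real.log Z - (1 + ρ) * t * V x
            = (Y x + δ) + ρ * Y x - Real.log Z := by simp only [hYdef]; ring
        rw [this, Real.exp_sub, Real.exp_log hZ0, Real.exp_add]
        simp only [hp]
        ring
      · have : ∀ x, p x * ((1 + h x) * Real.exp (ρ * Y x) / Z)
            * ((1 + ρ) * c + δ - Real.log Z - (1 + ρ) * t * V x)
            = (1 + ρ) / Z * (p x * ((1 + h x) * Real.exp (ρ * Y x) * Y x))
              + p x * ((1 + h x) * Real.exp (ρ * Y x) / Z) * (δ - Real.log Z) := fun x => by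
          simp only [hYdef]; ring
        simp_rw [this]
        rw [Finset.sum_add_distrib, ← Finset.mul_sum, ← Finset.sum_mul, hs1, div_mul_eq_mul_div,
          hroot, mul_div_cancel_left₀ _ hZ0.ne']
        ring
    · have hMh : ∑ z, ((if x = z then (1 : ℝ) else 0) - p z
          - p z * (Y z - 1 + Real.exp (-(Y z))) / v * Y x) * h z
          = h x - s * Y x - ∑ z, p z * h z := by
        have : ∀ z, ((if x = z then (1 : ℝ) else 0) - p z
          - p z * (Y z - 1 + Real.exp (-(Y z))) / v * Y x) * h z
            = (if x = z then h z else 0) - p z * h z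
              - Y x / v * (p z * (h z * (Y z - 1 + Real.exp (-(Y z))))) := fun z => by
          split_ifs <;> ring
        simp_rw [this]
        rw [Finset.sum_sub_distrib, Finset.sum_sub_distrib, ← Finset.mul_sum, hsdef, ← hv]
        simp only [Finset.sum_ite_eq, Finset.mem_univ, if_true]
        ring
      rw [hMh, ← mul_sub, abs_mul, abs_of_nonneg (hp0 x), mul_comm]
      by_cases hx : p x = 0
      · simp [hx]
      exact mul_le_mul_of_nonneg_right (H.abs_ratio_sub_le hs hρ hρs hx) (hp0 x)

theorem WorstCaseLinearization.abs_linear_le {δ ε : ℝ} {μ V p : X → ℝ} {M : X → X → ℝ}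
    (H : WorstCaseLinearization δ μ V p M) {h : X → ℝ} (hε : 0 ≤ ε) (hh : ∀ x, |h x| ≤ ε)
    (U : X → ℝ) : |∑ x, p x * ((∑ z, M x z * h z) * U x)| ≤ 3 * ε * ‖U‖ := by
  refine abs_weighted_sum_le_const H.nonneg H.sum_eq fun x hx => ?_
  rw [abs_mul]
  refine mul_le_mul ?_ (norm_le_pi_norm U x) (abs_nonneg _) (by positivity)
  refine (Finset.abs_sum_le_sum_abs _ _).trans ?_
  calc ∑ z, |M x z * h z| ≤ ∑ z, |M x z| * ε := by
        refine Finset.sum_le_sum fun z _ => ?_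
        rw [abs_mul]
        exact mul_le_mul_of_nonneg_left (hh z) (abs_nonneg _)
    _ ≤ 3 * ε := by
        rw [← Finset.sum_mul]
        exact mul_le_mul_of_nonneg_right (H.row_le x hx) hε

end Linearization

/-! ### Comparing increments through supergradients. -/

section Supergradient

/-- The increment of a concave function is the integral of its supergradient. Riemann sums replace
the integral, so the selections u, u' may be arbitrary functions. -/
theorem sub_le_of_supergradient {g g' u u' : ℝ → ℝ} {B η : ℝ}
    (hg : ∀ x ∈ Set.Icc (0 : ℝ) 1, ∀ y ∈ Set.Icc (0 : ℝ) 1, g y ≤ g x + u x * (y - x))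
    (hg' : ∀ x ∈ Set.Icc (0 : ℝ) 1, ∀ y ∈ Set.Icc (0 : ℝ) 1, g' y ≤ g' x + u' x * (y - x))
    (hu : |u 0 - u 1| ≤ B) (h : ∀ x ∈ Set.Icc (0 : ℝ) 1, |u' x - u x| ≤ η) :
    (g' 1 - g' 0) - (g 1 - g 0) ≤ η := by
  refine le_of_forall_pos_le_add fun e he => ?_
  obtain ⟨N, hN⟩ := exists_nat_gt (B / e)
  have hB : 0 ≤ B := (abs_nonneg _).trans hu
  have hN0 : (0 : ℝ) < N := (div_nonneg hB he.le).trans_lt hN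
  have hmem : ∀ i ≤ N, (i : ℝ) / N ∈ Set.Icc (0 : ℝ) 1 := fun i hi =>
    ⟨by positivity, (div_le_one hN0).2 (by exact_mod_cast hi)⟩
  -- The inequality for g' is used at the left end of each cell and that for g at the right end. The
  -- term u / N absorbs the mismatch, which telescopes to (u 0 - u 1) / N.
  set F : ℕ → ℝ := fun i => g' (i / N) - g (i / N) + u (i / N) / N with hF
  have hstep : ∀ i ∈ Finset.range N, F (i + 1) - F i ≤ η / N := by
    intro i hi
    have hi' := Finset.mem_range.1 hi
    have h1 := hg' _ (hmem i hi'.le) _ (hmem (i + 1) hi')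
    have h2 := hg _ (hmem (i + 1) hi') _ (hmem i hi'.le)
    have h3 := mul_le_mul_of_nonneg_right ((abs_le.1 (h _ (hmem i hi'.le))).2)
      (inv_pos.2 hN0).le
    have e1 : ((i + 1 : ℕ) : ℝ) / N - i / N = (N : ℝ)⁻¹ := by push_cast; field_simp; ring
    have e2 : (i : ℝ) / N - ((i + 1 : ℕ) : ℝ) / N = -(N : ℝ)⁻¹ := by rw [← e1]; ring
    rw [e1] at h1
    rw [e2] at h2
    simp only [hF, div_eq_mul_inv] at *
    linarith
  have hsum := Finset.sum_le_sum hstep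
  rw [Finset.sum_range_sub, Finset.sum_const, Finset.card_range, nsmul_eq_mul,
    mul_div_cancel₀ _ hN0.ne'] at hsum
  simp only [hF, Nat.cast_zero, zero_div, div_self hN0.ne'] at hsum
  have h4 : B / N ≤ e := by
    rw [div_lt_iff₀ he] at hN
    rw [div_le_iff₀ hN0]
    linarith
  have h5 : (u 0 - u 1) / N ≤ B / N := div_le_div_of_nonneg_right ((le_abs_self _).trans hu) hN0.le
  rw [sub_div] at h5
  linarith

theorem abs_sub_le_of_supergradient {g g' u u' : ℝ → ℝ} {η : ℝ}
    (hg : ∀ x ∈ Set.Icc (0 : ℝ) 1, ∀ y ∈ Set.Icc (0 : ℝ) 1, g y ≤ g x + u x * (y - x))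
    (hg' : ∀ x ∈ Set.Icc (0 : ℝ) 1, ∀ y ∈ Set.Icc (0 : ℝ) 1, g' y ≤ g' x + u' x * (y - x))
    (h : ∀ x ∈ Set.Icc (0 : ℝ) 1, |u' x - u x| ≤ η) :
    |(g' 1 - g' 0) - (g 1 - g 0)| ≤ η := by
  rw [abs_le']
  refine ⟨sub_le_of_supergradient hg hg' le_rfl h, ?_⟩
  rw [neg_sub]
  exact sub_le_of_supergradient hg' hg le_rfl fun x hx => by rw [abs_sub_comm]; exact h x hx

end Supergradient

/-! ### Sampling error of differences of the dual functional: size and mean. -/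

section Difference

variable {X : Type*} [Fintype X]

/-- A worst-case distribution is a supergradient, so its mean of V - W is one along the segment. -/
theorem IsWorstCase.klDual_segment_le {δ : ℝ} {w V W p : X → ℝ} {θ : ℝ}
    (h : IsWorstCase δ w (W + θ • (V - W)) p) (θ' : ℝ) :
    klDual δ w (W + θ' • (V - W))
      ≤ klDual δ w (W + θ • (V - W)) + (∑ x, p x * (V - W) x) * (θ' - θ) := by
  refine (h.klDual_le _).trans (le_of_eq ?_)
  rw [h.klDual_eq, Finset.sum_mul, ← Finset.sum_add_distrib]
  refine Finset.sum_congr rfl fun x _ => ?_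
  simp only [Pi.add_apply, Pi.smul_apply, smul_eq_mul]
  ring

/-- Along the segment the two supergradients differ by 3 ε from the linear term and 100 ε² ≤ 4 ε
from the remainder. The resulting factor ‖V - W‖ is the source of the variance reduction. -/
theorem abs_klDual_sub_sub_le {μ : X → ℝ} {δ pm ε : ℝ} (hμ : IsProbWeight μ pm)
    (hδ : 0 < δ) (hδpm : δ ≤ pm / 47) (hε : 0 ≤ ε) (hε' : ε ≤ 1 / 25) {h : X → ℝ}
    (hh : ∀ x, |h x| ≤ ε) (hμh : ∑ x, μ x * h x = 0) (V W : X → ℝ) :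
    |(klDual δ (fun x => μ x * (1 + h x)) V - klDual δ (fun x => μ x * (1 + h x)) W)
      - (klDual δ μ V - klDual δ μ W)| ≤ 7 * ε * ‖V - W‖ := by
  choose p M hpM using fun θ : ℝ => exists_worstCaseLinearization hμ hδ hδpm (W + θ • (V - W))
  choose p' hp' hp'p using fun θ => (hpM θ).perturb ε h hε hε' hh hμh
  have key := abs_sub_le_of_supergradient
    (g := fun θ => klDual δ μ (W + θ • (V - W)))
    (g' := fun θ => klDual δ (fun x => μ x * (1 + h x)) (W + θ • (V - W)))
    (fun θ _ θ' _ => (hpM θ).isWorstCase.klDual_segment_le θ')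
    (fun θ _ θ' _ => (hp' θ).klDual_segment_le θ') (η := 7 * ε * ‖V - W‖) ?_
  · simpa using key
  intro θ _
  have h1 := (hpM θ).abs_linear_le hε hh (V - W)
  have h2 : |∑ x, (p' θ x - p θ x * (1 + ∑ z, M θ x z * h z)) * (V - W) x|
      ≤ 100 * ε ^ 2 * ‖V - W‖ := by
    refine (Finset.abs_sum_le_sum_abs _ _).trans ?_
    calc ∑ x, |(p' θ x - p θ x * (1 + ∑ z, M θ x z * h z)) * (V - W) x|
        ≤ ∑ x, p θ x * (100 * ε ^ 2 * ‖V - W‖) := by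
          refine Finset.sum_le_sum fun x _ => ?_
          rw [abs_mul]
          refine (mul_le_mul (hp'p θ x) (norm_le_pi_norm (V - W) x) (abs_nonneg _)
            (mul_nonneg (by positivity) ((hpM θ).nonneg x))).trans (le_of_eq (by ring))
      _ = _ := by rw [← Finset.sum_mul, (hpM θ).sum_eq, one_mul]
  have hid : ∑ x, p' θ x * (V - W) x - ∑ x, p θ x * (V - W) x
      = ∑ x, (p' θ x - p θ x * (1 + ∑ z, M θ x z * h z)) * (V - W) x
        + ∑ x, p θ x * ((∑ z, M θ x z * h z) * (V - W) x) := by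
    rw [← Finset.sum_sub_distrib, ← Finset.sum_add_distrib]
    exact Finset.sum_congr rfl fun x _ => by ring
  rw [hid]
  refine (abs_add_le _ _).trans ?_
  have h3 : 100 * ε ^ 2 ≤ 4 * ε := by nlinarith
  nlinarith [norm_nonneg (V - W)]

/-- The bias of differences of the dual functional under random perturbations of the reference
distribution is of second order. -/
theorem abs_setIntegral_klDual_sub_sub_le {Ω : Type*} [Finite Ω] [MeasurableSpace Ω]
    [MeasurableSingletonClass Ω] (P : Measure Ω) [IsProbabilityMeasure P] {μ : X → ℝ}
    {δ pm ε B : ℝ} (hμ : IsProbWeight μ pm) (hδ : 0 < δ) (hδpm : δ ≤ pm / 47) (hε : 0 ≤ ε)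
    (hε' : ε ≤ 1 / 25) {h : Ω → X → ℝ} (G : Set Ω) (hB0 : 0 ≤ B) (hB : ∀ ω x, |h ω x| ≤ B)
    (hint : ∀ x, ∫ ω, h ω x ∂P = 0) (hh : ∀ ω ∈ G, ∀ x, |h ω x| ≤ ε)
    (hμh : ∀ ω ∈ G, ∑ x, μ x * h ω x = 0) (V W : X → ℝ) :
    |∫ ω in G, ((klDual δ (fun x => μ x * (1 + h ω x)) V
        - klDual δ (fun x => μ x * (1 + h ω x)) W) - (klDual δ μ V - klDual δ μ W)) ∂P|
      ≤ (100 * ε ^ 2 + 3 * B * P.real Gᶜ) * ‖V - W‖ := by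
  have hG : MeasurableSet G := G.toFinite.measurableSet
  have hI : ∀ (Q : Measure Ω) [IsFiniteMeasure Q] (f : Ω → ℝ), Integrable f Q :=
    -- On this finite space every function is integrable, so the worst cases may be chosen
    -- pointwise.
    fun Q _ f => Integrable.of_finite
  choose p M hpM using fun θ : ℝ => exists_worstCaseLinearization hμ hδ hδpm (W + θ • (V - W))
  have hex : ∀ θ ω, ∃ p', ω ∈ G → IsWorstCase δ (fun x => μ x * (1 + h ω x)) (W + θ • (V - W)) p' ∧
      ∀ x, |p' x - p θ x * (1 + ∑ z, M θ x z * h ω z)| ≤ 100 * ε ^ 2 * p θ x := by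
    intro θ ω
    by_cases hω : ω ∈ G
    · obtain ⟨p', hp'⟩ := (hpM θ).perturb ε (h ω) hε hε' (hh ω hω) (hμh ω hω)
      exact ⟨p', fun _ => hp'⟩
    · exact ⟨0, fun h => absurd h hω⟩
  choose p' hp' using hex
  have key := abs_sub_le_of_supergradient
    (g := fun θ => ∫ _ in G, klDual δ μ (W + θ • (V - W)) ∂P)
    (g' := fun θ => ∫ ω in G, klDual δ (fun x => μ x * (1 + h ω x)) (W + θ • (V - W)) ∂P)
    (u := fun θ => ∫ _ in G, (∑ x, p θ x * (V - W) x) ∂P)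
    (u' := fun θ => ∫ ω in G, (∑ x, p' θ ω x * (V - W) x) ∂P)
    (η := (100 * ε ^ 2 + 3 * B * P.real Gᶜ) * ‖V - W‖) ?_ ?_ ?_
  · rw [integral_sub (hI _ _) (hI _ _), integral_sub (hI _ _) (hI _ _),
      integral_sub (hI _ _) (hI _ _)]
    simpa using key
  · intro θ _ θ' _
    rw [← integral_mul_const, ← integral_add (hI _ _) (hI _ _)]
    exact integral_mono (hI _ _) (hI _ _) fun ω => (hpM θ).isWorstCase.klDual_segment_le θ'
  · intro θ _ θ' _
    rw [← integral_mul_const, ← integral_add (hI _ _) (hI _ _)]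
    exact setIntegral_mono_on (hI _ _) (hI _ _) hG fun ω hω => (hp' θ ω hω).1.klDual_segment_le θ'
  · intro θ _
    set L : Ω → ℝ := fun ω => ∑ x, p θ x * ((∑ z, M θ x z * h ω z) * (V - W) x) with hL
    have hL0 : ∫ ω, L ω ∂P = 0 := by
      simp only [hL]
      rw [integral_finsetSum _ fun x _ => hI _ _]
      refine Finset.sum_eq_zero fun x _ => ?_
      rw [integral_const_mul, integral_mul_const, integral_finsetSum _ fun x _ => hI _ _]
      simp_rw [integral_const_mul, hint]
      simp
    -- The linear term has integral zero over the whole space, so over G it is minus its integral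
    -- over the complement.
    have hLc : ‖∫ ω in G, L ω ∂P‖ ≤ 3 * B * ‖V - W‖ * P.real Gᶜ := by
      have h1 := integral_add_compl hG (hI P L)
      rw [hL0] at h1
      rw [show ∫ ω in G, L ω ∂P = -∫ ω in Gᶜ, L ω ∂P by linarith, norm_neg]
      exact norm_setIntegral_le_of_norm_le_const (measure_lt_top _ _)
        fun ω _ => (hpM θ).abs_linear_le hB0 (hB ω) (V - W)
    have hR : ‖∫ ω in G, (∑ x, (p' θ ω x - p θ x * (1 + ∑ z, M θ x z * h ω z)) * (V - W) x) ∂P‖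
        ≤ 100 * ε ^ 2 * ‖V - W‖ := by
      refine (norm_setIntegral_le_of_norm_le_const (C := 100 * ε ^ 2 * ‖V - W‖)
        (measure_lt_top _ _) fun ω hω => ?_).trans
        (mul_le_of_le_one_right (by positivity) measureReal_le_one)
      refine (Finset.abs_sum_le_sum_abs _ _).trans ?_
      calc ∑ x, |(p' θ ω x - p θ x * (1 + ∑ z, M θ x z * h ω z)) * (V - W) x|
          ≤ ∑ x, p θ x * (100 * ε ^ 2 * ‖V - W‖) := by
            refine Finset.sum_le_sum fun x _ => ?_
            rw [abs_mul]
            refine (mul_le_mul ((hp' θ ω hω).2 x) (norm_le_pi_norm (V - W) x) (abs_nonneg _)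
              (mul_nonneg (by positivity) ((hpM θ).nonneg x))).trans (le_of_eq (by ring))
        _ = _ := by rw [← Finset.sum_mul, (hpM θ).sum_eq, one_mul]
    have hid : ∫ ω in G, (∑ x, p' θ ω x * (V - W) x) ∂P - ∫ _ in G, (∑ x, p θ x * (V - W) x) ∂P
        = ∫ ω in G, (∑ x, (p' θ ω x - p θ x * (1 + ∑ z, M θ x z * h ω z)) * (V - W) x) ∂P
          + ∫ ω in G, L ω ∂P := by
      rw [← integral_sub (hI _ _) (hI _ _), ← integral_add (hI _ _) (hI _ _)]
      refine integral_congr_ae (Filter.Eventually.of_forall fun ω => ?_)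
      simp only [hL]
      rw [← Finset.sum_sub_distrib, ← Finset.sum_add_distrib]
      exact Finset.sum_congr rfl fun x _ => by ring
    rw [hid, ← Real.norm_eq_abs]
    refine (norm_add_le _ _).trans ?_
    linarith

end Difference

/-! ### Strong duality for KL balls of probability mass functions. -/

section KLBall

variable {X : Type*} [Fintype X]

/-- The real-valued weights of a distribution on a finite set. -/
def pmfWeight (P : PMF X) (x : X) : ℝ := (P x).toReal

theorem pmfWeight_nonneg (P : PMF X) (x : X) : 0 ≤ pmfWeight P x := ENNReal.toReal_nonneg

theorem pmfWeight_ne_zero_iff {P : PMF X} {x : X} : pmfWeight P x ≠ 0 ↔ P x ≠ 0 := by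
  simp [pmfWeight, ENNReal.toReal_eq_zero_iff, P.apply_ne_top]

variable [MeasurableSpace X] [MeasurableSingletonClass X]

theorem toMeasure_real_singleton (P : PMF X) (x : X) : P.toMeasure.real {x} = pmfWeight P x := by
  rw [measureReal_def, PMF.toMeasure_apply_singleton _ _ (measurableSet_singleton x), pmfWeight]

theorem toMeasure_absolutelyContinuous_iff {P Q : PMF X} :
    P.toMeasure ≪ Q.toMeasure ↔ ∀ x, pmfWeight P x ≠ 0 → pmfWeight Q x ≠ 0 := by
  constructor
  · intro h x hx hQ
    have h1 : Q.toMeasure {x} = 0 := by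
      rw [PMF.toMeasure_apply_singleton _ _ (measurableSet_singleton x)]
      by_contra h2
      exact pmfWeight_ne_zero_iff.2 h2 hQ
    have h2 := h h1
    rw [PMF.toMeasure_apply_singleton _ _ (measurableSet_singleton x)] at h2
    exact pmfWeight_ne_zero_iff.1 hx h2
  · intro h s hs
    rw [PMF.toMeasure_apply_eq_zero_iff _ s.toFinite.measurableSet] at hs ⊢
    refine Set.disjoint_left.2 fun x hx hxs => ?_
    exact Set.disjoint_left.1 hs
      ((PMF.mem_support_iff _ _).2 (pmfWeight_ne_zero_iff.1
        (h x (pmfWeight_ne_zero_iff.2 ((PMF.mem_support_iff _ _).1 hx))))) hxs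

theorem toReal_rnDeriv_toMeasure {P Q : PMF X} (h : P.toMeasure ≪ Q.toMeasure) {x : X}
    (hx : pmfWeight Q x ≠ 0) :
    (P.toMeasure.rnDeriv Q.toMeasure x).toReal = pmfWeight P x / pmfWeight Q x := by
  have h1 : P.toMeasure {x} = P.toMeasure.rnDeriv Q.toMeasure x * Q.toMeasure {x} := by
    conv_lhs => rw [← Measure.withDensity_rnDeriv_eq _ _ h]
    rw [withDensity_apply _ (measurableSet_singleton x), lintegral_singleton]
  rw [PMF.toMeasure_apply_singleton _ _ (measurableSet_singleton x),
    PMF.toMeasure_apply_singleton _ _ (measurableSet_singleton x)] at h1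
  rw [eq_div_iff hx, pmfWeight, pmfWeight, h1, ENNReal.toReal_mul]

theorem mem_klBall_iff {P Q : PMF X} {δ : ℝ} (hδ : 0 ≤ δ) :
    P ∈ klBall Q δ ↔ (∀ x, pmfWeight P x ≠ 0 → pmfWeight Q x ≠ 0) ∧
      ∑ x, pmfWeight P x * Real.log (pmfWeight P x / pmfWeight Q x) ≤ δ := by
  have hint : Integrable (llr P.toMeasure Q.toMeasure) P.toMeasure := Integrable.of_finite
  have hval : ∀ h : P.toMeasure ≪ Q.toMeasure, (klDiv P.toMeasure Q.toMeasure).toReal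
      = ∑ x, pmfWeight P x * Real.log (pmfWeight P x / pmfWeight Q x) := by
    intro h
    rw [toReal_klDiv_of_measure_eq h (by simp), integral_fintype hint]
    simp_rw [toMeasure_real_singleton, smul_eq_mul]
    refine weighted_sum_congr fun x hx => ?_
    rw [llr, toReal_rnDeriv_toMeasure h (toMeasure_absolutelyContinuous_iff.1 h x hx)]
  rw [klBall, Set.mem_ofPred_eq, ← toMeasure_absolutelyContinuous_iff]
  constructor
  · intro h
    have hac : P.toMeasure ≪ Q.toMeasure := by
      by_contra hn
      rw [klDiv_of_not_ac hn] at h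
      exact absurd h (by simp)
    refine ⟨hac, ?_⟩
    rw [← hval hac]
    exact ENNReal.toReal_le_of_le_ofReal hδ h
  · rintro ⟨hac, h⟩
    rw [← hval hac] at h
    exact (ENNReal.le_ofReal_iff_toReal_le (klDiv_ne_top hac hint) hδ).2 h

theorem klDual_le_pmfExp {P Q : PMF X} {δ : ℝ} (hδ : 0 ≤ δ) (hP : P ∈ klBall Q δ) (V : X → ℝ) :
    klDual δ (pmfWeight Q) V ≤ pmfExp P V := by
  obtain ⟨h1, h2⟩ := (mem_klBall_iff hδ).1 hP
  exact klDual_le_of_kl_le (pmfWeight_nonneg P) (sum_toReal_pmf P) (pmfWeight_nonneg Q) h1 h2 V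

theorem exists_pmf_weight_eq {p : X → ℝ} (hp : ∀ x, 0 ≤ p x) (hp1 : ∑ x, p x = 1) :
    ∃ P : PMF X, pmfWeight P = p := by
  refine ⟨PMF.ofFintype (fun x => ENNReal.ofReal (p x)) ?_, ?_⟩
  · rw [← ENNReal.ofReal_sum_of_nonneg fun x _ => hp x, hp1, ENNReal.ofReal_one]
  · ext x
    simp [pmfWeight, ENNReal.toReal_ofReal (hp x)]

/-- Strong duality for the KL ball around a distribution on a finite set. -/
theorem exists_mem_klBall_pmfExp_eq {Q : PMF X} {δ pm : ℝ} (hQ : IsProbWeight (pmfWeight Q) pm)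
    (hδ : 0 < δ) (hδpm : δ ≤ pm / 47) (V : X → ℝ) :
    ∃ P ∈ klBall Q δ, pmfExp P V = klDual δ (pmfWeight Q) V := by
  by_cases hV : ∃ c, ∀ x, pmfWeight Q x ≠ 0 → V x = c
  · obtain ⟨c, hc⟩ := hV
    exact ⟨Q, mem_klBall_self _ _,
      (isWorstCase_self_of_const hδ.le hQ.nonneg hQ.sum_eq hc).klDual_eq.symm⟩
  obtain ⟨t, ht, c, hY1, hZ, hmean⟩ :=
    exists_tilt hQ.nonneg hQ.sum_eq hQ.pm_pos hQ.pm_le hδ hδpm hV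
  have hp1 : ∑ x, pmfWeight Q x * Real.exp (c + δ - t * V x) = 1 := by
    have : ∀ x, pmfWeight Q x * Real.exp (c + δ - t * V x)
        = pmfWeight Q x * Real.exp (c - t * V x) * Real.exp δ := fun x => by
      rw [mul_assoc, ← Real.exp_add]; congr 2; ring
    simp_rw [this]
    rw [← Finset.sum_mul, hZ, ← Real.exp_add, neg_add_cancel, Real.exp_zero]
  have hkl : ∑ x, pmfWeight Q x * Real.exp (c + δ - t * V x) * (c + δ - t * V x) = δ := by
    have : ∀ x, pmfWeight Q x * Real.exp (c + δ - t * V x) * (c + δ - t * V x)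
        = pmfWeight Q x * Real.exp (c - t * V x) * (c - t * V x) * Real.exp δ
          + pmfWeight Q x * Real.exp (c + δ - t * V x) * δ := fun x => by
      rw [show c + δ - t * V x = (c - t * V x) + δ by ring, Real.exp_add]; ring
    simp_rw [this]
    rw [Finset.sum_add_distrib, ← Finset.sum_mul, ← Finset.sum_mul, hmean, hp1]; ring
  obtain ⟨P, hP⟩ := exists_pmf_weight_eq
    (fun x => mul_nonneg (pmfWeight_nonneg Q x) (Real.exp_pos (c + δ - t * V x)).le) hp1
  have hw := isWorstCase_of_tilt hδ.le hQ.nonneg hQ.sum_eq (V := V)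
    (p := fun x => pmfWeight Q x * Real.exp (c + δ - t * V x)) ht (fun x => rfl) hp1 hkl
  refine ⟨P, (mem_klBall_iff hδ.le).2 ⟨fun x hx => ?_, le_of_eq ?_⟩, ?_⟩
  · rw [hP] at hx
    exact left_ne_zero_of_mul hx
  · rw [hP]
    refine Eq.trans ?_ hkl
    refine weighted_sum_congr (p := fun x => pmfWeight Q x * Real.exp (c + δ - t * V x))
      fun x hx => ?_
    rw [mul_div_cancel_left₀ _ (left_ne_zero_of_mul hx), Real.log_exp]
  · rw [hw.klDual_eq]
    exact Finset.sum_congr rfl fun x _ => by rw [← congrFun hP x, pmfWeight]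

end KLBall

/-! ### The robust Bellman operator in dual form. -/

namespace RobustMDP

variable {S : Type u} {A : Type v} [Fintype S] [Fintype A]

section MinSupport

theorem bddBelow_of_finite {ι : Type*} [Finite ι] (f : ι → ℝ) : BddBelow (Set.range f) :=
  (Set.finite_range f).bddBelow

theorem minSupport_le_p (M : RobustMDP S A) (s : S) (a : A) {s' : S}
    (h : pmfWeight (M.p s a) s' ≠ 0) : M.minSupport ≤ pmfWeight (M.p s a) s' := by
  have h' : 0 < M.p s a s' := (pmfWeight_ne_zero_iff.1 h).bot_lt
  refine (ciInf_le (bddBelow_of_finite _) (s, a)).trans ((min_le_right _ _).trans ?_)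
  exact ciInf_le (bddBelow_of_finite _) (⟨s', h'⟩ : {s' : S // 0 < M.p s a s'})

theorem minSupport_le_ν (M : RobustMDP S A) (s : S) (a : A) {r : M.rewards}
    (h : pmfWeight (M.ν s a) r ≠ 0) : M.minSupport ≤ pmfWeight (M.ν s a) r := by
  have h' : 0 < M.ν s a r := (pmfWeight_ne_zero_iff.1 h).bot_lt
  refine (ciInf_le (bddBelow_of_finite _) (s, a)).trans ((min_le_left _ _).trans ?_)
  exact ciInf_le (bddBelow_of_finite _) (⟨r, h'⟩ : {r : M.rewards // 0 < M.ν s a r})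

omit [Fintype S] [Fintype A] in
theorem _root_.PMF.iInf_pos_toReal_pos {X : Type*} [Finite X] (P : PMF X) :
    0 < ⨅ x : {x : X // 0 < P x}, (P x.1).toReal := by
  obtain ⟨x, hx⟩ := P.support_nonempty
  have : Nonempty {x : X // 0 < P x} := ⟨⟨x, (((PMF.mem_support_iff _ _).1 hx)).bot_lt⟩⟩
  obtain ⟨y, hy⟩ := exists_eq_ciInf_of_finite (f := fun x : {x : X // 0 < P x} => (P x.1).toReal)
  rw [← hy]
  exact ENNReal.toReal_pos y.2.ne' (P.apply_ne_top _)

variable [Nonempty S] [Nonempty A]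

theorem minSupport_pos (M : RobustMDP S A) : 0 < M.minSupport := by
  obtain ⟨x, hx⟩ := exists_eq_ciInf_of_finite (f := fun x : S × A => min
    (⨅ r : {r : M.rewards // 0 < M.ν x.1 x.2 r}, (M.ν x.1 x.2 r.1).toReal)
    (⨅ s' : {s' : S // 0 < M.p x.1 x.2 s'}, (M.p x.1 x.2 s'.1).toReal))
  rw [minSupport, ← hx]
  exact lt_min (PMF.iInf_pos_toReal_pos _) (PMF.iInf_pos_toReal_pos _)

theorem isProbWeight_p (M : RobustMDP S A) (s : S) (a : A) :
    IsProbWeight (pmfWeight (M.p s a)) M.minSupport :=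
  ⟨pmfWeight_nonneg _, sum_toReal_pmf _, M.minSupport_pos, fun _ h => M.minSupport_le_p s a h⟩

theorem isProbWeight_ν (M : RobustMDP S A) (s : S) (a : A) :
    IsProbWeight (pmfWeight (M.ν s a)) M.minSupport :=
  ⟨pmfWeight_nonneg _, sum_toReal_pmf _, M.minSupport_pos, fun _ h => M.minSupport_le_ν s a h⟩

theorem _root_.IsProbWeight.pm_le_one {X : Type*} [Fintype X] {μ : X → ℝ} {pm : ℝ}
    (h : IsProbWeight μ pm) : pm ≤ 1 := by
  obtain ⟨x, hx⟩ : ∃ x, μ x ≠ 0 := by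
    by_contra! h0
    simpa [h0] using h.sum_eq
  exact (h.pm_le x hx).trans (h.sum_eq ▸
    Finset.single_le_sum (f := μ) (fun y _ => h.nonneg y) (Finset.mem_univ x))

theorem minSupport_le_one (M : RobustMDP S A) : M.minSupport ≤ 1 :=
  (M.isProbWeight_p (Classical.arbitrary S) (Classical.arbitrary A)).pm_le_one

/-- With u = p_∧ / 48 ≤ 1 / 48, -log (1 - u) ≤ u / (1 - u) ≤ p_∧ / 47. -/
theorem le_minSupport_div (M : RobustMDP S A) {δ : ℝ}
    (hδ : δ < -Real.log (1 - M.minSupport / 48)) : δ ≤ M.minSupport / 47 := by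
  have h0 := M.minSupport_pos
  have h1 := M.minSupport_le_one
  have h2 : 0 < 1 - M.minSupport / 48 := by linarith
  have h3 := Real.one_sub_inv_le_log_of_pos h2
  have h4 : (1 - M.minSupport / 48)⁻¹ ≤ 1 + M.minSupport / 47 := by
    rw [inv_le_comm₀ h2 (by positivity), inv_le_iff_one_le_mul₀ (by positivity)]
    nlinarith
  linarith

end MinSupport

/-- The greedy value function `v(q)(s) = max_b q(s, b)`. -/
def maxAct (q : S → A → ℝ) (s : S) : ℝ := ⨆ b, q s b

/-- The robust Bellman operator on `q`-functions in dual form. -/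
def robustBellman (M : RobustMDP S A) (δ : ℝ) (q : S → A → ℝ) (s : S) (a : A) : ℝ :=
  klDual δ (pmfWeight (M.ν s a)) (fun r => (r : ℝ))
    + M.γ * klDual δ (pmfWeight (M.p s a)) (maxAct q)

theorem empiricalBellman_apply (M : RobustMDP S A) (δ : ℝ) (n : ℕ)
    (x : ℕ → S → A → M.rewards × S) (q : S → A → ℝ) (s : S) (a : A) :
    M.empiricalBellman δ n x q s a
      = klDual δ (empWeight n fun i => (x i s a).1) (fun r => (r : ℝ))
        + M.γ * klDual δ (empWeight n fun i => (x i s a).2) (maxAct q) := by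
  rw [← empiricalDual_eq_klDual, ← empiricalDual_eq_klDual]
  rfl

theorem norm_maxAct_sub_le [Nonempty A] (q q' : S → A → ℝ) :
    ‖maxAct q - maxAct q'‖ ≤ ‖q - q'‖ := by
  have h1 : ∀ (q q' : S → A → ℝ) s, maxAct q s ≤ maxAct q' s + ‖q - q'‖ := by
    intro q q' s
    refine ciSup_le fun b => ?_
    have h2 := le_ciSup (Set.finite_range fun b => q' s b).bddAbove b
    have h3 : q s b - q' s b ≤ ‖q - q'‖ := (le_abs_self _).trans
      ((norm_le_pi_norm ((q - q') s) b).trans (norm_le_pi_norm (q - q') s))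
    have h4 : q' s b ≤ maxAct q' s := h2
    linarith
  refine (pi_norm_le_iff_of_nonneg (norm_nonneg _)).2 fun s => ?_
  have h2 := h1 q q' s
  have h3 := h1 q' q s
  rw [norm_sub_rev] at h3
  rw [Pi.sub_apply, Real.norm_eq_abs, abs_le]
  constructor <;> linarith

theorem norm_le_of_forall_abs_le {q : S → A → ℝ} {c : ℝ} (hc : 0 ≤ c)
    (h : ∀ s a, |q s a| ≤ c) : ‖q‖ ≤ c :=
  (pi_norm_le_iff_of_nonneg hc).2 fun s => (pi_norm_le_iff_of_nonneg hc).2 fun a => h s a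

theorem norm_empiricalBellman_sub_le [Nonempty A] (M : RobustMDP S A) {δ : ℝ} (hδ : 0 ≤ δ) {n : ℕ}
    (hn : n ≠ 0) (x : ℕ → S → A → M.rewards × S) (q q' : S → A → ℝ) :
    ‖M.empiricalBellman δ n x q - M.empiricalBellman δ n x q'‖ ≤ M.γ * ‖q - q'‖ := by
  refine norm_le_of_forall_abs_le (mul_nonneg M.γ_pos.le (norm_nonneg _)) fun s a => ?_
  rw [Pi.sub_apply, Pi.sub_apply, empiricalBellman_apply, empiricalBellman_apply,
    add_sub_add_left_eq_sub, ← mul_sub, abs_mul, abs_of_pos M.γ_pos]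
  exact mul_le_mul_of_nonneg_left ((abs_klDual_sub_le hδ (empWeight_nonneg _ _)
    (sum_empWeight hn _) _ _).trans (norm_maxAct_sub_le q q')) M.γ_pos.le

omit [Fintype S] [Fintype A] in
theorem abs_klDual_pmfWeight_le {X : Type*} [Fintype X] {δ : ℝ} (hδ : 0 ≤ δ) (P : PMF X)
    (V : X → ℝ) : |klDual δ (pmfWeight P) V| ≤ ‖V‖ := by
  have := abs_klDual_sub_le hδ (pmfWeight_nonneg P) (sum_toReal_pmf P) V 0
  rwa [klDual_zero hδ (pmfWeight_nonneg P) (sum_toReal_pmf P), sub_zero, sub_zero] at this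

theorem norm_robustBellman_le [Nonempty A] (M : RobustMDP S A) {δ : ℝ} (hδ : 0 ≤ δ)
    (hr : ∀ r ∈ M.rewards, r ∈ Set.Icc (0 : ℝ) 1) (q : S → A → ℝ) :
    ‖M.robustBellman δ q‖ ≤ 1 + M.γ * ‖q‖ := by
  have hm : ‖maxAct q‖ ≤ ‖q‖ := by
    have h := norm_maxAct_sub_le q 0
    have h0 : maxAct (0 : S → A → ℝ) = 0 := by ext s; simp [maxAct]
    rwa [h0, sub_zero, sub_zero] at h
  have hrn : ‖fun r : M.rewards => (r : ℝ)‖ ≤ 1 :=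
    (pi_norm_le_iff_of_nonneg zero_le_one).2 fun r => by
      rw [Real.norm_eq_abs, abs_le]
      exact ⟨by linarith [(hr r r.2).1], (hr r r.2).2⟩
  have hγ := M.γ_pos.le
  refine norm_le_of_forall_abs_le (by positivity) fun s a => ?_
  refine (abs_add_le _ _).trans (add_le_add ((abs_klDual_pmfWeight_le hδ _ _).trans hrn) ?_)
  rw [abs_mul, abs_of_nonneg hγ]
  exact mul_le_mul_of_nonneg_left ((abs_klDual_pmfWeight_le hδ _ _).trans hm) hγ

variable [Nonempty S] [Nonempty A] [MeasurableSpace S] [MeasurableSingletonClass S]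

/-- The constraint set is a product and each of the two infima is attained, so a single pair attains
the sum of the dual values. -/
theorem robustBackup_eq (M : RobustMDP S A) {δ : ℝ} (hδ : 0 < δ) (hδM : δ ≤ M.minSupport / 47)
    (v : S → ℝ) (s : S) (a : A) :
    M.robustBackup δ v s a = klDual δ (pmfWeight (M.ν s a)) (fun r => (r : ℝ))
      + M.γ * klDual δ (pmfWeight (M.p s a)) v := by
  have hlb : ∀ x : klBall (M.p s a) δ × klBall (M.ν s a) δ,
      klDual δ (pmfWeight (M.ν s a)) (fun r => (r : ℝ))
        + M.γ * klDual δ (pmfWeight (M.p s a)) v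
        ≤ pmfExp x.2.1 (fun r => (r : ℝ)) + M.γ * pmfExp x.1.1 v := fun x =>
    add_le_add (klDual_le_pmfExp hδ.le x.2.2 _)
      (mul_le_mul_of_nonneg_left (klDual_le_pmfExp hδ.le x.1.2 _) M.γ_pos.le)
  obtain ⟨P, hP, hPe⟩ := exists_mem_klBall_pmfExp_eq (M.isProbWeight_p s a) hδ hδM v
  obtain ⟨N, hN, hNe⟩ := exists_mem_klBall_pmfExp_eq (M.isProbWeight_ν s a) hδ hδM
    (fun r => (r : ℝ))
  have : Nonempty (klBall (M.p s a) δ × klBall (M.ν s a) δ) := ⟨⟨⟨P, hP⟩, ⟨N, hN⟩⟩⟩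
  refine le_antisymm ?_ (le_ciInf hlb)
  refine (ciInf_le ⟨_, Set.forall_mem_range.2 hlb⟩ ⟨⟨P, hP⟩, ⟨N, hN⟩⟩).trans (le_of_eq ?_)
  simp only [hPe, hNe]

theorem robustBellman_qStar (M : RobustMDP S A) {δ : ℝ} (hδ : 0 < δ)
    (hδM : δ ≤ M.minSupport / 47) : M.robustBellman δ (M.qStar δ) = M.qStar δ := by
  -- The left side unfolds to `bellmanV` applied to `vStar`.
  have hv : maxAct (M.qStar δ) = M.vStar δ :=
    ContractingWith.fixedPoint_isFixedPt (M.bellmanV_contracting δ)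
  funext s a
  rw [robustBellman, hv, qStar, robustBackup_eq M hδ hδM]

theorem norm_qStar_le (M : RobustMDP S A) {δ : ℝ} (hδ : 0 < δ)
    (hδM : δ ≤ M.minSupport / 47) (hr : ∀ r ∈ M.rewards, r ∈ Set.Icc (0 : ℝ) 1) :
    ‖M.qStar δ‖ ≤ (1 - M.γ)⁻¹ := by
  have h := M.norm_robustBellman_le hδ.le hr (M.qStar δ)
  rw [robustBellman_qStar M hδ hδM] at h
  have h1 : 0 < 1 - M.γ := sub_pos.2 M.γ_lt_one
  rw [← one_div, le_div_iff₀ h1]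
  nlinarith [M.γ_pos]

end RobustMDP

/-! ### The deterministic recursion with rescaled linear step sizes. -/

section Recursion

/-- The rescaled linear step size `1 / (1 + a k)`. -/
def stepSize (a : ℝ) (k : ℕ) : ℝ := 1 / (1 + a * k)

theorem stepSize_pos {a : ℝ} (ha : 0 < a) (k : ℕ) : 0 < stepSize a k := by
  unfold stepSize; positivity

theorem stepSize_le_one {a : ℝ} (ha : 0 < a) (k : ℕ) : stepSize a k ≤ 1 := by
  unfold stepSize
  rw [div_le_one (by positivity)]
  have : 0 ≤ a * k := by positivity
  linarith

/-- The averaging recursion `P 0 = 0`, `P (k + 1) = (1 - λ) P k + λ Y k` with rescaled linear step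
size `λ`. -/
def noiseAvg {E : Type*} [AddCommGroup E] [Module ℝ E] (a : ℝ) (Y : ℕ → E) : ℕ → E
  | 0 => 0
  | k + 1 => (1 - stepSize a (k + 1)) • noiseAvg a Y k + stepSize a (k + 1) • Y k

theorem noiseAvg_apply {S A : Type*} (a : ℝ) (Y : ℕ → S → A → ℝ) (k : ℕ) (s : S) (b : A) :
    noiseAvg a Y k s b = noiseAvg a (fun k => Y k s b) k := by
  induction k with
  | zero => rfl
  | succ k ih => simp [noiseAvg, ih]

theorem noiseAvg_congr {E : Type*} [AddCommGroup E] [Module ℝ E] (a : ℝ) {Y Y' : ℕ → E} {k : ℕ}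
    (h : ∀ j < k, Y j = Y' j) : noiseAvg a Y k = noiseAvg a Y' k := by
  induction k with
  | zero => rfl
  | succ k ih =>
    rw [noiseAvg, noiseAvg, ih fun j hj => h j (hj.trans k.lt_succ_self), h k k.lt_succ_self]

/-- Subtracting the averaged noise P leaves a recursion driven by D and Z alone, with ‖D‖ ≤ γ (‖e -
P‖ + ‖P‖). The contraction factor 1 - λ_(k+1) + γ λ_(k+1) equals λ_(k+1) / λ_k, so ‖e_k - P_k‖ / λ_k
grows by at most ‖P_k‖ + b per step. -/
theorem norm_sub_noiseAvg_le {E : Type*} [NormedAddCommGroup E] [NormedSpace ℝ E] {γ b : ℝ}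
    (hγ0 : 0 < γ) (hγ1 : γ < 1) {e D Y Z : ℕ → E} {K : ℕ}
    (hrec : ∀ k < K, e (k + 1) = (1 - stepSize (1 - γ) (k + 1)) • e k
      + stepSize (1 - γ) (k + 1) • (D k + Y k + Z k))
    (hD : ∀ k < K, ‖D k‖ ≤ γ * ‖e k‖) (hZ : ∀ k < K, ‖Z k‖ ≤ b) :
    ∀ k ≤ K, ‖e k - noiseAvg (1 - γ) Y k‖ ≤ stepSize (1 - γ) k *
      (‖e 0‖ + ∑ j ∈ Finset.range k, (‖noiseAvg (1 - γ) Y j‖ + b)) := by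
  have ha : 0 < 1 - γ := sub_pos.2 hγ1
  intro k
  induction k with
  | zero => intro _; simp [noiseAvg, stepSize]
  | succ k ih =>
    intro hk
    have ih := ih (by omega)
    set l := stepSize (1 - γ) (k + 1) with hl
    set P := noiseAvg (1 - γ) Y k with hP
    have hl0 : 0 < l := stepSize_pos ha _
    have hl1 : l ≤ 1 := stepSize_le_one ha _
    have hid : e (k + 1) - noiseAvg (1 - γ) Y (k + 1)
        = (1 - l) • (e k - P) + l • (D k + Z k) := by
      rw [hrec k hk, noiseAvg, ← hl, ← hP]
      module
    have h1 : ‖e (k + 1) - noiseAvg (1 - γ) Y (k + 1)‖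
        ≤ (1 - l) * ‖e k - P‖ + l * (‖D k‖ + ‖Z k‖) := by
      rw [hid]
      refine (norm_add_le _ _).trans ?_
      rw [norm_smul, norm_smul, Real.norm_of_nonneg (by linarith), Real.norm_of_nonneg hl0.le]
      gcongr
      exact norm_add_le _ _
    have h2 : ‖e k‖ ≤ ‖e k - P‖ + ‖P‖ := by
      simpa using norm_add_le (e k - P) P
    have h3 : ‖D k‖ + ‖Z k‖ ≤ γ * ‖e k - P‖ + (‖P‖ + b) := by
      have := hD k hk
      have := hZ k hk
      nlinarith [norm_nonneg P]
    have h4 : (1 - l) + l * γ = l / stepSize (1 - γ) k := by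
      rw [hl, stepSize, stepSize]
      have h5 : 0 < 1 + (1 - γ) * (k : ℝ) := by positivity
      have h6 : 0 < 1 + (1 - γ) * ((k + 1 : ℕ) : ℝ) := by positivity
      push_cast at h6 ⊢
      field_simp
      ring
    rw [Finset.sum_range_succ, ← hP]
    calc _ ≤ (1 - l) * ‖e k - P‖ + l * (γ * ‖e k - P‖ + (‖P‖ + b)) :=
          h1.trans (by gcongr)
      _ = l / stepSize (1 - γ) k * ‖e k - P‖ + l * (‖P‖ + b) := by rw [← h4]; ring
      _ ≤ l / stepSize (1 - γ) k * (stepSize (1 - γ) k *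
          (‖e 0‖ + ∑ j ∈ Finset.range k, (‖noiseAvg (1 - γ) Y j‖ + b))) + l * (‖P‖ + b) := by
          have := stepSize_pos ha k
          gcongr
      _ = _ := by
          have := (stepSize_pos ha k).ne'
          field_simp
          ring

/-- Comparison with the telescoping sum of 2 (√(j + 1) - √j). The term j = 0 is 1 / 0 = 0. -/
theorem sum_inv_sqrt_le (K : ℕ) : ∑ j ∈ Finset.range (K + 1), 1 / Real.sqrt j ≤ 2 * Real.sqrt K := by
  induction K with
  | zero => simp
  | succ K ih =>
    rw [Finset.sum_range_succ]
    have hs : 0 < Real.sqrt ((K + 1 : ℕ) : ℝ) := Real.sqrt_pos.2 (by positivity)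
    have h1 : Real.sqrt K ≤ Real.sqrt ((K + 1 : ℕ) : ℝ) := Real.sqrt_le_sqrt (by push_cast; linarith)
    have h2 : Real.sqrt ((K + 1 : ℕ) : ℝ) ^ 2 = K + 1 := by
      rw [Real.sq_sqrt (by positivity)]; push_cast; ring
    have h3 : Real.sqrt K ^ 2 = K := Real.sq_sqrt (by positivity)
    have h4 : 1 / Real.sqrt ((K + 1 : ℕ) : ℝ)
        ≤ 2 * (Real.sqrt ((K + 1 : ℕ) : ℝ) - Real.sqrt K) := by
      rw [div_le_iff₀ hs]
      nlinarith [Real.sqrt_nonneg (K : ℝ)]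
    linarith

/-- The lower bound on K gives a √K ≥ 100. After multiplication by the step size, the start
contributes at most R / 10000, the noise sum 28 R / 10000 and the constant error b, summed K times,
12 R / 100. -/
theorem recursion_bound_le_half {a c₁ R b : ℝ} {K : ℕ} (ha : 0 < a) (ha1 : a < 1)
    (hc : 10000 ≤ c₁) (hK : c₁ / a ^ 2 ≤ K) (hR : 0 ≤ R) (hb : b ≤ 12 / 100 * a * R) :
    14 / 100 * R / Real.sqrt K + stepSize a K *
      (R + ∑ j ∈ Finset.range K, (14 / 100 * R / Real.sqrt j + b)) ≤ R / 2 := by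
  have hK1 : (100 / a) ^ 2 ≤ K := by
    refine le_trans ?_ hK
    rw [div_pow]
    gcongr
    linarith
  have hs : 100 / a ≤ Real.sqrt K := Real.le_sqrt_of_sq_le hK1
  have hsa : 100 ≤ a * Real.sqrt K := by
    rw [div_le_iff₀ ha] at hs
    linarith
  have hs100 : 100 ≤ Real.sqrt K := hsa.trans (mul_le_of_le_one_left (Real.sqrt_nonneg _) ha1.le)
  have hsK : Real.sqrt K ^ 2 = K := Real.sq_sqrt (by positivity)
  have hsum : ∑ j ∈ Finset.range K, (14 / 100 * R / Real.sqrt j + b)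
      ≤ 14 / 100 * R * (2 * Real.sqrt K) + K * (12 / 100 * a * R) := by
    rw [Finset.sum_add_distrib, Finset.sum_const, Finset.card_range, nsmul_eq_mul]
    refine add_le_add ?_ (mul_le_mul_of_nonneg_left hb (by positivity))
    simp_rw [div_eq_mul_one_div (14 / 100 * R)]
    rw [← Finset.mul_sum]
    refine mul_le_mul_of_nonneg_left (le_trans ?_ (sum_inv_sqrt_le K)) (by positivity)
    exact Finset.sum_le_sum_of_subset_of_nonneg (Finset.range_subset_range.2 K.le_succ)
      fun _ _ _ => by positivity
  set s := Real.sqrt K with hsdef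
  have h1 : 14 / 100 * R / s ≤ 14 / 10000 * R := by
    rw [div_le_iff₀ (by linarith)]
    nlinarith
  have h2 : stepSize a K * (R + ∑ j ∈ Finset.range K, (14 / 100 * R / Real.sqrt j + b))
      ≤ 2 / 10 * R := by
    have hden : 0 < 1 + a * (K : ℝ) := by positivity
    rw [stepSize, one_div, inv_mul_le_iff₀ hden]
    refine (add_le_add_right hsum R).trans ?_
    rw [← hsK]
    have e1 : 100 * s ≤ a * s ^ 2 := by nlinarith
    have e2 : 10000 ≤ a * s ^ 2 := by nlinarith
    nlinarith [mul_le_mul_of_nonneg_right e1 hR, mul_le_mul_of_nonneg_right e2 hR]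
  linarith

end Recursion

/-! ### Concentration of empirical distributions and the induced bias. -/

section Empirical

variable {X : Type*} [Fintype X]

/-- The sample sequences whose empirical distribution is within relative error `ε` of `w`. -/
def goodSample (n : ℕ) (ε : ℝ) (w : X → ℝ) : Set (ℕ → X) :=
  {z | ∀ x, |empWeight n z x - w x| ≤ ε * w x}

/-- The relative deviation of the empirical distribution from `w`. -/
def relDev (n : ℕ) (w : X → ℝ) (z : ℕ → X) (x : X) : ℝ :=
  open Classical in if w x = 0 then 0 else empWeight n z x / w x - 1

/-- The estimation error of a difference of dual functionals. -/
def dualGap (δ : ℝ) (n : ℕ) (w V W : X → ℝ) (z : ℕ → X) : ℝ :=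
  (klDual δ (empWeight n z) V - klDual δ (empWeight n z) W) - (klDual δ w V - klDual δ w W)

theorem empWeight_congr {n : ℕ} {z z' : ℕ → X} (h : ∀ i < n, z i = z' i) :
    empWeight n z = empWeight n z' := by
  funext x
  unfold empWeight
  congr 1
  refine Finset.sum_congr rfl fun i hi => ?_
  rw [h i (Finset.mem_range.1 hi)]

theorem dualGap_congr {δ : ℝ} {n : ℕ} {w V W : X → ℝ} {z z' : ℕ → X} (h : ∀ i < n, z i = z' i) :
    dualGap δ n w V W z = dualGap δ n w V W z' := by
  rw [dualGap, dualGap, empWeight_congr h]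

theorem mem_goodSample_congr {n : ℕ} {ε : ℝ} {w : X → ℝ} {z z' : ℕ → X}
    (h : ∀ i < n, z i = z' i) : z ∈ goodSample n ε w ↔ z' ∈ goodSample n ε w := by
  simp only [goodSample, Set.mem_ofPred_eq, empWeight_congr h]

theorem empWeight_eq_of_good {n : ℕ} {ε : ℝ} {w : X → ℝ} {z : ℕ → X}
    (hz : z ∈ goodSample n ε w) : empWeight n z = fun x => w x * (1 + relDev n w z x) := by
  funext x
  by_cases hx : w x = 0
  · have := hz x
    rw [hx, mul_zero, sub_zero] at this
    rw [hx, zero_mul]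
    exact abs_nonpos_iff.1 this
  · rw [relDev, if_neg hx, add_sub_cancel, mul_div_cancel₀ _ hx]

theorem abs_relDev_le_of_good {n : ℕ} {ε : ℝ} {w : X → ℝ} (hw : ∀ x, 0 ≤ w x) (hε : 0 ≤ ε)
    {z : ℕ → X} (hz : z ∈ goodSample n ε w) (x : X) : |relDev n w z x| ≤ ε := by
  unfold relDev
  split_ifs with hx
  · simpa using hε
  · have hx' := (hw x).lt_of_ne' hx
    have h1 : empWeight n z x / w x - 1 = (empWeight n z x - w x) / w x := by
      rw [sub_div, div_self hx]
    rw [h1, abs_div, abs_of_pos hx', div_le_iff₀ hx']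
    exact hz x

theorem sum_mul_relDev_of_good {n : ℕ} (hn : n ≠ 0) {ε : ℝ} {w : X → ℝ} (hw1 : ∑ x, w x = 1)
    {z : ℕ → X} (hz : z ∈ goodSample n ε w) : ∑ x, w x * relDev n w z x = 0 := by
  have h := sum_empWeight hn z
  rw [empWeight_eq_of_good hz] at h
  simp_rw [mul_add, mul_one] at h
  rw [Finset.sum_add_distrib, hw1] at h
  linarith

theorem empWeight_le_one {n : ℕ} (hn : n ≠ 0) (z : ℕ → X) (x : X) : empWeight n z x ≤ 1 :=
  sum_empWeight hn z ▸ Finset.single_le_sum (f := empWeight n z)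
    (fun y _ => empWeight_nonneg n z y) (Finset.mem_univ x)

theorem abs_relDev_le {n : ℕ} (hn : n ≠ 0) {w : X → ℝ} {pm : ℝ} (hw : IsProbWeight w pm)
    (z : ℕ → X) (x : X) : |relDev n w z x| ≤ 1 / pm := by
  have hpm := hw.pm_pos
  have hpm1 : 1 ≤ 1 / pm := by
    rw [le_div_iff₀ hpm, one_mul]; exact hw.pm_le_one
  unfold relDev
  split_ifs with hx
  · rw [abs_zero]; positivity
  · have h1 : empWeight n z x / w x ≤ 1 / pm :=
      div_le_div₀ zero_le_one (empWeight_le_one hn z x) hpm (hw.pm_le x hx)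
    have h2 : 0 ≤ empWeight n z x / w x := div_nonneg (empWeight_nonneg n z x) (hw.nonneg x)
    rw [abs_le]
    constructor <;> linarith

theorem abs_dualGap_le_of_good {n : ℕ} (hn : n ≠ 0) {δ pm ε : ℝ} {w : X → ℝ}
    (hw : IsProbWeight w pm) (hδ : 0 < δ) (hδpm : δ ≤ pm / 47) (hε : 0 ≤ ε) (hε' : ε ≤ 1 / 25)
    {z : ℕ → X} (hz : z ∈ goodSample n ε w) (V W : X → ℝ) :
    |dualGap δ n w V W z| ≤ 7 * ε * ‖V - W‖ := by
  rw [dualGap, empWeight_eq_of_good hz]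
  exact abs_klDual_sub_sub_le hw hδ hδpm hε hε' (abs_relDev_le_of_good hw.nonneg hε hz)
    (sum_mul_relDev_of_good hn hw.sum_eq hz) V W

variable [MeasurableSpace X] [MeasurableSingletonClass X]

section Law

variable {Ω : Type*} [MeasurableSpace Ω] {μ : Measure Ω} [IsProbabilityMeasure μ]

theorem integral_indicator_eq {z : Ω → X} (hz : Measurable z) (x : X) :
    ∫ ω, (open Classical in if z ω = x then (1 : ℝ) else 0) ∂μ = μ.real {ω | z ω = x} := by
  classical
  have h : MeasurableSet {ω | z ω = x} := hz (measurableSet_singleton x)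
  rw [← integral_indicator_one h]
  refine integral_congr_ae (Filter.Eventually.of_forall fun ω => ?_)
  by_cases hx : z ω = x <;> simp [Set.indicator, hx]

theorem integrable_indicator_eq {z : Ω → X} (hz : Measurable z) (x : X) :
    Integrable (fun ω => open Classical in if z ω = x then (1 : ℝ) else 0) μ := by
  classical
  refine Integrable.of_bound (C := 1) ?_ (Filter.Eventually.of_forall fun ω => ?_)
  · exact (Measurable.ite (hz (measurableSet_singleton x)) measurable_const
      measurable_const).aestronglyMeasurable
  · split_ifs <;> simp

theorem integral_empWeight {n : ℕ} (hn : n ≠ 0) {w : X → ℝ} {z : ℕ → Ω → X}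
    (hz : ∀ i, Measurable (z i)) (hlaw : ∀ i < n, ∀ x, μ.real {ω | z i ω = x} = w x) (x : X) :
    ∫ ω, empWeight n (fun i => z i ω) x ∂μ = w x := by
  unfold empWeight
  rw [integral_const_mul, integral_finsetSum _ fun i _ => integrable_indicator_eq (hz i) x,
    Finset.sum_congr rfl fun i hi => (integral_indicator_eq (hz i) x).trans
      (hlaw i (Finset.mem_range.1 hi) x),
    Finset.sum_const, Finset.card_range, nsmul_eq_mul, inv_mul_cancel_left₀ (by exact_mod_cast hn)]

/-- Extension of a finite tuple to a sequence. -/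
def finExt [Nonempty X] {n : ℕ} (t : Fin n → X) (i : ℕ) : X :=
  if h : i < n then t ⟨i, h⟩ else Classical.arbitrary X

theorem finExt_apply [Nonempty X] {n : ℕ} (z : ℕ → X) {i : ℕ} (hi : i < n) :
    finExt (fun j : Fin n => z j) i = z i := by
  simp [finExt, hi]

/-- The gap depends on n samples only, so the bias estimate is applied to their joint law on the
finite space of n-tuples, with 1 / pm as a deterministic bound on the relative deviation. -/
theorem abs_setIntegral_dualGap_le {n : ℕ} (hn : n ≠ 0) {δ pm ε : ℝ} {w : X → ℝ}
    (hw : IsProbWeight w pm) (hδ : 0 < δ) (hδpm : δ ≤ pm / 47) (hε : 0 ≤ ε) (hε' : ε ≤ 1 / 25)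
    {z : ℕ → Ω → X} (hz : ∀ i, Measurable (z i))
    (hlaw : ∀ i < n, ∀ x, μ.real {ω | z i ω = x} = w x) (V W : X → ℝ) :
    |∫ ω in {ω | (fun i => z i ω) ∈ goodSample n ε w}, dualGap δ n w V W (fun i => z i ω) ∂μ|
      ≤ (100 * ε ^ 2 + 3 * (1 / pm) * μ.real {ω | (fun i => z i ω) ∉ goodSample n ε w})
        * ‖V - W‖ := by
  have : Nonempty X := by
    by_contra h
    rw [not_nonempty_iff] at h
    simpa using hw.sum_eq
  set τ : Ω → Fin n → X := fun ω i => z i ω with hτ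
  have hτm : Measurable τ := measurable_pi_lambda _ fun i => hz i
  set G : Set (Fin n → X) := {t | finExt t ∈ goodSample n ε w} with hG
  have hGm : MeasurableSet G := G.toFinite.measurableSet
  have hGe : {ω | (fun i => z i ω) ∈ goodSample n ε w} = τ ⁻¹' G := by
    ext ω
    exact mem_goodSample_congr fun i hi => (finExt_apply (fun j => z j ω) hi).symm
  have hprob : IsProbabilityMeasure (μ.map τ) := Measure.isProbabilityMeasure_map hτm.aemeasurable
  have hcompl : {ω | (fun i => z i ω) ∉ goodSample n ε w} = τ ⁻¹' Gᶜ := by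
    rw [Set.preimage_compl, ← hGe]; rfl
  have hgap : ∀ ω, dualGap δ n w V W (fun i => z i ω) = dualGap δ n w V W (finExt (τ ω)) :=
    fun ω => dualGap_congr fun i hi => (finExt_apply (fun j => z j ω) hi).symm
  simp_rw [hgap]
  rw [hGe, hcompl, ← map_measureReal_apply hτm hGm.compl,
    ← setIntegral_map (f := fun t => dualGap δ n w V W (finExt t)) hGm
      (Measurable.of_discrete.aestronglyMeasurable) hτm.aemeasurable]
  have key := abs_setIntegral_klDual_sub_sub_le (μ.map τ) hw hδ hδpm hε hε'
    (h := fun t => relDev n w (finExt t)) G (B := 1 / pm) (by have := hw.pm_pos; positivity)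
    (fun t x => abs_relDev_le hn hw _ x) (fun x => ?_)
    (fun t ht x => abs_relDev_le_of_good hw.nonneg hε ht x)
    (fun t ht => sum_mul_relDev_of_good hn hw.sum_eq ht) V W
  · refine le_trans (le_of_eq ?_) key
    congr 1
    refine setIntegral_congr_fun hGm fun t ht => ?_
    simp only [dualGap, empWeight_eq_of_good (show finExt t ∈ goodSample n ε w from ht)]
  · rw [integral_map hτm.aemeasurable Measurable.of_discrete.aestronglyMeasurable]
    unfold relDev
    split_ifs with hx
    · simp
    · have he : ∀ ω, empWeight n (finExt (τ ω)) x = empWeight n (fun i => z i ω) x := fun ω => by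
        rw [empWeight_congr fun i hi => finExt_apply (fun j => z j ω) hi]
      simp_rw [he]
      rw [integral_sub _ (integrable_const _), integral_div, integral_empWeight hn hz hlaw,
        div_self hx]
      · simp
      · refine Integrable.div_const ?_ _
        unfold empWeight
        exact (integrable_finsetSum _ fun i _ => integrable_indicator_eq (hz i) x).const_mul _

/-- Two-sided Hoeffding bound for indicators, whose sub-Gaussian variance proxy is 1 / 4. -/
theorem measureReal_abs_empWeight_sub_le {n : ℕ} (hn : n ≠ 0) {z : ℕ → Ω → X} {c : ℝ} {t : ℝ}
    (ht : 0 ≤ t) (hz : ∀ i, Measurable (z i)) (hind : iIndepFun z μ) (x : X)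
    (hlaw : ∀ i < n, μ.real {ω | z i ω = x} = c) :
    μ.real {ω | t < |empWeight n (fun i => z i ω) x - c|} ≤ 2 * Real.exp (-2 * n * t ^ 2) := by
  classical
  have hn0 : (0 : ℝ) < n := by exact_mod_cast Nat.pos_of_ne_zero hn
  set f : X → ℝ := fun y => if y = x then 1 else 0 with hf
  have hfm : Measurable f := Measurable.of_discrete
  have hsub : ∀ i < n, HasSubgaussianMGF (fun ω => f (z i ω) - c) (1 / 4) μ := by
    intro i hi
    have h := hasSubgaussianMGF_of_mem_Icc (μ := μ) (X := fun ω => f (z i ω)) (a := 0) (b := 1)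
      (hfm.comp (hz i)).aemeasurable (Filter.Eventually.of_forall fun ω => by
        simp only [hf]; split_ifs <;> simp)
    have hint : ∫ ω, f (z i ω) ∂μ = c := by
      rw [← hlaw i hi, ← integral_indicator_eq (hz i) x]
    simp only [hint, sub_zero, nnnorm_one] at h
    convert h using 1
    norm_num
  have hind1 : iIndepFun (fun i ω => f (z i ω) - c) μ :=
    hind.comp (fun _ y => f y - c) fun _ => Measurable.of_discrete
  have hind2 : iIndepFun (fun i ω => -(f (z i ω) - c)) μ :=
    hind.comp (fun _ y => -(f y - c)) fun _ => Measurable.of_discrete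
  have h1 := HasSubgaussianMGF.measure_sum_range_ge_le_of_iIndepFun hind1 hsub
    (ε := n * t) (by positivity)
  have h2 := HasSubgaussianMGF.measure_sum_range_ge_le_of_iIndepFun hind2
    (fun i hi => (hsub i hi).neg) (ε := n * t) (by positivity)
  have he : -(n * t) ^ 2 / (2 * n * ((1 / 4 : NNReal) : ℝ)) = -2 * n * t ^ 2 := by
    push_cast
    field_simp
    norm_num
  rw [he] at h1 h2
  have hemp : ∀ ω, n * (empWeight n (fun i => z i ω) x - c)
      = ∑ i ∈ Finset.range n, (f (z i ω) - c) := by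
    intro ω
    rw [Finset.sum_sub_distrib, Finset.sum_const, Finset.card_range, nsmul_eq_mul, empWeight,
      mul_sub, mul_inv_cancel_left₀ hn0.ne']
  have hsubset : {ω | t < |empWeight n (fun i => z i ω) x - c|}
      ⊆ {ω | n * t ≤ ∑ i ∈ Finset.range n, (f (z i ω) - c)}
        ∪ {ω | n * t ≤ ∑ i ∈ Finset.range n, -(f (z i ω) - c)} := by
    intro ω hω
    simp only [Set.mem_ofPred_eq] at hω
    rcases lt_abs.1 hω with h | h
    · left
      change n * t ≤ _
      rw [← hemp]
      exact mul_le_mul_of_nonneg_left h.le hn0.le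
    · right
      change n * t ≤ _
      rw [Finset.sum_neg_distrib, ← hemp, ← mul_neg]
      exact mul_le_mul_of_nonneg_left h.le hn0.le
  refine (measureReal_mono hsubset).trans ((measureReal_union_le _ _).trans ?_)
  linarith

theorem measureReal_not_goodSample_le {n : ℕ} (hn : n ≠ 0) {pm ε : ℝ} {w : X → ℝ}
    (hw : IsProbWeight w pm) (hε : 0 ≤ ε) {z : ℕ → Ω → X} (hz : ∀ i, Measurable (z i))
    (hind : iIndepFun z μ) (hlaw : ∀ i < n, ∀ x, μ.real {ω | z i ω = x} = w x) :
    μ.real {ω | (fun i => z i ω) ∉ goodSample n ε w}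
      ≤ Fintype.card X * (2 * Real.exp (-2 * n * (ε * pm) ^ 2)) := by
  have hpm := hw.pm_pos
  have hsubset : {ω | (fun i => z i ω) ∉ goodSample n ε w}
      ⊆ ⋃ x, {ω | ε * w x < |empWeight n (fun i => z i ω) x - w x|} := by
    intro ω hω
    simp only [goodSample, Set.mem_ofPred_eq, not_forall, not_le] at hω
    exact Set.mem_iUnion.2 hω
  refine (measureReal_mono hsubset).trans ((measureReal_iUnion_fintype_le _).trans ?_)
  rw [← nsmul_eq_mul, ← Finset.card_univ]
  refine Finset.sum_le_card_nsmul _ _ _ fun x _ => ?_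
  -- Relative accuracy forces exact zeros off the support; a point of weight zero is almost surely
  -- never sampled.
  by_cases hx : w x = 0
  · refine le_trans (le_of_eq ?_) (by positivity : (0 : ℝ) ≤ 2 * Real.exp (-2 * n * (ε * pm) ^ 2))
    have hsub0 : {ω | ε * w x < |empWeight n (fun i => z i ω) x - w x|}
        ⊆ ⋃ i : Fin n, {ω | z i ω = x} := by
      intro ω hω
      rw [Set.mem_iUnion]
      by_contra! hne
      simp only [Set.mem_ofPred_eq, hx, mul_zero, sub_zero, abs_pos] at hω
      refine hω ?_
      unfold empWeight
      rw [Finset.sum_eq_zero, mul_zero]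
      intro i hi
      exact if_neg (hne ⟨i, Finset.mem_range.1 hi⟩)
    refine le_antisymm ((measureReal_mono hsub0).trans
      ((measureReal_iUnion_fintype_le _).trans (le_of_eq ?_))) measureReal_nonneg
    refine Finset.sum_eq_zero fun i _ => ?_
    rw [hlaw i i.2 x, hx]
  · have h := measureReal_abs_empWeight_sub_le hn (mul_nonneg hε (hw.nonneg x)) hz hind x
      (fun i hi => hlaw i hi x)
    refine h.trans ?_
    have h3 : (ε * pm) ^ 2 ≤ (ε * w x) ^ 2 :=
      pow_le_pow_left₀ (by positivity) (mul_le_mul_of_nonneg_left (hw.pm_le x hx) hε) 2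
    have h4 : (n : ℝ) * (ε * pm) ^ 2 ≤ n * (ε * w x) ^ 2 :=
      mul_le_mul_of_nonneg_left h3 (by positivity)
    gcongr 2 * Real.exp ?_
    linarith

end Law

end Empirical

/-! ### Independence of functions of disjoint finite sets of samples. -/

section FiniteDependence

variable {ι E Ω : Type*} [Finite E] [Nonempty E] [MeasurableSpace E] [MeasurableSingletonClass E]
  [MeasurableSpace Ω] {μ : Measure Ω} [IsProbabilityMeasure μ] {X : ι → Ω → E}

/-- A function of finitely many coordinates factors through the restriction to them. -/
theorem exists_factor_of_dependsOn {β : Type*} {f : (ι → E) → β} {S : Finset ι}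
    (hf : DependsOn f (S : Set ι)) :
    ∃ F : ((i : S) → E) → β, ∀ x : ι → E, f x = F fun i => x i := by
  classical
  refine ⟨fun t => f fun j => if h : j ∈ S then t ⟨j, h⟩ else Classical.arbitrary E, fun x => ?_⟩
  refine hf fun i hi => ?_
  rw [Finset.mem_coe] at hi
  simp [hi]

theorem measurable_of_dependsOn {β : Type*} [MeasurableSpace β] {f : (ι → E) → β} {S : Finset ι}
    (hX : ∀ i, Measurable (X i)) (hf : DependsOn f (S : Set ι)) :
    Measurable fun ω => f fun j => X j ω := by
  obtain ⟨F, hF⟩ := exists_factor_of_dependsOn hf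
  simp_rw [hF]
  exact (Measurable.of_discrete (f := F)).comp (measurable_pi_lambda _ fun i => hX i)

theorem indepFun_of_dependsOn {β β' : Type*} [MeasurableSpace β] [MeasurableSpace β']
    {f : (ι → E) → β} {g : (ι → E) → β'} {S T : Finset ι} (hX : ∀ i, Measurable (X i))
    (hind : iIndepFun X μ) (hST : Disjoint S T) (hf : DependsOn f (S : Set ι))
    (hg : DependsOn g (T : Set ι)) :
    IndepFun (fun ω => f fun j => X j ω) (fun ω => g fun j => X j ω) μ := by
  obtain ⟨F, hF⟩ := exists_factor_of_dependsOn hf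
  obtain ⟨G, hG⟩ := exists_factor_of_dependsOn hg
  simp_rw [hF, hG]
  exact (hind.indepFun_finset S T hST hX).comp (Measurable.of_discrete (f := F))
    (Measurable.of_discrete (f := G))

/-- A probability bound for an event with a parameter persists when the parameter is replaced by
an independent random variable. -/
theorem measureReal_le_of_dependsOn {β : Type*} {f : (ι → E) → β} {D : β → (ι → E) → Prop}
    {S T : Finset ι} (hX : ∀ i, Measurable (X i)) (hind : iIndepFun X μ) (hST : Disjoint S T)
    (hf : DependsOn f (S : Set ι)) (hD : ∀ b, DependsOn (D b) (T : Set ι)) {c : ℝ} (hc : 0 ≤ c)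
    (hDc : ∀ b, μ.real {ω | D b fun j => X j ω} ≤ c) :
    μ.real {ω | D (f fun j => X j ω) fun j => X j ω} ≤ c := by
  classical
  -- The random parameter takes finitely many values, so splitting over them replaces conditioning,
  -- and the discrete σ-algebra suffices.
  let _ : MeasurableSpace β := ⊤
  obtain ⟨F, hF⟩ := exists_factor_of_dependsOn hf
  set Q : Ω → β := fun ω => f fun j => X j ω with hQ
  have hQm : Measurable Q := measurable_of_dependsOn hX hf
  have hrange : ∀ ω, Q ω ∈ (Set.finite_range F).toFinset := fun ω => by
    rw [Set.Finite.mem_toFinset, hQ]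
    exact ⟨_, (hF _).symm⟩
  set R := (Set.finite_range F).toFinset with hR
  have hsub : {ω | D (Q ω) fun j => X j ω}
      ⊆ ⋃ b ∈ R, (Q ⁻¹' {b} ∩ {ω | D b fun j => X j ω}) := fun ω hω =>
    Set.mem_biUnion (hrange ω) ⟨rfl, hω⟩
  refine (measureReal_mono hsub (measure_ne_top _ _)).trans
    ((measureReal_biUnion_finset_le _ _).trans ?_)
  have hterm : ∀ b ∈ R, μ.real (Q ⁻¹' {b} ∩ {ω | D b fun j => X j ω}) ≤ μ.real (Q ⁻¹' {b}) * c := by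
    intro b _
    have h := (indepFun_of_dependsOn hX hind hST hf (hD b)).measure_inter_preimage_eq_mul {b} {True}
      (MeasurableSpace.measurableSet_top) (measurableSet_singleton _)
    have he : (fun ω => D b fun j => X j ω) ⁻¹' {True} = {ω | D b fun j => X j ω} := by
      ext ω; simp
    rw [he] at h
    rw [measureReal_def, h, ENNReal.toReal_mul]
    exact mul_le_mul_of_nonneg_left (hDc b) ENNReal.toReal_nonneg
  refine (Finset.sum_le_sum hterm).trans ?_
  rw [← Finset.sum_mul, sum_measureReal_preimage_singleton R
    (fun b _ => hQm MeasurableSpace.measurableSet_top)]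
  exact mul_le_of_le_one_left hc measureReal_le_one

end FiniteDependence

/-! ### Sub-Gaussian tails of the averaged noise. -/

section NoiseTail

variable {Ω : Type*} [MeasurableSpace Ω] {μ : Measure Ω} [IsProbabilityMeasure μ]

theorem _root_.ProbabilityTheory.HasSubgaussianMGF.mono {X : Ω → ℝ} {c c' : NNReal}
    (h : HasSubgaussianMGF X c μ) (hc : c ≤ c') : HasSubgaussianMGF X c' μ where
  integrable_exp_mul := h.integrable_exp_mul
  mgf_le t := (h.mgf_le t).trans (Real.exp_le_exp.2 (by gcongr))

/-- Since a ≤ 1, (1 - λ_(k+1)) λ_k ≤ λ_(k+1); multiplying by 1 - λ_(k+1) gives the claim. It makes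
λ_k an invariant variance factor of the averaging recursion. -/
theorem stepSize_sq_add_le {a : ℝ} (ha : 0 < a) (ha1 : a ≤ 1) (k : ℕ) :
    (1 - stepSize a (k + 1)) ^ 2 * stepSize a k + stepSize a (k + 1) ^ 2 ≤ stepSize a (k + 1) := by
  have h1 := stepSize_le_one ha (k + 1)
  have h2 : (1 - stepSize a (k + 1)) * stepSize a k ≤ stepSize a (k + 1) := by
    unfold stepSize
    push_cast
    have h3 : 0 < 1 + a * (k : ℝ) := by positivity
    have h4 : 0 < 1 + a * ((k : ℝ) + 1) := by positivity
    rw [show 1 - 1 / (1 + a * ((k : ℝ) + 1)) = a * (k + 1) / (1 + a * ((k : ℝ) + 1)) by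
      field_simp; ring, div_mul_div_comm, mul_one, div_le_div_iff₀ (by positivity) h4]
    nlinarith
  nlinarith [mul_le_mul_of_nonneg_left h2 (sub_nonneg.2 h1)]

theorem hasSubgaussianMGF_noiseAvg {a : ℝ} (ha : 0 < a) (ha1 : a ≤ 1) {Y : ℕ → Ω → ℝ}
    {c : NNReal} {K : ℕ} (hY : ∀ k < K, HasSubgaussianMGF (Y k) c μ)
    (hind : ∀ k < K, IndepFun (fun ω => noiseAvg a (fun j => Y j ω) k) (Y k) μ) :
    ∀ k ≤ K, HasSubgaussianMGF (fun ω => noiseAvg a (fun j => Y j ω) k)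
      ((stepSize a k).toNNReal * c) μ := by
  intro k
  induction k with
  | zero =>
    intro _
    exact HasSubgaussianMGF.fun_zero.mono zero_le
  | succ k ih =>
    intro hk
    have h1 := (ih (by omega)).const_mul (1 - stepSize a (k + 1))
    have h2 := (hY k hk).const_mul (stepSize a (k + 1))
    have h3 : IndepFun (fun ω => (1 - stepSize a (k + 1)) * noiseAvg a (fun j => Y j ω) k)
        (fun ω => stepSize a (k + 1) * Y k ω) μ :=
      (hind k hk).comp (measurable_const_mul _) (measurable_const_mul _)
    refine (h1.add_of_indepFun h2 h3).mono ?_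
    rw [← NNReal.coe_le_coe]
    change (1 - stepSize a (k + 1)) ^ 2 * (((stepSize a k).toNNReal : ℝ) * (c : ℝ))
      + stepSize a (k + 1) ^ 2 * (c : ℝ) ≤ ((stepSize a (k + 1)).toNNReal : ℝ) * (c : ℝ)
    rw [Real.coe_toNNReal _ (stepSize_pos ha _).le, Real.coe_toNNReal _ (stepSize_pos ha _).le]
    have := mul_le_mul_of_nonneg_right (stepSize_sq_add_le ha ha1 k) c.coe_nonneg
    linarith

theorem measureReal_abs_ge_le {X : Ω → ℝ} {c : NNReal} (h : HasSubgaussianMGF X c μ) {t : ℝ}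
    (ht : 0 ≤ t) : μ.real {ω | t < |X ω|} ≤ 2 * Real.exp (-t ^ 2 / (2 * c)) := by
  have h1 := h.measure_ge_le ht
  have h2 := h.neg.measure_ge_le ht
  have hsub : {ω | t < |X ω|} ⊆ {ω | t ≤ X ω} ∪ {ω | t ≤ (-X) ω} := fun ω hω => by
    rcases lt_abs.1 (show t < |X ω| from hω) with h | h
    · exact Or.inl h.le
    · exact Or.inr h.le
  refine (measureReal_mono hsub).trans ((measureReal_union_le _ _).trans ?_)
  linarith

/-- Tail bound for the averaged noise of bounded centred variables. -/
theorem measureReal_noiseAvg_gt_le {a : ℝ} (ha : 0 < a) (ha1 : a ≤ 1) {Y : ℕ → Ω → ℝ} {K : ℕ}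
    {σ x : ℝ} (hσ : 0 ≤ σ) (hx : 0 ≤ x) (hYm : ∀ k < K, Measurable (Y k))
    (hYb : ∀ k < K, ∀ ω, |Y k ω| ≤ σ) (hY0 : ∀ k < K, ∫ ω, Y k ω ∂μ = 0)
    (hind : ∀ k < K, IndepFun (fun ω => noiseAvg a (fun j => Y j ω) k) (Y k) μ) {k : ℕ}
    (hk : k ≤ K) :
    μ.real {ω | σ * Real.sqrt (2 * stepSize a k * x) < |noiseAvg a (fun j => Y j ω) k|}
      ≤ 2 * Real.exp (-x) := by
  have hsub : ∀ k < K, HasSubgaussianMGF (Y k) (σ.toNNReal ^ 2) μ := by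
    intro k hk
    have h := hasSubgaussianMGF_of_mem_Icc_of_integral_eq_zero (μ := μ) (a := -σ) (b := σ)
      (hYm k hk).aemeasurable
      (Filter.Eventually.of_forall fun ω => abs_le.1 (hYb k hk ω)) (hY0 k hk)
    refine h.mono (le_of_eq ?_)
    congr 1
    rw [sub_neg_eq_add, ← two_mul]
    ext
    push_cast
    rw [Real.norm_of_nonneg (by positivity), Real.coe_toNNReal _ hσ]
    ring
  have h := measureReal_abs_ge_le (hasSubgaussianMGF_noiseAvg ha ha1 hsub hind k hk)
    (t := σ * Real.sqrt (2 * stepSize a k * x)) (by positivity)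
  -- For σ = 0 the exponent of the tail bound divides by zero and is useless, but the noise
  -- vanishes.
  rcases hσ.eq_or_lt with h0 | h0
  · have hz : ∀ k ≤ K, ∀ ω, noiseAvg a (fun j => Y j ω) k = 0 := by
      intro k hk ω
      rw [noiseAvg_congr a (Y' := fun _ => 0) fun j hj => ?_]
      · clear hk
        induction k with
        | zero => rfl
        | succ k ih => simp [noiseAvg, ih]
      · exact abs_nonpos_iff.1 (h0 ▸ hYb j (hj.trans_le hk) ω)
    refine le_trans (le_of_eq ?_) (by positivity : 0 ≤ 2 * Real.exp (-x))
    simp [hz k hk, ← h0]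
  · refine h.trans (le_of_eq ?_)
    have hs := stepSize_pos ha k
    push_cast
    rw [Real.coe_toNNReal _ hs.le, Real.coe_toNNReal _ hσ, mul_pow, Real.sq_sqrt (by positivity)]
    congr 2
    field_simp

end NoiseTail

/-! ### Finite sets of sample labels. -/

namespace SampleIdx

variable {S : Type u} {A : Type v} [Fintype S] [Fintype A]

/-- The labels of inner samples with epoch in `T`, step in `T'` and sample number below `N`. -/
def innerBox (T T' : Finset ℕ) (N : ℕ) : Finset (SampleIdx S A) :=
  open Classical in
  (T ×ˢ T' ×ˢ Finset.range N ×ˢ (Finset.univ : Finset S) ×ˢ (Finset.univ : Finset A)).image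
    fun j => .inner j.1 j.2.1 j.2.2.1 j.2.2.2.1 j.2.2.2.2

/-- The labels of recentering samples with epoch in `T` and sample number below `N`. -/
def recenterBox (T : Finset ℕ) (N : ℕ) : Finset (SampleIdx S A) :=
  open Classical in
  (T ×ˢ Finset.range N ×ˢ (Finset.univ : Finset S) ×ˢ (Finset.univ : Finset A)).image
    fun j => .recenter j.1 j.2.1 j.2.2.1 j.2.2.2

theorem inner_mem_innerBox {T T' : Finset ℕ} {N l k i : ℕ} {s : S} {a : A} :
    SampleIdx.inner l k i s a ∈ innerBox T T' N ↔ l ∈ T ∧ k ∈ T' ∧ i < N := by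
  simp [innerBox]

theorem recenter_notMem_innerBox {T T' : Finset ℕ} {N l i : ℕ} {s : S} {a : A} :
    SampleIdx.recenter l i s a ∉ innerBox T T' N := by
  simp [innerBox]

theorem recenter_mem_recenterBox {T : Finset ℕ} {N l i : ℕ} {s : S} {a : A} :
    SampleIdx.recenter l i s a ∈ recenterBox T N ↔ l ∈ T ∧ i < N := by
  simp [recenterBox]

theorem inner_notMem_recenterBox {T : Finset ℕ} {N l k i : ℕ} {s : S} {a : A} :
    SampleIdx.inner l k i s a ∉ recenterBox T N := by
  simp [recenterBox]

theorem disjoint_innerBox_of_step {T U T' U' : Finset ℕ} {N N' : ℕ} (h : Disjoint T' U') :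
    Disjoint (innerBox T T' N : Finset (SampleIdx S A)) (innerBox U U' N') := by
  rw [Finset.disjoint_left]
  rintro (⟨l, i, s, a⟩ | ⟨l, k, i, s, a⟩) h1 h2
  · exact recenter_notMem_innerBox h1
  · exact Finset.disjoint_left.1 h (inner_mem_innerBox.1 h1).2.1 (inner_mem_innerBox.1 h2).2.1

/-- The labels of samples in epochs up to `l`. -/
def pastBox (l K n N : ℕ) : Finset (SampleIdx S A) :=
  open Classical in
  innerBox (Finset.range (l + 1)) (Finset.range (K + 1)) n ∪ recenterBox (Finset.range (l + 1)) N

theorem mem_pastBox {l K n N : ℕ} {j : SampleIdx S A} : j ∈ pastBox l K n N ↔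
    j ∈ innerBox (Finset.range (l + 1)) (Finset.range (K + 1)) n
      ∨ j ∈ recenterBox (Finset.range (l + 1)) N := by
  classical
  rw [pastBox, Finset.mem_union]

theorem disjoint_pastBox_innerBox {l K n N n' : ℕ} {T' : Finset ℕ} :
    Disjoint (pastBox l K n N : Finset (SampleIdx S A)) (innerBox {l + 1} T' n') := by
  rw [Finset.disjoint_left]
  rintro (⟨l', i, s, a⟩ | ⟨l', k, i, s, a⟩) h1 h2
  · exact recenter_notMem_innerBox h2
  · rw [mem_pastBox] at h1
    rcases h1 with h1 | h1
    · have e1 := (inner_mem_innerBox.1 h1).1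
      have e2 := (inner_mem_innerBox.1 h2).1
      simp only [Finset.mem_range, Finset.mem_singleton] at e1 e2
      omega
    · exact inner_notMem_recenterBox h1

end SampleIdx

/-! ### Dependence of the iterates on the samples, and the error of one epoch. -/

namespace RobustMDP

variable {S : Type u} {A : Type v}

theorem innerLoop_congr {γ : ℝ} {T T' : ℕ → (S → A → ℝ) → (S → A → ℝ)}
    {Tc Tc' : (S → A → ℝ) → (S → A → ℝ)} {q : S → A → ℝ} {K : ℕ}
    (hT : ∀ k < K, T (k + 1) = T' (k + 1)) (hTc : Tc = Tc') :
    innerLoop γ T Tc q K = innerLoop γ T' Tc' q K := by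
  induction K with
  | zero => rfl
  | succ K ih =>
    rw [innerLoop, innerLoop, ih fun k hk => hT k (hk.trans K.lt_succ_self),
      hT K K.lt_succ_self, hTc]

variable [Fintype S] [Fintype A]

theorem empiricalBellman_congr (M : RobustMDP S A) (δ : ℝ) {n : ℕ}
    {x x' : ℕ → S → A → M.rewards × S} (h : ∀ i < n, ∀ s a, x i s a = x' i s a) :
    M.empiricalBellman δ n x = M.empiricalBellman δ n x' := by
  funext q s a
  rw [empiricalBellman_apply, empiricalBellman_apply]
  rw [empWeight_congr fun i hi => congrArg Prod.fst (h i hi s a),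
    empWeight_congr fun i hi => congrArg Prod.snd (h i hi s a)]

theorem vrIterate_dependsOn (M : RobustMDP S A) (δ : ℝ) (K n N : ℕ) (m : ℕ → ℕ) (l : ℕ)
    (hN : ∀ l' ≤ l, m l' ≤ N) :
    DependsOn (fun x => M.vrIterate δ K n m x l)
      (SampleIdx.pastBox l K n N : Finset (SampleIdx S A)) := by
  induction l with
  | zero => intro x y _; rfl
  | succ l ih =>
    intro x y h
    have ih' := ih (fun l' hl' => hN l' (by omega)) (x := x) (y := y) fun j hj => h j (by
      rw [Finset.mem_coe, SampleIdx.mem_pastBox] at hj ⊢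
      rcases j with ⟨l', i, s, a⟩ | ⟨l', k, i, s, a⟩
      · rcases hj with hj | hj
        · exact absurd hj SampleIdx.recenter_notMem_innerBox
        · rw [SampleIdx.recenter_mem_recenterBox, Finset.mem_range] at hj
          exact Or.inr (SampleIdx.recenter_mem_recenterBox.2
            ⟨Finset.mem_range.2 (by omega), hj.2⟩)
      · rcases hj with hj | hj
        · rw [SampleIdx.inner_mem_innerBox, Finset.mem_range] at hj
          exact Or.inl (SampleIdx.inner_mem_innerBox.2
            ⟨Finset.mem_range.2 (by omega), hj.2⟩)
        · exact absurd hj SampleIdx.inner_notMem_recenterBox)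
    simp only [vrIterate] at ih' ⊢
    rw [ih']
    refine innerLoop_congr (fun k hk => ?_) ?_
    · refine M.empiricalBellman_congr δ fun i hi s a => h _ ?_
      rw [Finset.mem_coe, SampleIdx.mem_pastBox]
      exact Or.inl (SampleIdx.inner_mem_innerBox.2
        ⟨Finset.mem_range.2 (by omega), Finset.mem_range.2 (by omega), hi⟩)
    · refine M.empiricalBellman_congr δ fun i hi s a => h _ ?_
      rw [Finset.mem_coe, SampleIdx.mem_pastBox]
      exact Or.inr (SampleIdx.recenter_mem_recenterBox.2
        ⟨Finset.mem_range.2 (by omega), hi.trans_le (hN _ le_rfl)⟩)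

theorem norm_empiricalBellman_sub_robustBellman_le [Nonempty S] [Nonempty A] (M : RobustMDP S A)
    {δ ε : ℝ} (hδ : 0 < δ)
    (hδM : δ ≤ M.minSupport / 47) (hr : ∀ r ∈ M.rewards, r ∈ Set.Icc (0 : ℝ) 1) {n : ℕ}
    (hn : n ≠ 0) (hε : 0 ≤ ε) (hε' : ε ≤ 1 / 25) {x : ℕ → S → A → M.rewards × S}
    (hp : ∀ s a, (fun i => (x i s a).2) ∈ goodSample n ε (pmfWeight (M.p s a)))
    (hν : ∀ s a, (fun i => (x i s a).1) ∈ goodSample n ε (pmfWeight (M.ν s a)))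
    (q : S → A → ℝ) :
    ‖M.empiricalBellman δ n x q - M.robustBellman δ q‖ ≤ 7 * ε * (1 + ‖q‖) := by
  have hm : ‖maxAct q‖ ≤ ‖q‖ := by
    have h := norm_maxAct_sub_le q 0
    have h0 : maxAct (0 : S → A → ℝ) = 0 := by ext s; simp [maxAct]
    rwa [h0, sub_zero, sub_zero] at h
  have hrn : ‖fun r : M.rewards => (r : ℝ)‖ ≤ 1 :=
    (pi_norm_le_iff_of_nonneg zero_le_one).2 fun r => by
      rw [Real.norm_eq_abs, abs_le]
      exact ⟨by linarith [(hr r r.2).1], (hr r r.2).2⟩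
  refine norm_le_of_forall_abs_le (by positivity) fun s a => ?_
  have h1 := abs_dualGap_le_of_good hn (M.isProbWeight_ν s a) hδ hδM hε hε' (hν s a)
    (fun r => (r : ℝ)) 0
  have h2 := abs_dualGap_le_of_good hn (M.isProbWeight_p s a) hδ hδM hε hε' (hp s a) (maxAct q) 0
  rw [dualGap, klDual_zero hδ.le (empWeight_nonneg n _) (sum_empWeight hn _),
    klDual_zero hδ.le (M.isProbWeight_ν s a).nonneg (M.isProbWeight_ν s a).sum_eq,
    sub_zero, sub_zero, sub_zero] at h1
  rw [dualGap, klDual_zero hδ.le (empWeight_nonneg n _) (sum_empWeight hn _),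
    klDual_zero hδ.le (M.isProbWeight_p s a).nonneg (M.isProbWeight_p s a).sum_eq,
    sub_zero, sub_zero, sub_zero] at h2
  rw [Pi.sub_apply, Pi.sub_apply, empiricalBellman_apply, robustBellman, add_sub_add_comm,
    ← mul_sub]
  refine (abs_add_le _ _).trans ?_
  rw [abs_mul, abs_of_pos M.γ_pos, mul_add]
  refine add_le_add (h1.trans (mul_le_mul_of_nonneg_left hrn (by positivity))) ?_
  refine (mul_le_of_le_one_left (abs_nonneg _) M.γ_lt_one.le).trans ?_
  exact h2.trans (mul_le_mul_of_nonneg_left hm (by positivity))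

/-- The error of one epoch in terms of the averaged noise, the bias and the recentering error. -/
theorem norm_innerLoop_sub_le [Nonempty A] (M : RobustMDP S A) {δ : ℝ} (hδ : 0 ≤ δ) {n K : ℕ}
    (hn : n ≠ 0) {q qs : S → A → ℝ} (hqs : M.robustBellman δ qs = qs)
    (x : ℕ → ℕ → S → A → M.rewards × S) (Tc : (S → A → ℝ) → (S → A → ℝ))
    {Y c : ℕ → S → A → ℝ} {R β z : ℝ} {t : ℕ → ℝ} (hR : ‖q - qs‖ ≤ R) (hβ : 0 ≤ β)
    (hgap : ∀ k < K, ∀ s a, M.γ * dualGap δ n (pmfWeight (M.p s a)) (maxAct qs) (maxAct q)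
      (fun i => (x (k + 1) i s a).2) = Y k s a + c k s a)
    (hc : ∀ k < K, ∀ s a, |c k s a| ≤ β) (hTc : ‖Tc q - M.robustBellman δ q‖ ≤ z)
    (ht : ∀ j ≤ K, 0 ≤ t j)
    (hY : ∀ j ≤ K, ∀ s a, |noiseAvg (1 - M.γ) (fun k => Y k s a) j| ≤ t j) :
    ‖innerLoop M.γ (fun k => M.empiricalBellman δ n (x k)) Tc q K - qs‖
      ≤ t K + stepSize (1 - M.γ) K * (R + ∑ j ∈ Finset.range K, (t j + (β + z))) := by
  have ha : 0 < 1 - M.γ := sub_pos.2 M.γ_lt_one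
  set e : ℕ → S → A → ℝ := fun k =>
    innerLoop M.γ (fun k => M.empiricalBellman δ n (x k)) Tc q k - qs with he
  have hnoise : ∀ j ≤ K, ‖noiseAvg (1 - M.γ) Y j‖ ≤ t j := fun j hj =>
    norm_le_of_forall_abs_le (ht j hj) fun s a => by
      rw [noiseAvg_apply]; exact hY j hj s a
  have key := norm_sub_noiseAvg_le (b := β + z) M.γ_pos M.γ_lt_one (e := e)
    (D := fun k => M.empiricalBellman δ n (x (k + 1)) (e k + qs)
      - M.empiricalBellman δ n (x (k + 1)) qs)
    (Y := Y) (Z := fun k => c k + (Tc q - M.robustBellman δ q)) (K := K) ?_ ?_ ?_ K le_rfl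
  · have h1 : ‖e K‖ ≤ ‖e K - noiseAvg (1 - M.γ) Y K‖ + ‖noiseAvg (1 - M.γ) Y K‖ := by
      simpa using norm_add_le (e K - noiseAvg (1 - M.γ) Y K) (noiseAvg (1 - M.γ) Y K)
    have h2 : ‖e 0‖ ≤ R := hR
    have h3 : stepSize (1 - M.γ) K *
        (‖e 0‖ + ∑ j ∈ Finset.range K, (‖noiseAvg (1 - M.γ) Y j‖ + (β + z)))
        ≤ stepSize (1 - M.γ) K * (R + ∑ j ∈ Finset.range K, (t j + (β + z))) := by
      refine mul_le_mul_of_nonneg_left (add_le_add h2 (Finset.sum_le_sum fun j hj => ?_))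
        (stepSize_pos ha K).le
      have := hnoise j (Finset.mem_range.1 hj).le
      linarith
    have h4 := hnoise K le_rfl
    change ‖e K‖ ≤ _
    linarith
  · intro k hk
    have hstep : (1 / (1 + (1 - M.γ) * ((k : ℝ) + 1))) = stepSize (1 - M.γ) (k + 1) := by
      rw [stepSize]; push_cast; rfl
    -- The reward parts cancel in the difference, which is why only the next states of inner samples
    -- enter. What is left is noise, bias and the exact difference.
    have hid : M.empiricalBellman δ n (x (k + 1)) qs - M.empiricalBellman δ n (x (k + 1)) q
        = Y k + c k + (qs - M.robustBellman δ q) := by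
      funext s a
      have h1 := hgap k hk s a
      have h2 := congrFun (congrFun hqs s) a
      rw [dualGap] at h1
      rw [robustBellman] at h2
      simp only [Pi.sub_apply, Pi.add_apply, empiricalBellman_apply, robustBellman]
      linarith
    have hek : e k + qs = innerLoop M.γ (fun k => M.empiricalBellman δ n (x k)) Tc q k :=
      sub_add_cancel _ _
    have hek1 : e (k + 1) = (1 - stepSize (1 - M.γ) (k + 1)) • (e k + qs)
        + stepSize (1 - M.γ) (k + 1) • (M.empiricalBellman δ n (x (k + 1)) (e k + qs)
          - M.empiricalBellman δ n (x (k + 1)) q + Tc q) - qs := by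
      rw [hek, ← hstep]
      rfl
    have hid' : M.empiricalBellman δ n (x (k + 1)) q
        = M.empiricalBellman δ n (x (k + 1)) qs - (Y k + c k + (qs - M.robustBellman δ q)) := by
      rw [← hid]; abel
    rw [hek1, hid']
    module
  · intro k hk
    refine (M.norm_empiricalBellman_sub_le hδ hn _ _ _).trans (le_of_eq ?_)
    rw [add_sub_cancel_right]
  · intro k hk
    refine (norm_add_le _ _).trans (add_le_add ?_ hTc)
    exact norm_le_of_forall_abs_le hβ fun s a => hc k hk s a

end RobustMDP

/-! ### Random samples: truncated noise, its mean and its tail. -/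

namespace RobustMDP

variable {S : Type u} {A : Type v} [Fintype S] [Nonempty S] [Fintype A] [Nonempty A]
  [MeasurableSpace S] [MeasurableSingletonClass S]

/-- The samples `X` are measurable, independent, and drawn from the simulator of `M`. -/
structure IsSampleFamily {Ω : Type w} [MeasurableSpace Ω] (M : RobustMDP S A) (μ : Measure Ω)
    (X : SampleIdx S A → Ω → M.rewards × S) : Prop where
  measurable : ∀ j, Measurable (X j)
  indep : iIndepFun X μ
  map_eq : ∀ j, μ.map (X j)
    = (M.ν j.state j.action).toMeasure.prod (M.p j.state j.action).toMeasure

/-- The next states observed in the `k`-th inner operator of epoch `l`. -/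
def innerStates (M : RobustMDP S A) (l k : ℕ) (s : S) (a : A)
    (x : SampleIdx S A → M.rewards × S) (i : ℕ) : S := (x (.inner l k i s a)).2

/-- The next states observed in the recentering operator of epoch `l`. -/
def recenterStates (M : RobustMDP S A) (l : ℕ) (s : S) (a : A)
    (x : SampleIdx S A → M.rewards × S) (i : ℕ) : S := (x (.recenter l i s a)).2

/-- The rewards observed in the recentering operator of epoch `l`. -/
def recenterRewards (M : RobustMDP S A) (l : ℕ) (s : S) (a : A)
    (x : SampleIdx S A → M.rewards × S) (i : ℕ) : M.rewards := (x (.recenter l i s a)).1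

instance (M : RobustMDP S A) : Nonempty (M.rewards × S) := by
  obtain ⟨r, _⟩ := (M.ν (Classical.arbitrary S) (Classical.arbitrary A)).support_nonempty
  exact ⟨(r, Classical.arbitrary S)⟩

variable {Ω : Type w} [MeasurableSpace Ω] {μ : Measure Ω} [IsProbabilityMeasure μ]
  {M : RobustMDP S A} {X : SampleIdx S A → Ω → M.rewards × S}

namespace IsSampleFamily

theorem measureReal_snd (H : M.IsSampleFamily μ X) (j : SampleIdx S A) (s' : S) :
    μ.real {ω | (X j ω).2 = s'} = pmfWeight (M.p j.state j.action) s' := by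
  have h : {ω | (X j ω).2 = s'} = X j ⁻¹' (Set.univ ×ˢ {s'}) := by ext ω; simp
  rw [h, ← map_measureReal_apply (H.measurable j)
    (MeasurableSet.univ.prod (measurableSet_singleton s')), H.map_eq, measureReal_prod_prod,
    probReal_univ, one_mul, toMeasure_real_singleton]

theorem measureReal_fst (H : M.IsSampleFamily μ X) (j : SampleIdx S A) (r : M.rewards) :
    μ.real {ω | (X j ω).1 = r} = pmfWeight (M.ν j.state j.action) r := by
  have h : {ω | (X j ω).1 = r} = X j ⁻¹' ({r} ×ˢ Set.univ) := by ext ω; simp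
  rw [h, ← map_measureReal_apply (H.measurable j)
    ((measurableSet_singleton r).prod MeasurableSet.univ), H.map_eq, measureReal_prod_prod,
    probReal_univ, mul_one, toMeasure_real_singleton]

theorem measureReal_inner_not_good_le (H : M.IsSampleFamily μ X) {n : ℕ} (hn : n ≠ 0) {ε : ℝ}
    (hε : 0 ≤ ε) (l k : ℕ) (s : S) (a : A) :
    μ.real {ω | M.innerStates l k s a (fun j => X j ω) ∉ goodSample n ε (pmfWeight (M.p s a))}
      ≤ Fintype.card S * (2 * Real.exp (-2 * n * (ε * M.minSupport) ^ 2)) := by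
  refine measureReal_not_goodSample_le hn (M.isProbWeight_p s a) hε
    (z := fun i ω => (X (.inner l k i s a) ω).2) (fun i => (H.measurable _).snd) ?_
    fun i _ x => H.measureReal_snd (.inner l k i s a) x
  exact (H.indep.precomp (g := fun i => SampleIdx.inner l k i s a)
    fun i i' h => by injection h).comp (fun _ => Prod.snd) fun _ => measurable_snd

theorem measureReal_recenter_not_good_le (H : M.IsSampleFamily μ X) {n : ℕ} (hn : n ≠ 0) {ε : ℝ}
    (hε : 0 ≤ ε) (l : ℕ) (s : S) (a : A) :
    μ.real {ω | M.recenterStates l s a (fun j => X j ω) ∉ goodSample n ε (pmfWeight (M.p s a))}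
      ≤ Fintype.card S * (2 * Real.exp (-2 * n * (ε * M.minSupport) ^ 2)) := by
  refine measureReal_not_goodSample_le hn (M.isProbWeight_p s a) hε
    (z := fun i ω => (X (.recenter l i s a) ω).2) (fun i => (H.measurable _).snd) ?_
    fun i _ x => H.measureReal_snd (.recenter l i s a) x
  exact (H.indep.precomp (g := fun i => SampleIdx.recenter l i s a)
    fun i i' h => by injection h).comp (fun _ => Prod.snd) fun _ => measurable_snd

theorem measureReal_recenter_rewards_not_good_le (H : M.IsSampleFamily μ X) {n : ℕ} (hn : n ≠ 0)
    {ε : ℝ} (hε : 0 ≤ ε) (l : ℕ) (s : S) (a : A) :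
    μ.real {ω | M.recenterRewards l s a (fun j => X j ω) ∉ goodSample n ε (pmfWeight (M.ν s a))}
      ≤ M.rewards.card * (2 * Real.exp (-2 * n * (ε * M.minSupport) ^ 2)) := by
  rw [← Fintype.card_coe M.rewards]
  refine measureReal_not_goodSample_le hn (M.isProbWeight_ν s a) hε
    (z := fun i ω => (X (.recenter l i s a) ω).1) (fun i => (H.measurable _).fst) ?_
    fun i _ x => H.measureReal_fst (.recenter l i s a) x
  exact (H.indep.precomp (g := fun i => SampleIdx.recenter l i s a)
    fun i i' h => by injection h).comp (fun _ => Prod.fst) fun _ => measurable_fst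

end IsSampleFamily

/-- The mean over good samples of the estimation error of the difference between `qs` and `q`. -/
def gapMean (M : RobustMDP S A) (δ : ℝ) (n : ℕ) (ε : ℝ) (μ : Measure Ω)
    (X : SampleIdx S A → Ω → M.rewards × S) (qs q : S → A → ℝ) (l k : ℕ) (s : S) (a : A) : ℝ :=
  ∫ ω in {ω | M.innerStates l k s a (fun j => X j ω) ∈ goodSample n ε (pmfWeight (M.p s a))},
    dualGap δ n (pmfWeight (M.p s a)) (maxAct qs) (maxAct q)
      (M.innerStates l k s a fun j => X j ω) ∂μ

/-- The centred and truncated noise of the `(k + 1)`-st inner update of epoch `l`. -/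
def noiseTerm (M : RobustMDP S A) (δ : ℝ) (n : ℕ) (ε : ℝ) (μ : Measure Ω)
    (X : SampleIdx S A → Ω → M.rewards × S) (qs q : S → A → ℝ) (l k : ℕ) (s : S) (a : A)
    (x : SampleIdx S A → M.rewards × S) : ℝ :=
  M.γ * ((goodSample n ε (pmfWeight (M.p s a))).indicator
    (dualGap δ n (pmfWeight (M.p s a)) (maxAct qs) (maxAct q)) (M.innerStates l (k + 1) s a x)
      - M.gapMean δ n ε μ X qs q l (k + 1) s a)

theorem innerStates_dependsOn (M : RobustMDP S A) (l k : ℕ) (s : S) (a : A) {n : ℕ}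
    {x y : SampleIdx S A → M.rewards × S}
    (h : ∀ j ∈ ((SampleIdx.innerBox {l} {k} n : Finset (SampleIdx S A)) : Set (SampleIdx S A)),
      x j = y j) :
    ∀ i < n, M.innerStates l k s a x i = M.innerStates l k s a y i := fun i hi => by
  rw [innerStates, h _ (Finset.mem_coe.2 (SampleIdx.inner_mem_innerBox.2 (by simp [hi]))),
    innerStates]

theorem noiseTerm_dependsOn (M : RobustMDP S A) (δ : ℝ) (n : ℕ) (ε : ℝ) (μ : Measure Ω)
    (X : SampleIdx S A → Ω → M.rewards × S) (qs q : S → A → ℝ) (l k : ℕ) (s : S) (a : A) :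
    DependsOn (M.noiseTerm δ n ε μ X qs q l k s a)
      (SampleIdx.innerBox {l} {k + 1} n : Finset (SampleIdx S A)) := by
  classical
  intro x y h
  have h' := M.innerStates_dependsOn l (k + 1) s a h
  rw [noiseTerm, noiseTerm, Set.indicator_apply, Set.indicator_apply, dualGap_congr h',
    if_congr (mem_goodSample_congr h') rfl rfl]

theorem noiseAvg_noiseTerm_dependsOn (M : RobustMDP S A) (δ : ℝ) (n : ℕ) (ε : ℝ) (μ : Measure Ω)
    (X : SampleIdx S A → Ω → M.rewards × S) (qs q : S → A → ℝ) (l k : ℕ) (s : S) (a : A) (b : ℝ) :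
    DependsOn (fun x => noiseAvg b (fun j => M.noiseTerm δ n ε μ X qs q l j s a x) k)
      (SampleIdx.innerBox {l} (Finset.range (k + 1)) n : Finset (SampleIdx S A)) := by
  intro x y h
  refine noiseAvg_congr b fun j hj => M.noiseTerm_dependsOn δ n ε μ X qs q l j s a fun i hi => ?_
  refine h i ?_
  rw [Finset.mem_coe] at hi ⊢
  rcases i with ⟨l', i, s, a⟩ | ⟨l', k', i, s, a⟩
  · exact absurd hi SampleIdx.recenter_notMem_innerBox
  · rw [SampleIdx.inner_mem_innerBox] at hi ⊢
    obtain ⟨h1, h2, h3⟩ := hi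
    rw [Finset.mem_singleton] at h2
    exact ⟨h1, Finset.mem_range.2 (by omega), h3⟩

section Tail

variable {δ ε R : ℝ} {n : ℕ} {qs q : S → A → ℝ}

theorem measurableSet_inner_good (H : M.IsSampleFamily μ X) (n : ℕ) (ε : ℝ) (l k : ℕ) (s : S)
    (a : A) : MeasurableSet {ω | M.innerStates l k s a (fun j => X j ω)
      ∈ goodSample n ε (pmfWeight (M.p s a))} := by
  have h : DependsOn (fun x : SampleIdx S A → M.rewards × S =>
      M.innerStates l k s a x ∈ goodSample n ε (pmfWeight (M.p s a)))
      (SampleIdx.innerBox {l} {k} n : Finset (SampleIdx S A)) := fun x y h =>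
    propext (mem_goodSample_congr (M.innerStates_dependsOn l k s a h))
  exact measurableSet_setOfPred.2 (measurable_of_dependsOn (X := X)
    (f := fun x : SampleIdx S A → M.rewards × S =>
      M.innerStates l k s a x ∈ goodSample n ε (pmfWeight (M.p s a))) H.measurable h)

theorem measurable_dualGap_inner (H : M.IsSampleFamily μ X) (V W : S → ℝ) (w : S → ℝ)
    (l k : ℕ) (s : S) (a : A) :
    Measurable fun ω => dualGap δ n w V W (M.innerStates l k s a fun j => X j ω) := by
  have h : DependsOn (fun x : SampleIdx S A → M.rewards × S =>
      dualGap δ n w V W (M.innerStates l k s a x))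
      (SampleIdx.innerBox {l} {k} n : Finset (SampleIdx S A)) := fun x y h =>
    dualGap_congr (M.innerStates_dependsOn l k s a h)
  exact measurable_of_dependsOn (X := X) (f := fun x : SampleIdx S A → M.rewards × S =>
    dualGap δ n w V W (M.innerStates l k s a x)) H.measurable h

theorem abs_indicator_dualGap_le (hδ : 0 < δ) (hδM : δ ≤ M.minSupport / 47) (hn : n ≠ 0)
    (hε : 0 ≤ ε) (hε' : ε ≤ 1 / 25) (hR : ‖q - qs‖ ≤ R) (s : S) (a : A) (z : ℕ → S) :
    |(goodSample n ε (pmfWeight (M.p s a))).indicator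
      (dualGap δ n (pmfWeight (M.p s a)) (maxAct qs) (maxAct q)) z| ≤ 7 * ε * R := by
  classical
  have hR0 : 0 ≤ R := (norm_nonneg _).trans hR
  rw [Set.indicator_apply]
  split_ifs with hz
  · refine (abs_dualGap_le_of_good hn (M.isProbWeight_p s a) hδ hδM hε hε' hz _ _).trans ?_
    refine mul_le_mul_of_nonneg_left ((norm_maxAct_sub_le _ _).trans ?_) (by positivity)
    rwa [norm_sub_rev]
  · rw [abs_zero]; positivity

theorem gapMean_eq_integral (H : M.IsSampleFamily μ X) (l k : ℕ) (s : S) (a : A) :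
    M.gapMean δ n ε μ X qs q l k s a
      = ∫ ω, (goodSample n ε (pmfWeight (M.p s a))).indicator
      (dualGap δ n (pmfWeight (M.p s a)) (maxAct qs) (maxAct q))
        (M.innerStates l k s a fun j => X j ω) ∂μ := by
  rw [gapMean, ← integral_indicator (measurableSet_inner_good H n ε l k s a)]
  rfl

theorem measurable_indicator_dualGap (H : M.IsSampleFamily μ X) (l k : ℕ) (s : S) (a : A) :
    Measurable fun ω => (goodSample n ε (pmfWeight (M.p s a))).indicator
      (dualGap δ n (pmfWeight (M.p s a)) (maxAct qs) (maxAct q))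
        (M.innerStates l k s a fun j => X j ω) :=
  (measurable_dualGap_inner (δ := δ) (n := n) H (maxAct qs) (maxAct q)
    (pmfWeight (M.p s a)) l k s a).indicator (measurableSet_inner_good H n ε l k s a)

/-- The crude bound of first order in ε; together with the same bound on the truncated gap it bounds
the centred noise by 14 ε R. -/
theorem abs_gapMean_le (H : M.IsSampleFamily μ X) (hδ : 0 < δ) (hδM : δ ≤ M.minSupport / 47)
    (hn : n ≠ 0) (hε : 0 ≤ ε) (hε' : ε ≤ 1 / 25) (hR : ‖q - qs‖ ≤ R) (l k : ℕ) (s : S) (a : A) :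
    |M.gapMean δ n ε μ X qs q l k s a| ≤ 7 * ε * R := by
  rw [gapMean_eq_integral H, ← Real.norm_eq_abs]
  refine (norm_integral_le_of_norm_le_const (C := 7 * ε * R)
    (Filter.Eventually.of_forall fun ω => ?_)).trans (le_of_eq ?_)
  · exact abs_indicator_dualGap_le hδ hδM hn hε hε' hR s a _
  · rw [probReal_univ, mul_one]

/-- The bound of second order in ε, needed because this mean enters every update as a bias that
averaging does not reduce. -/
theorem abs_gapMean_le_bias (H : M.IsSampleFamily μ X) (hδ : 0 < δ) (hδM : δ ≤ M.minSupport / 47)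
    (hn : n ≠ 0) (hε : 0 ≤ ε) (hε' : ε ≤ 1 / 25) (hR : ‖q - qs‖ ≤ R) (l k : ℕ) (s : S) (a : A) :
    |M.gapMean δ n ε μ X qs q l k s a| ≤ (100 * ε ^ 2 + 3 * (1 / M.minSupport)
      * (Fintype.card S * (2 * Real.exp (-2 * n * (ε * M.minSupport) ^ 2)))) * R := by
  have hR0 : 0 ≤ R := (norm_nonneg _).trans hR
  have hpm := M.minSupport_pos
  refine (abs_setIntegral_dualGap_le hn (M.isProbWeight_p s a) hδ hδM hε hε'
    (z := fun i ω => (X (.inner l k i s a) ω).2) (fun i => (H.measurable _).snd)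
    (fun i _ x => H.measureReal_snd (.inner l k i s a) x) (maxAct qs) (maxAct q)).trans ?_
  have h1 := H.measureReal_inner_not_good_le hn hε l k s a
  have h2 : ‖maxAct qs - maxAct q‖ ≤ R := (norm_maxAct_sub_le _ _).trans (by rwa [norm_sub_rev])
  refine mul_le_mul ?_ h2 (norm_nonneg _) (by positivity)
  gcongr
  exact h1

theorem measureReal_noiseAvg_noiseTerm_le (H : M.IsSampleFamily μ X) (hδ : 0 < δ)
    (hδM : δ ≤ M.minSupport / 47) (hn : n ≠ 0) (hε : 0 ≤ ε) (hε' : ε ≤ 1 / 25)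
    (hR : ‖q - qs‖ ≤ R) {x : ℝ} (hx : 0 ≤ x) (l k : ℕ) (s : S) (a : A) :
    μ.real {ω | 14 * ε * R * Real.sqrt (2 * stepSize (1 - M.γ) k * x)
      < |noiseAvg (1 - M.γ) (fun j => M.noiseTerm δ n ε μ X qs q l j s a fun i => X i ω) k|}
      ≤ 2 * Real.exp (-x) := by
  have hR0 : 0 ≤ R := (norm_nonneg _).trans hR
  have hγ := M.γ_pos
  have hγ1 := M.γ_lt_one
  refine measureReal_noiseAvg_gt_le (Y := fun j ω => M.noiseTerm δ n ε μ X qs q l j s a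
    fun i => X i ω) (K := k) (by linarith) (by linarith) (by positivity) hx
    (fun j _ => measurable_of_dependsOn H.measurable (M.noiseTerm_dependsOn δ n ε μ X qs q l j s a))
    (fun j _ ω => ?_) (fun j _ => ?_) (fun j _ => ?_) le_rfl
  · have h1 := abs_indicator_dualGap_le hδ hδM hn hε hε' hR s a
      (M.innerStates l (j + 1) s a fun i => X i ω)
    have h2 := abs_gapMean_le H hδ hδM hn hε hε' hR l (j + 1) s a
    rw [noiseTerm, abs_mul, abs_of_pos hγ]
    refine (mul_le_of_le_one_left (abs_nonneg _) hγ1.le).trans ((abs_sub _ _).trans ?_)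
    linarith
  · simp only [noiseTerm]
    rw [integral_const_mul, integral_sub, integral_const, probReal_univ, one_smul,
      gapMean_eq_integral H, sub_self, mul_zero]
    · refine Integrable.of_bound (C := 7 * ε * R)
        (measurable_indicator_dualGap H l (j + 1) s a).aestronglyMeasurable
        (Filter.Eventually.of_forall fun ω => ?_)
      exact abs_indicator_dualGap_le hδ hδM hn hε hε' hR s a _
    · exact integrable_const _
  · refine indepFun_of_dependsOn H.measurable H.indep
      (SampleIdx.disjoint_innerBox_of_step ?_)
      (M.noiseAvg_noiseTerm_dependsOn δ n ε μ X qs q l j s a (1 - M.γ))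
      (M.noiseTerm_dependsOn δ n ε μ X qs q l j s a)
    simp

end Tail

end RobustMDP

/-! ### Union bound and the numerical choice of sample sizes. -/

theorem measureReal_exists_mem_le {Ω ι : Type*} [MeasurableSpace Ω] {μ : Measure Ω}
    [IsProbabilityMeasure μ] (s : Finset ι) {P : ι → Ω → Prop} {c : ℝ}
    (h : ∀ i ∈ s, μ.real {ω | P i ω} ≤ c) : μ.real {ω | ∃ i ∈ s, P i ω} ≤ s.card * c := by
  have he : {ω | ∃ i ∈ s, P i ω} = ⋃ i ∈ s, {ω | P i ω} := by ext ω; simp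
  rw [he, ← nsmul_eq_mul]
  exact (measureReal_biUnion_finset_le _ _).trans (Finset.sum_le_card_nsmul _ _ _ h)

/-- The batch size makes the relative accuracy `√a / (100 x)` of the samples likely. -/
theorem exp_neg_batch_le {a pm x n : ℝ} (ha : 0 < a) (hpm : 0 < pm) (hpm1 : pm ≤ 1) (hx : 2 ≤ x)
    (hn : 10000 * x ^ 4 / (pm ^ 3 * a) ≤ n) :
    Real.exp (-2 * n * (Real.sqrt a / (100 * x) * pm) ^ 2) ≤ pm * Real.exp (-x) := by
  have h1 : x ^ 2 / pm ≤ n * (Real.sqrt a / (100 * x) * pm) ^ 2 := by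
    rw [mul_pow, div_pow, Real.sq_sqrt ha.le]
    refine le_trans (le_of_eq ?_) (mul_le_mul_of_nonneg_right hn (by positivity))
    field_simp
    norm_num
  have h2 : x ≤ x ^ 2 / pm := by
    rw [le_div_iff₀ hpm]; nlinarith
  have h3 : 1 / pm ≤ x ^ 2 / pm := by
    gcongr; nlinarith
  -- The gained factor pm later cancels the bound 1 / pm on relative deviations in the bias.
  have h4 : Real.exp (-(1 / pm)) ≤ pm := by
    rw [Real.exp_neg, inv_le_comm₀ (Real.exp_pos _) hpm, ← one_div]
    linarith [Real.add_one_le_exp (1 / pm)]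
  calc Real.exp (-2 * n * (Real.sqrt a / (100 * x) * pm) ^ 2)
      ≤ Real.exp (-(1 / pm) + -x) := Real.exp_le_exp.2 (by linarith)
    _ ≤ pm * Real.exp (-x) := by
        rw [Real.exp_add]; gcongr

theorem exp_neg_recenter_le {a pm y m : ℝ} (l : ℕ) (ha : 0 < a) (hpm : 0 < pm) (hpm1 : pm ≤ 1)
    (hy : 1 ≤ y) (hm : 10000 * 4 ^ l * y ^ 2 / (pm ^ 3 * a ^ 2) ≤ m) :
    Real.exp (-2 * m * ((2 : ℝ)⁻¹ ^ l * a / 100 * pm) ^ 2) ≤ Real.exp (-y) := by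
  have h1 : y ^ 2 / pm ≤ m * ((2 : ℝ)⁻¹ ^ l * a / 100 * pm) ^ 2 := by
    refine le_trans (le_of_eq ?_) (mul_le_mul_of_nonneg_right hm (by positivity))
    rw [show (4 : ℝ) ^ l = 2 ^ l * 2 ^ l by rw [← mul_pow]; norm_num, inv_pow]
    field_simp
    norm_num
  have h2 : y ≤ y ^ 2 / pm := by
    rw [le_div_iff₀ hpm]; nlinarith
  exact Real.exp_le_exp.2 (by linarith)

/-- Here a j λ_j ≤ 1 and √(2 x) ≤ x: the factor √a / x in the accuracy compensates the growth of the
step size as a ↓ 0 and the deviation level x. -/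
theorem sqrt_div_mul_sqrt_stepSize_le {a x : ℝ} (ha : 0 < a) (hx : 2 ≤ x) (j : ℕ) :
    Real.sqrt a / (100 * x) * Real.sqrt (2 * stepSize a (j + 1) * x)
      ≤ 1 / 100 / Real.sqrt ((j + 1 : ℕ) : ℝ) := by
  have hj0 : (0 : ℝ) < ((j + 1 : ℕ) : ℝ) := by positivity
  rw [stepSize]
  generalize ((j + 1 : ℕ) : ℝ) = r at hj0 ⊢
  have h2 : Real.sqrt a * Real.sqrt (2 * (1 / (1 + a * r)) * x) * Real.sqrt r ≤ x := by
    rw [← Real.sqrt_mul ha.le, ← Real.sqrt_mul (by positivity)]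
    refine Real.sqrt_le_iff.2 ⟨by linarith, ?_⟩
    have h3 : a * r / (1 + a * r) ≤ 1 := by
      rw [div_le_one (by positivity)]; linarith
    calc _ = 2 * x * (a * r / (1 + a * r)) := by ring
      _ ≤ 2 * x * 1 := by gcongr
      _ ≤ x ^ 2 := by nlinarith
  rw [le_div_iff₀ (Real.sqrt_pos.2 hj0), div_mul_eq_mul_div, div_mul_eq_mul_div,
    div_le_div_iff₀ (by positivity) (by norm_num)]
  linarith

/-- The quadratic term is at most a / 100 because x ≥ 1; the bad event contributes at most 1 / K ≤ a
/ 10000. -/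
theorem batch_bias_le {a pm x d s E c₁ K : ℝ} (ha : 0 < a) (ha1 : a < 1) (hpm : 0 < pm)
    (hx : 2 ≤ x) (hs : 0 ≤ s) (hsd : s ≤ d) (hE : E ≤ pm * Real.exp (-x)) (hc : 10000 ≤ c₁)
    (hK : c₁ / a ^ 2 ≤ K) (hxd : 8 * d * K * Real.exp (-x) ≤ 1) :
    100 * (Real.sqrt a / (100 * x)) ^ 2 + 3 * (1 / pm) * (s * (2 * E)) ≤ 15 / 1000 * a := by
  have hd : 0 ≤ d := hs.trans hsd
  have hK0 : 0 < K := lt_of_lt_of_le (by positivity) hK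
  have h1 : 100 * (Real.sqrt a / (100 * x)) ^ 2 ≤ a / 100 := by
    rw [div_pow, Real.sq_sqrt ha.le, mul_pow, mul_div_assoc',
      div_le_div_iff₀ (by positivity) (by norm_num)]
    have := mul_le_mul_of_nonneg_left (by nlinarith : 1 ≤ x ^ 2) ha.le
    linarith
  have h2 : 3 * (1 / pm) * (s * (2 * E)) ≤ 8 * (d * Real.exp (-x)) := by
    calc _ ≤ 3 * (1 / pm) * (s * (2 * (pm * Real.exp (-x)))) := by gcongr
      _ ≤ 3 * (1 / pm) * (d * (2 * (pm * Real.exp (-x)))) := by gcongr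
      _ = 6 * (d * Real.exp (-x)) := by field_simp; ring
      _ ≤ _ := by
        have : 0 ≤ d * Real.exp (-x) := by positivity
        linarith
  have h3 : 8 * (d * Real.exp (-x)) ≤ 1 / K := by
    rw [le_div_iff₀ hK0]; linarith
  have h4 : 1 / K ≤ a / 10000 := by
    rw [div_le_div_iff₀ hK0 (by norm_num)]
    rw [div_le_iff₀ (by positivity)] at hK
    have := mul_le_mul_of_nonneg_left ha1.le (mul_pos hK0 ha).le
    linarith
  linarith

/-! ### The probability that one epoch fails. -/

namespace RobustMDP

variable {S : Type u} {A : Type v} [Fintype S] [Nonempty S] [Fintype A] [Nonempty A]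
  [MeasurableSpace S] [MeasurableSingletonClass S]
  {Ω : Type w} [MeasurableSpace Ω] {μ : Measure Ω} [IsProbabilityMeasure μ]
  {M : RobustMDP S A} {X : SampleIdx S A → Ω → M.rewards × S}

/-- On the good events the error of an epoch iterate is halved. -/
theorem norm_vrIterate_succ_sub_le (H : M.IsSampleFamily μ X) {δ : ℝ} (hδ : 0 < δ)
    (hδM : δ ≤ M.minSupport / 47) (hr : ∀ r ∈ M.rewards, r ∈ Set.Icc (0 : ℝ) 1) {K n l : ℕ}
    {m : ℕ → ℕ} {ε ε' c₁ R : ℝ} {qs q : S → A → ℝ} (hqs : M.robustBellman δ qs = qs) (hn : n ≠ 0)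
    (hm : m (l + 1) ≠ 0) (hε : 0 ≤ ε) (hε1 : ε ≤ 1 / 25) (hε' : 0 ≤ ε') (hε1' : ε' ≤ 1 / 25)
    (hc : 10000 ≤ c₁) (hK : c₁ / (1 - M.γ) ^ 2 ≤ K) {y : SampleIdx S A → M.rewards × S}
    (hq : M.vrIterate δ K n m y l = q) (hR : ‖q - qs‖ ≤ R)
    (hin : ∀ k < K, ∀ s a,
      M.innerStates (l + 1) (k + 1) s a y ∈ goodSample n ε (pmfWeight (M.p s a)))
    (hp : ∀ s a, M.recenterStates (l + 1) s a y
      ∈ goodSample (m (l + 1)) ε' (pmfWeight (M.p s a)))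
    (hν : ∀ s a, M.recenterRewards (l + 1) s a y
      ∈ goodSample (m (l + 1)) ε' (pmfWeight (M.ν s a)))
    (hnoise : ∀ j ≤ K, ∀ s a, |noiseAvg (1 - M.γ) (fun i => M.noiseTerm δ n ε μ X qs q (l + 1) i s a
      y) j| ≤ 14 / 100 * R / Real.sqrt j)
    (hbias : (100 * ε ^ 2 + 3 * (1 / M.minSupport)
      * (Fintype.card S * (2 * Real.exp (-2 * n * (ε * M.minSupport) ^ 2)))) * R
      + 7 * ε' * (1 + ‖q‖) ≤ 12 / 100 * (1 - M.γ) * R) :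
    ‖M.vrIterate δ K n m y (l + 1) - qs‖ ≤ R / 2 := by
  classical
  have hR0 : 0 ≤ R := (norm_nonneg _).trans hR
  have hγ := M.γ_pos
  have hγ1 := M.γ_lt_one
  have hpm := M.minSupport_pos
  refine le_trans ?_ (recursion_bound_le_half (by linarith) (by linarith) hc hK hR0 hbias)
  rw [vrIterate, hq]
  refine M.norm_innerLoop_sub_le hδ.le hn hqs
    (fun k i s a => y (.inner (l + 1) k i s a)) _
    (Y := fun k s a => M.noiseTerm δ n ε μ X qs q (l + 1) k s a y)
    (c := fun k s a => M.γ * M.gapMean δ n ε μ X qs q (l + 1) (k + 1) s a)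
    (t := fun j => 14 / 100 * R / Real.sqrt j) hR (by positivity) ?_ ?_ ?_ ?_ hnoise
  · intro k hk s a
    simp only [noiseTerm, Set.indicator_of_mem (hin k hk s a)]
    change _ * dualGap δ n _ _ _ (M.innerStates (l + 1) (k + 1) s a y) = _
    ring
  · intro k hk s a
    rw [abs_mul, abs_of_pos hγ]
    exact (mul_le_of_le_one_left (abs_nonneg _) hγ1.le).trans
      (abs_gapMean_le_bias H hδ hδM hn hε hε1 hR _ _ s a)
  · exact M.norm_empiricalBellman_sub_robustBellman_le hδ hδM hr hm hε' hε1' hp hν q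
  · intro j _
    positivity

theorem dimFactor_ge (M : RobustMDP S A) :
    1 ≤ M.dimFactor ∧ (Fintype.card S : ℝ) ≤ M.dimFactor ∧
    (Fintype.card S : ℝ) * Fintype.card A ≤ M.dimFactor ∧
    (Fintype.card S : ℝ) * Fintype.card A * Fintype.card S ≤ M.dimFactor ∧
    (Fintype.card S : ℝ) * Fintype.card A * M.rewards.card ≤ M.dimFactor := by
  have hS : (1 : ℝ) ≤ Fintype.card S := by exact_mod_cast Fintype.card_pos
  have hA : (1 : ℝ) ≤ Fintype.card A := by exact_mod_cast Fintype.card_pos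
  have hSA : (Fintype.card S : ℝ) ≤ Fintype.card S * Fintype.card A :=
    le_mul_of_one_le_right (by positivity) hA
  have h1 : (Fintype.card S : ℝ) * Fintype.card A ≤ M.dimFactor :=
    le_mul_of_one_le_right (by positivity) (hS.trans (le_max_left _ _))
  refine ⟨hS.trans (hSA.trans h1), hSA.trans h1, h1, ?_, ?_⟩
  · exact mul_le_mul_of_nonneg_left (le_max_left _ _) (by positivity)
  · exact mul_le_mul_of_nonneg_left (le_max_right _ _) (by positivity)

/-- An inner sample of epoch `l` is not good with small probability. -/
theorem measureReal_exists_inner_not_good_le (H : M.IsSampleFamily μ X) {n : ℕ} (hn : n ≠ 0)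
    {ε E : ℝ} (hε : 0 ≤ ε) (hE : Real.exp (-2 * n * (ε * M.minSupport) ^ 2) ≤ E) (K l : ℕ) :
    μ.real {ω | ∃ k < K, ∃ s a, M.innerStates l (k + 1) s a (fun j => X j ω)
      ∉ goodSample n ε (pmfWeight (M.p s a))} ≤ 2 * K * M.dimFactor * E := by
  have hE0 : 0 ≤ E := (Real.exp_pos _).le.trans hE
  have h := measureReal_exists_mem_le (μ := μ)
    (Finset.range K ×ˢ (Finset.univ : Finset S) ×ˢ (Finset.univ : Finset A))
    (P := fun j ω => M.innerStates l (j.1 + 1) j.2.1 j.2.2 (fun j => X j ω)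
      ∉ goodSample n ε (pmfWeight (M.p j.2.1 j.2.2)))
    (c := Fintype.card S * (2 * E)) fun j _ =>
      (H.measureReal_inner_not_good_le hn hε l _ _ _).trans (by gcongr)
  refine (measureReal_mono ?_).trans (h.trans ?_)
  · rintro ω ⟨k, hk, s, a, hω⟩
    exact ⟨(k, s, a), by simp [hk], hω⟩
  · rw [Finset.card_product, Finset.card_product, Finset.card_range, Finset.card_univ,
      Finset.card_univ]
    push_cast
    have := mul_le_mul_of_nonneg_right M.dimFactor_ge.2.2.2.1 (by positivity : 0 ≤ K * (2 * E))
    linarith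

theorem measureReal_exists_recenter_not_good_le (H : M.IsSampleFamily μ X) {n : ℕ} (hn : n ≠ 0)
    {ε E : ℝ} (hε : 0 ≤ ε) (hE : Real.exp (-2 * n * (ε * M.minSupport) ^ 2) ≤ E) (l : ℕ) :
    μ.real {ω | ∃ s a, M.recenterStates l s a (fun j => X j ω)
        ∉ goodSample n ε (pmfWeight (M.p s a)) ∨ M.recenterRewards l s a (fun j => X j ω)
        ∉ goodSample n ε (pmfWeight (M.ν s a))} ≤ 4 * M.dimFactor * E := by
  have hE0 : 0 ≤ E := (Real.exp_pos _).le.trans hE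
  have h := measureReal_exists_mem_le (μ := μ)
    ((Finset.univ : Finset S) ×ˢ (Finset.univ : Finset A))
    (P := fun j ω => M.recenterStates l j.1 j.2 (fun j => X j ω)
        ∉ goodSample n ε (pmfWeight (M.p j.1 j.2)) ∨ M.recenterRewards l j.1 j.2 (fun j => X j ω)
        ∉ goodSample n ε (pmfWeight (M.ν j.1 j.2)))
    (c := Fintype.card S * (2 * E) + M.rewards.card * (2 * E)) fun j _ => by
      refine (measureReal_union_le _ _).trans (add_le_add ?_ ?_)
      · exact (H.measureReal_recenter_not_good_le hn hε l _ _).trans (by gcongr)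
      · exact (H.measureReal_recenter_rewards_not_good_le hn hε l _ _).trans (by gcongr)
  refine (measureReal_mono ?_).trans (h.trans ?_)
  · rintro ω ⟨s, a, hω⟩
    exact ⟨(s, a), by simp, hω⟩
  · rw [Finset.card_product, Finset.card_univ, Finset.card_univ]
    push_cast
    have h1 := mul_le_mul_of_nonneg_right M.dimFactor_ge.2.2.2.1 (by positivity : 0 ≤ 2 * E)
    have h2 := mul_le_mul_of_nonneg_right M.dimFactor_ge.2.2.2.2 (by positivity : 0 ≤ 2 * E)
    linarith

/-- The averaged noise of an epoch is large with small probability. -/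
theorem measureReal_exists_noiseAvg_gt_le (H : M.IsSampleFamily μ X) {δ : ℝ} (hδ : 0 < δ)
    (hδM : δ ≤ M.minSupport / 47) {K n l : ℕ} {m : ℕ → ℕ} {ε R x : ℝ} {qs : S → A → ℝ}
    (hn : n ≠ 0) (hε : 0 ≤ ε) (hε1 : ε ≤ 1 / 25) (hx : 0 ≤ x) :
    μ.real {ω | ‖M.vrIterate δ K n m (fun j => X j ω) l - qs‖ ≤ R ∧ ∃ k < K, ∃ s a,
      14 * ε * R * Real.sqrt (2 * stepSize (1 - M.γ) (k + 1) * x)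
        < |noiseAvg (1 - M.γ) (fun i => M.noiseTerm δ n ε μ X qs
          (M.vrIterate δ K n m (fun j => X j ω) l) (l + 1) i s a fun j => X j ω) (k + 1)|}
      ≤ 2 * K * M.dimFactor * Real.exp (-x) := by
  have hd := M.dimFactor_ge
  -- The iterate q̂_l is a function of earlier epochs, so the bound is proved for a fixed q. Keeping
  -- ‖q - qs‖ ≤ R inside the event makes it empty for the q whose noise is not controlled.
  refine measureReal_le_of_dependsOn
    (D := fun q y => ‖q - qs‖ ≤ R ∧ ∃ k < K, ∃ s a,
      14 * ε * R * Real.sqrt (2 * stepSize (1 - M.γ) (k + 1) * x)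
        < |noiseAvg (1 - M.γ) (fun i => M.noiseTerm δ n ε μ X qs q (l + 1) i s a y) (k + 1)|)
    H.measurable H.indep
    (SampleIdx.disjoint_pastBox_innerBox (T' := Finset.range (K + 1)) (n' := n))
    (M.vrIterate_dependsOn δ K n ((Finset.range (l + 1)).sup m) m l fun l' hl' =>
      Finset.le_sup (Finset.mem_range.2 (by omega))) ?_ ?_ ?_
  · intro q y y' h
    refine propext (and_congr_right fun _ => exists_congr fun k => and_congr_right fun hk =>
      exists_congr fun s => exists_congr fun a => ?_)
    have he := M.noiseAvg_noiseTerm_dependsOn δ n ε μ X qs q (l + 1) (k + 1) s a (1 - M.γ)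
      (x := y) (y := y') fun j hj => h j ?_
    · exact iff_of_eq (congrArg (fun r : ℝ =>
        14 * ε * R * Real.sqrt (2 * stepSize (1 - M.γ) (k + 1) * x) < |r|) he)
    rw [Finset.mem_coe] at hj ⊢
    rcases j with ⟨l', i, s, a⟩ | ⟨l', k', i, s, a⟩
    · exact absurd hj SampleIdx.recenter_notMem_innerBox
    · rw [SampleIdx.inner_mem_innerBox, Finset.mem_range] at hj ⊢
      exact ⟨hj.1, by omega, hj.2.2⟩
  · have := hd.1
    positivity
  · intro q
    by_cases hq : ‖q - qs‖ ≤ R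
    swap
    · have : {ω | ‖q - qs‖ ≤ R ∧ ∃ k < K, ∃ s a,
        14 * ε * R * Real.sqrt (2 * stepSize (1 - M.γ) (k + 1) * x)
        < |noiseAvg (1 - M.γ) (fun i => M.noiseTerm δ n ε μ X qs q (l + 1) i s a
          fun j => X j ω) (k + 1)|} = ∅ := by
        ext ω; simp [hq]
      rw [this, measureReal_empty]
      have := hd.1
      positivity
    have h := measureReal_exists_mem_le (μ := μ)
      (Finset.range K ×ˢ (Finset.univ : Finset S) ×ˢ (Finset.univ : Finset A))
      (P := fun j ω => 14 * ε * R * Real.sqrt (2 * stepSize (1 - M.γ) (j.1 + 1) * x)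
        < |noiseAvg (1 - M.γ) (fun i => M.noiseTerm δ n ε μ X qs q (l + 1) i j.2.1 j.2.2
          fun j => X j ω) (j.1 + 1)|)
      (c := 2 * Real.exp (-x)) fun j _ =>
        measureReal_noiseAvg_noiseTerm_le H hδ hδM hn hε hε1 hq hx _ _ _ _
    refine (measureReal_mono ?_).trans (h.trans ?_)
    · rintro ω ⟨_, k, hk, s, a, hω⟩
      exact ⟨(k, s, a), by simp [hk], hω⟩
    · rw [Finset.card_product, Finset.card_product, Finset.card_range, Finset.card_univ,
        Finset.card_univ]
      push_cast
      have := mul_le_mul_of_nonneg_right hd.2.2.1 (by positivity : 0 ≤ K * (2 * Real.exp (-x)))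
      linarith

/-- The probability that an epoch fails to halve the error. -/
theorem measureReal_epoch_fail_le (H : M.IsSampleFamily μ X) {δ : ℝ} (hδ : 0 < δ)
    (hδM : δ ≤ M.minSupport / 47) (hr : ∀ r ∈ M.rewards, r ∈ Set.Icc (0 : ℝ) 1) {K n l : ℕ}
    {m : ℕ → ℕ} {c₁ x y : ℝ} (hc : 10000 ≤ c₁) (hK : c₁ / (1 - M.γ) ^ 2 ≤ K) (hx : 2 ≤ x)
    (hy : 1 ≤ y) (hn : 10000 * x ^ 4 / (M.minSupport ^ 3 * (1 - M.γ)) ≤ n)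
    (hm : 10000 * 4 ^ (l + 1) * y ^ 2 / (M.minSupport ^ 3 * (1 - M.γ) ^ 2) ≤ m (l + 1))
    (hxd : 8 * M.dimFactor * K * Real.exp (-x) ≤ 1) :
    μ.real {ω | ‖M.vrIterate δ K n m (fun j => X j ω) l - M.qStar δ‖
        ≤ (2 : ℝ)⁻¹ ^ l * (1 - M.γ)⁻¹ ∧ (2 : ℝ)⁻¹ ^ (l + 1) * (1 - M.γ)⁻¹
        < ‖M.vrIterate δ K n m (fun j => X j ω) (l + 1) - M.qStar δ‖}
      ≤ 4 * K * M.dimFactor * Real.exp (-x) + 4 * M.dimFactor * Real.exp (-y) := by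
  have hpm := M.minSupport_pos
  have hpm1 := M.minSupport_le_one
  have hγ := M.γ_pos
  have hγ1 := M.γ_lt_one
  obtain ⟨hd1, hdS, -, -, -⟩ := M.dimFactor_ge
  set a := 1 - M.γ with ha_def
  have ha : 0 < a := by linarith
  have ha1 : a < 1 := by linarith
  set pm := M.minSupport with hpm_def
  have hn0 : n ≠ 0 := by
    rintro rfl
    exact absurd hn (not_le.2 (by rw [Nat.cast_zero]; positivity))
  have hm0 : m (l + 1) ≠ 0 := by
    intro h0
    rw [h0] at hm
    exact absurd hm (not_le.2 (by rw [Nat.cast_zero]; positivity))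
  have hK0 : (0 : ℝ) < K := lt_of_lt_of_le (by positivity) hK
  -- Inner accuracy: 14 ε R √(2 λ_j x) becomes 14 / 100 · R / √j, and 100 ε² is at most a / 100.
  set ε := Real.sqrt a / (100 * x) with hε_def
  -- Recentering accuracy: values of q̂ are only bounded by 2 / a, so ε' must be of order a² R for
  -- an error of order a R.
  set ε' := (2 : ℝ)⁻¹ ^ (l + 1) * a / 100 with hε'_def
  set R := (2 : ℝ)⁻¹ ^ l * a⁻¹ with hR_def
  have hR0 : 0 < R := by positivity
  have hsq : Real.sqrt a ≤ 1 := Real.sqrt_le_one.2 ha1.le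
  have hε : 0 ≤ ε := by positivity
  have hε1 : ε ≤ 1 / 25 := by
    rw [hε_def, div_le_div_iff₀ (by positivity) (by norm_num)]
    linarith
  have hpow : (2 : ℝ)⁻¹ ^ l ≤ 1 := pow_le_one₀ (by norm_num) (by norm_num)
  have hε' : 0 ≤ ε' := by positivity
  have hε'R : ε' = a ^ 2 * R / 200 := by
    rw [hε'_def, hR_def, pow_succ]; field_simp; norm_num
  have hε1' : ε' ≤ 1 / 25 := by
    have : (2 : ℝ)⁻¹ ^ (l + 1) ≤ 1 := pow_le_one₀ (by norm_num) (by norm_num)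
    rw [hε'_def]
    nlinarith
  have hE := exp_neg_batch_le ha hpm hpm1 hx hn
  have hE' := exp_neg_recenter_le (l + 1) ha hpm hpm1 hy hm
  have hE1 : Real.exp (-2 * n * (ε * pm) ^ 2) ≤ Real.exp (-x) :=
    hE.trans (mul_le_of_le_one_left (Real.exp_pos _).le hpm1)
  have hbias : 100 * ε ^ 2 + 3 * (1 / pm) * (Fintype.card S *
      (2 * Real.exp (-2 * n * (ε * pm) ^ 2))) ≤ 15 / 1000 * a :=
    batch_bias_le ha ha1 hpm hx (by positivity) hdS hE hc hK hxd
  have hB1 := measureReal_exists_recenter_not_good_le H hm0 hε' hE' (l + 1)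
  have hB2 := measureReal_exists_inner_not_good_le H hn0 hε hE1 K (l + 1)
  have hB3 := measureReal_exists_noiseAvg_gt_le H hδ hδM (K := K) (l := l) (m := m) (R := R)
    (qs := M.qStar δ) hn0 hε hε1 (by linarith : 0 ≤ x)
  refine (measureReal_mono ?_).trans ((measureReal_union_le _ _).trans ((add_le_add
    ((measureReal_union_le _ _).trans (add_le_add hB2 hB3)) hB1).trans (le_of_eq (by ring))))
  rintro ω ⟨hω, hω'⟩
  by_contra hcon
  simp only [Set.mem_union, Set.mem_ofPred_eq, not_or] at hcon
  obtain ⟨⟨hc2, hc3⟩, hc1⟩ := hcon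
  refine absurd hω' (not_lt.2 ?_)
  have hhalf : (2 : ℝ)⁻¹ ^ (l + 1) * a⁻¹ = R / 2 := by rw [hR_def, pow_succ]; ring
  rw [hhalf]
  push Not at hc1 hc2 hc3
  have hq : ‖M.vrIterate δ K n m (fun j => X j ω) l‖ ≤ 2 * a⁻¹ := by
    have h1 := norm_qStar_le (M := M) hδ hδM hr
    have h2 := norm_add_le (M.vrIterate δ K n m (fun j => X j ω) l - M.qStar δ) (M.qStar δ)
    rw [sub_add_cancel] at h2
    have h3 : R ≤ a⁻¹ := mul_le_of_le_one_left (by positivity) hpow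
    linarith
  refine norm_vrIterate_succ_sub_le H hδ hδM hr (ε := ε) (ε' := ε') (c₁ := c₁)
    (M.robustBellman_qStar hδ hδM) hn0 hm0 hε hε1 hε' hε1' hc hK rfl hω hc2
    (fun s a => (hc1 s a).1) (fun s a => (hc1 s a).2) (fun j hj s b => ?_) ?_
  · rcases j with _ | j
    -- At j = 0 both sides vanish, the right one because R / √0 = 0.
    · simp [noiseAvg]
    · refine (hc3 hω j hj s b).trans ?_
      have h1 := sqrt_div_mul_sqrt_stepSize_le ha hx j
      calc _ = 14 * R * (ε * Real.sqrt (2 * stepSize a (j + 1) * x)) := by ring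
        _ ≤ 14 * R * (1 / 100 / Real.sqrt ((j + 1 : ℕ) : ℝ)) := by gcongr
        _ = _ := by ring
  -- The budget 12 / 100 · a R is spent as 15 / 1000 on the bias and 105 / 1000 on the recentering
  -- error.
  · have h1 := mul_le_mul_of_nonneg_right hbias hR0.le
    have hinv : 1 ≤ a⁻¹ := (one_le_inv₀ ha).2 ha1.le
    have h2 : 7 * ε' * (1 + ‖M.vrIterate δ K n m (fun j => X j ω) l‖) ≤ 105 / 1000 * a * R := by
      calc _ ≤ 7 * ε' * (3 * a⁻¹) := by gcongr; linarith
        _ = 105 / 1000 * a * R := by rw [hε'R]; field_simp; norm_num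
    linarith

end RobustMDP

/-! ### Union over the epochs and reduction to measurable samples. -/

theorem SampleIdx.countable (S : Type u) (A : Type v) [Finite S] [Finite A] :
    Countable (SampleIdx S A) := by
  let f : SampleIdx S A → (ℕ × ℕ × S × A) ⊕ (ℕ × ℕ × ℕ × S × A) := fun j =>
    match j with
    | .recenter l i s a => .inl (l, i, s, a)
    | .inner l k i s a => .inr (l, k, i, s, a)
  refine Function.Injective.countable (f := f) ?_
  rintro (⟨l, i, s, a⟩ | ⟨l, k, i, s, a⟩) (⟨l', i', s', a'⟩ | ⟨l', k', i', s', a'⟩) h <;>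
    simp_all [f]

namespace RobustMDP

variable {S : Type u} {A : Type v} [Fintype S] [Nonempty S] [Fintype A] [Nonempty A]
  [MeasurableSpace S] [MeasurableSingletonClass S]
  {Ω : Type w} [MeasurableSpace Ω] {μ : Measure Ω} [IsProbabilityMeasure μ]

/-- With high probability every epoch iterate is accurate, for measurable samples. -/
theorem IsSampleFamily.one_sub_le_measureReal {M : RobustMDP S A}
    {X : SampleIdx S A → Ω → M.rewards × S} (H : M.IsSampleFamily μ X)
    {δ c₁ c₂ c₃ ε η : ℝ} (hc₁ : 10000 ≤ c₁) (hc₂ : 10000 ≤ c₂) (hc₃ : 10000 ≤ c₃) (hδ : 0 < δ)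
    (hδM : δ < -Real.log (1 - M.minSupport / 48))
    (hr : ∀ r ∈ M.rewards, r ∈ Set.Icc (0 : ℝ) 1) (hε : 0 < ε) (hε1 : ε < (1 - M.γ)⁻¹)
    (hη : 0 < η) (hη1 : η < 1) :
    1 - η ≤ μ.real {ω | ∀ l ≤ M.lVR ε,
      ‖M.qHat δ c₁ c₂ c₃ ε η (fun j => X j ω) l - M.qStar δ‖
        ≤ (2 : ℝ)⁻¹ ^ l * (1 - M.γ)⁻¹} := by
  have hpm := M.minSupport_pos
  have hγ := M.γ_pos
  have ha : 0 < 1 - M.γ := sub_pos.2 M.γ_lt_one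
  have hδM' : δ ≤ M.minSupport / 47 := M.le_minSupport_div hδM
  have hd1 := M.dimFactor_ge.1
  set d := M.dimFactor with hd
  -- Uses ε < 1 / (1 - γ). With no epoch the arguments of the logarithms would be 0.
  have hL : 1 ≤ M.lVR ε := by
    refine Nat.ceil_pos.2 (Real.logb_pos (by norm_num) ?_)
    rw [lt_div_iff₀ (by positivity), one_mul]
    calc ε * (1 - M.γ) < (1 - M.γ)⁻¹ * (1 - M.γ) := by gcongr
      _ = 1 := inv_mul_cancel₀ ha.ne'
  have hK : c₁ / (1 - M.γ) ^ 2 ≤ (M.kVR c₁ : ℝ) := Nat.le_ceil _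
  set K := M.kVR c₁ with hKdef
  set L := M.lVR ε with hLdef
  have hK1 : (1 : ℝ) ≤ K := by
    have : (0 : ℝ) < K := lt_of_lt_of_le (by positivity) hK
    exact_mod_cast this
  have hL1 : (1 : ℝ) ≤ L := by exact_mod_cast hL
  have hdK : 1 ≤ d * K := one_le_mul_of_one_le_of_one_le hd1 hK1
  have hdKL : 1 ≤ d * K * L := one_le_mul_of_one_le_of_one_le hdK hL1
  have hdL : 1 ≤ d * L := one_le_mul_of_one_le_of_one_le hd1 hL1
  set x := Real.log (8 * d * K * L / η) with hx
  set y := Real.log (24 * d * L / η) with hy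
  have hxa : 8 ≤ 8 * d * K * L / η := by
    rw [le_div_iff₀ hη]; nlinarith
  have hya : 8 ≤ 24 * d * L / η := by
    rw [le_div_iff₀ hη]; nlinarith
  have hlog8 : 2 ≤ Real.log 8 := by
    rw [Real.le_log_iff_exp_le (by norm_num), show (2 : ℝ) = 1 + 1 by norm_num, Real.exp_add]
    nlinarith [Real.exp_one_lt_d9, Real.exp_pos 1]
  have hx2 : 2 ≤ x := hlog8.trans (Real.log_le_log (by norm_num) hxa)
  have hy1 : 1 ≤ y := by
    have := hlog8.trans (Real.log_le_log (by norm_num) hya)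
    linarith
  have hex : Real.exp (-x) = η / (8 * d * K * L) := by
    rw [Real.exp_neg, hx, Real.exp_log (by positivity), inv_div]
  have hey : Real.exp (-y) = η / (24 * d * L) := by
    rw [Real.exp_neg, hy, Real.exp_log (by positivity), inv_div]
  have hn : 10000 * x ^ 4 / (M.minSupport ^ 3 * (1 - M.γ)) ≤ M.nVR c₁ c₂ ε η :=
    le_trans (by gcongr) (Nat.le_ceil _)
  have hm : ∀ l, 10000 * 4 ^ l * y ^ 2 / (M.minSupport ^ 3 * (1 - M.γ) ^ 2)
      ≤ M.mVR c₃ ε η l := fun l => le_trans (by gcongr) (Nat.le_ceil _)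
  have hfail := fun l => measureReal_epoch_fail_le H hδ hδM' hr (l := l) hc₁ hK hx2 hy1 hn
    (hm (l + 1)) (by
      rw [hex, mul_div_assoc', div_le_one (by positivity)]
      have : 0 ≤ 8 * d * K := by positivity
      nlinarith)
  have hsum := measureReal_exists_mem_le (μ := μ) (Finset.range L) fun l _ => hfail l
  have hbound : ((Finset.range L).card : ℝ)
      * (4 * K * d * Real.exp (-x) + 4 * d * Real.exp (-y)) ≤ η := by
    rw [Finset.card_range, hex, hey]
    have hK0 : (K : ℝ) ≠ 0 := by positivity
    have hL0 : (L : ℝ) ≠ 0 := by positivity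
    have hd0 : d ≠ 0 := by positivity
    -- The L epochs together cost η / 2 for the inner loops and η / 6 for the recentering.
    have : (L : ℝ) * (4 * K * d * (η / (8 * d * K * L)) + 4 * d * (η / (24 * d * L)))
        = 2 / 3 * η := by
      field_simp
      norm_num
    linarith
  rw [sub_le_iff_le_add]
  refine (probReal_univ (μ := μ)).ge.trans ((measureReal_mono ?_).trans
    ((measureReal_union_le _ _).trans (add_le_add (le_refl _) (hsum.trans hbound))))
  intro ω _
  by_contra hcon
  rw [Set.mem_union, not_or] at hcon
  refine hcon.1 fun l => ?_
  induction l with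
  | zero =>
    intro _
    have h := M.norm_qStar_le hδ hδM' hr
    simpa [qHat, vrIterate] using h
  | succ l ih =>
    intro hl
    by_contra hlt
    exact hcon.2 ⟨l, Finset.mem_range.2 hl, ih (by omega), not_le.1 hlt⟩

/-- Samples with the prescribed laws agree almost surely with measurable ones. -/
theorem exists_isSampleFamily (M : RobustMDP S A) {X : SampleIdx S A → Ω → M.rewards × S}
    (hX : ∀ j, HasLaw (X j)
      ((M.ν j.state j.action).toMeasure.prod (M.p j.state j.action).toMeasure) μ)
    (hind : iIndepFun X μ) :
    ∃ X' : SampleIdx S A → Ω → M.rewards × S, M.IsSampleFamily μ X' ∧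
      ∀ᵐ ω ∂μ, ∀ j, X j ω = X' j ω := by
  -- Countably many labels allow all samples to be replaced outside one null set.
  have := SampleIdx.countable S A
  have he : ∀ j, X j =ᵐ[μ] (hX j).aemeasurable.mk := fun j => (hX j).aemeasurable.ae_eq_mk
  refine ⟨fun j => (hX j).aemeasurable.mk, ⟨fun j => (hX j).aemeasurable.measurable_mk,
    hind.congr he, fun j => ?_⟩, ae_all_iff.2 he⟩
  rw [← Measure.map_congr (he j), (hX j).map_eq]

end RobustMDP

end

theorem mainTheorem3 :
    ∃ C : ℝ, 0 < C ∧ ∀ c₁ c₂ c₃ : ℝ, C ≤ c₁ → C ≤ c₂ → C ≤ c₃ →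
      ∀ (S : Type u) (A : Type v) [Fintype S] [Nonempty S] [Fintype A] [Nonempty A]
        [MeasurableSpace S] [MeasurableSingletonClass S]
        (M : RobustMDP S A) (δ ε η : ℝ),
        0 < δ → δ < -Real.log (1 - M.minSupport / 48) →
        (∀ r ∈ M.rewards, r ∈ Set.Icc (0 : ℝ) 1) →
        0 < ε → ε < (1 - M.γ)⁻¹ →
        0 < η → η < 1 →
      ∀ (Ω : Type w) [MeasurableSpace Ω] (μ : Measure Ω) [IsProbabilityMeasure μ]
        (X : SampleIdx S A → Ω → M.rewards × S),
        (∀ j, HasLaw (X j)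
          ((M.ν j.state j.action).toMeasure.prod (M.p j.state j.action).toMeasure) μ) →
        iIndepFun X μ →
        1 - η ≤ μ.real {ω | ∀ l ≤ M.lVR ε,
            ‖M.qHat δ c₁ c₂ c₃ ε η (fun j => X j ω) l - M.qStar δ‖
              ≤ (2 : ℝ)⁻¹ ^ l * (1 - M.γ)⁻¹} ∧
        1 - η ≤ μ.real {ω |
            ‖M.qHat δ c₁ c₂ c₃ ε η (fun j => X j ω) (M.lVR ε) - M.qStar δ‖
              ≤ (2 : ℝ)⁻¹ ^ (M.lVR ε) * (1 - M.γ)⁻¹} := by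
  refine ⟨10000, by norm_num, fun c₁ c₂ c₃ hc₁ hc₂ hc₃ S A _ _ _ _ _ _ M δ ε η hδ hδM hr hε hε1
    hη hη1 Ω _ μ _ X hX hind => ?_⟩
  obtain ⟨X', H, hXX'⟩ := M.exists_isSampleFamily hX hind
  have h := H.one_sub_le_measureReal hc₁ hc₂ hc₃ hδ hδM hr hε hε1 hη hη1
  have h' : 1 - η ≤ μ.real {ω | ∀ l ≤ M.lVR ε,
      ‖M.qHat δ c₁ c₂ c₃ ε η (fun j => X j ω) l - M.qStar δ‖ ≤ (2 : ℝ)⁻¹ ^ l * (1 - M.γ)⁻¹} := by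
    -- The two accuracy events agree almost everywhere, so they have the same measure without any
    -- claim of measurability.
    refine h.trans (le_of_eq (measureReal_congr (Filter.eventuallyEq_set.2 ?_)))
    filter_upwards [hXX'] with ω hω
    simp only [hω]
  exact ⟨h', h'.trans (measureReal_mono fun ω hω => hω _ le_rfl)⟩
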